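/- Let $H=(V,\mathcal E)$ be a simple $k$-uniform hypergraph (two distinct hyperedges share at most one vertex) with vertices labelled $0,\dots,n-1$ and maximum degree $\Delta\ge 1$, let $q\ge 1$ be an integer, $s=\lceil\sqrt q\,\rceil$, and let $h:[q]\to[s]$ be a balanced projection scheme, i.e. $|h^{-1}(j)|\in\{\lfloor q/s\rfloor,\lceil q/s\rceil\}$ for all $j$. Let $\mu$ be the uniform distribution on the proper $q$-colourings of $H$ (no hyperedge monochromatic). For $\epsilon\in(0,1)$ consider the following algorithm, with natural logarithms. Put $T=\lceil 50n\log\frac{2n\Delta}{\epsilon}\rceil$ and $\zeta=\frac{\epsilon}{4T}$. Sample $Y\in[s]^V$ uniformly. For $t=1,\dots,T$, let $v$ be the vertex with label $t \bmod n$, let $X'_v\leftarrow\mathrm{Sample}(\{v\},Y_{V\setminus\{v\}})$ and set $Y_v\leftarrow h(X'_v)$. Return $\mathrm{Sample}(V,Y)$. $\mathrm{Sample}(S,Y_\Lambda)$, for $S,\Lambda\subseteq V$ and $Y_\Lambda\in[s]^\Lambda$, is the following subroutine. Remove from $H$ all hyperedges $e$ that contain $u,v\in e\cap\Lambda$ with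 $Y_u\ne Y_v$. By depth-first search, find the connected components of the remaining hypergraph that meet $S$, stopping as soon as one of them has more than $4\Delta k^3\log\frac{n\Delta}{\zeta}$ hyperedges; in that case return a uniform element of $[q]^S$. Otherwise, on each of these components repeat at most $R=\big\lceil 10\big(\frac{n\Delta}{\zeta}\big)^{1/(1000\eta)}\log\frac n\zeta\big\rceil$ times, where $\eta=\frac1\Delta\big(\frac q{100}\big)^{(k-3)/2}$: colour each vertex $v$ of the component independently and uniformly from $h^{-1}(Y_v)$ if $v\in\Lambda$ and from $[q]$ if $v\notin\Lambda$, until no remaining hyperedge of the component is monochromatic. If all $R$ trials fail on some component, return a uniform element of $[q]^S$; otherwise return the restriction to $S$ of the colourings found. Running time is the number of steps when $H$ is stored as incidence lists, drawing a uniform element of $[q]$, of $[s]$ or of a fibre $h^{-1}(j)$, and evaluating $h$, take $\lfloor\log_2 q\rfloor+1$ steps each, and reading a list entry with a constant number of elementary operations, as well as computing the numerical parameters of a call, takes one step. Theorem. There is an absolute constant $C$ such that the following holds for all $\delta>0$, $0<\alpha\le 1$, $\epsilon\in(0,1)$ and all $H,k,\Delta,n,q,h$ as above. If $$k\ \ge\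 \frac{20(1+\delta)}{\delta}\qquad\text{and}\qquad q\ \ge\ 100\left(\frac{\Delta}{\alpha}\right)^{\frac{2+\delta}{k-4/\delta-4}},$$ then $H$ has a proper $q$-colouring, the algorithm returns a random colouring whose law is within total variation distance $\epsilon$ of $\mu$, and its running time is, for all random choices, at most $$C\,\Delta^2k^5\,n\left(\frac{n\Delta}{\epsilon}\right)^{\alpha/100}\log^4\!\left(\frac{n\Delta q}{\epsilon}\right).$$ -/

import Mathlib

noncomputable section

namespace HypergraphSampling

/-! ## Hypergraphs and colourings -/

/-- The number of hyperedges containing `v`. -/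
def degree {V : Type} (H : Hypergraph V) (v : V) : ℕ := {e ∈ H.edgeSet | v ∈ e}.ncard

/-- `Δ` is the maximum degree of `H`. -/
def HasMaxDegree {V : Type} (H : Hypergraph V) (Δ : ℕ) : Prop :=
  IsGreatest {d | ∃ v ∈ H.vertexSet, d = degree H v} Δ

/-- Every hyperedge consists of exactly `k` vertices. -/
def IsUniform {V : Type} (H : Hypergraph V) (k : ℕ) : Prop := ∀ e ∈ H.edgeSet, e.ncard = k

/-- Simple (linear) hypergraphs: two distinct hyperedges share at most one vertex. -/
def IsSimple {V : Type} (H : Hypergraph V) : Prop :=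
  ∀ e ∈ H.edgeSet, ∀ f ∈ H.edgeSet, e ≠ f → (e ∩ f).Subsingleton

/-- A colouring is proper if no hyperedge is monochromatic. -/
def IsProper {V κ : Type} (H : Hypergraph V) (X : V → κ) : Prop :=
  ∀ e ∈ H.edgeSet, ¬ ∃ c, ∀ v ∈ e, X v = c

open Classical in
/-- The set of proper `q`-colourings of a hypergraph on the vertices `0, …, n - 1`. -/
def properColourings {n : ℕ} (H : Hypergraph (Fin n)) (q : ℕ) : Finset (Fin n → Fin q) :=
  Finset.univ.filter (IsProper H)

/-- Total variation distance of two distributions on a finite set. -/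
def tvDist {Ω : Type} [Fintype Ω] (μ ν : PMF Ω) : ℝ :=
  (1 / 2) * ∑ x, |(μ x).toReal - (ν x).toReal|

/-- A balanced projection scheme `[q] → [s]`, `1 ≤ s ≤ q`: every fibre has `⌊q/s⌋` or `⌈q/s⌉`
elements. -/
structure ProjectionScheme (q s : ℕ) where
  toFun : Fin q → Fin s
  one_le : 1 ≤ s
  le : s ≤ q
  balanced : ∀ j, (Finset.univ.filter fun c => toFun c = j).card = ⌊(q : ℝ) / s⌋₊ ∨
    (Finset.univ.filter fun c => toFun c = j).card = ⌈(q : ℝ) / s⌉₊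

/-- The colours in the `j`-th bucket. -/
def ProjectionScheme.fibre {q s : ℕ} (h : ProjectionScheme q s) (j : Fin s) : Finset (Fin q) :=
  Finset.univ.filter fun c => h.toFun c = j

theorem ProjectionScheme.fibre_nonempty {q s : ℕ} (h : ProjectionScheme q s) (j : Fin s) :
    (h.fibre j).Nonempty := by
  have hs : (0 : ℝ) < s := by exact_mod_cast h.one_le
  have h1 : (1 : ℝ) ≤ (q : ℝ) / s := by
    rw [le_div_iff₀ hs, one_mul]; exact_mod_cast h.le
  have h2 : 1 ≤ ⌊(q : ℝ) / s⌋₊ := Nat.le_floor (by exact_mod_cast h1)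
  have h3 : ⌊(q : ℝ) / s⌋₊ ≤ ⌈(q : ℝ) / s⌉₊ := Nat.floor_le_ceil _
  rw [← Finset.card_pos]
  unfold ProjectionScheme.fibre
  rcases h.balanced j with h4 | h4 <;> omega

/-- A colour; used as the contents of memory cells that have not been written yet. -/
def ProjectionScheme.someColour {q s : ℕ} (h : ProjectionScheme q s) : Fin q :=
  ⟨0, lt_of_lt_of_le h.one_le h.le⟩

theorem ProjectionScheme.univ_colours_nonempty {q s : ℕ} (h : ProjectionScheme q s) :
    (Finset.univ : Finset (Fin q)).Nonempty := ⟨h.someColour, Finset.mem_univ _⟩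

theorem ProjectionScheme.univ_buckets_nonempty {q s : ℕ} (h : ProjectionScheme q s) :
    (Finset.univ : Finset (Fin s)).Nonempty := ⟨h.toFun h.someColour, Finset.mem_univ _⟩

/-- The incidence-list representation of a hypergraph: the hyperedges are numbered `0, …, m - 1`
without repetition, `verts e` lists the vertices of hyperedge number `e`, and `inc v` lists the
(numbers of the) hyperedges that contain `v`. -/
structure IncidenceLists {n : ℕ} (H : Hypergraph (Fin n)) (m : ℕ) where
  verts : Fin m → List (Fin n)
  inc : Fin n → List (Fin m)
  nodup_verts : ∀ e, (verts e).Nodup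
  nodup_inc : ∀ v, (inc v).Nodup
  mem_inc : ∀ v e, e ∈ inc v ↔ v ∈ verts e
  bijOn : Set.BijOn (fun e => {v | v ∈ verts e}) Set.univ H.edgeSet

/-! ## Randomised computations with a step count

A randomised computation that returns a value of type `α` is the joint distribution of the returned
value and of the number of steps. The steps of a sequential composition add up.

Cost model. One step pays for reading the next entry of an incidence list together with a constant
number of accesses to arrays and word operations (comparisons, counters, pushing on a list), and
for taking an item off a list. Drawing a uniform colour from `[q]` or from a bucket `h⁻¹(j)`,
drawing a uniform bucket, and evaluating `h` cost `⌊log₂ q⌋ + 1` steps each. The numerical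
parameters (`T`, `ζ`, and the thresholds of a call) cost one step. Recursion is on lists whose
consecutive entries are paid for one by one, or on a counter. -/

/-- Randomised computations with a step count. -/
def RandComp (α : Type) : Type := PMF (α × ℕ)

instance : Monad RandComp where
  pure a := PMF.pure (a, 0)
  bind x f := PMF.bind x fun p => PMF.map (fun r => (r.1, p.2 + r.2)) (f p.1)

/-- The joint law of the returned value and the number of steps. -/
def RandComp.law {α : Type} (x : RandComp α) : PMF (α × ℕ) := x

/-- The law of the returned value. -/
def RandComp.output {α : Type} (x : RandComp α) : PMF α := x.law.map Prod.fst

/-- The running time is at most `b`, whatever the random choices are. -/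
def RandComp.RunsIn {α : Type} (x : RandComp α) (b : ℝ) : Prop := ∀ p ∈ x.law.support, (p.2 : ℝ) ≤ b

/-- Spend `c` steps. -/
def tick (c : ℕ) : RandComp Unit := PMF.pure ((), c)

/-- Draw a uniform element of `Q` in `c` steps. -/
def draw {α : Type} (c : ℕ) (Q : Finset α) (hQ : Q.Nonempty) : RandComp α :=
  (PMF.uniformOfFinset Q hQ).map fun a => (a, c)

/-- The number of steps for drawing a colour and for evaluating a projection scheme. -/
def colourCost (q : ℕ) : ℕ := Nat.log 2 q + 1

/-! ## Rejection sampling -/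

/-- Scan a list of vertices and decide whether all values of `Z` that are defined on it agree
with each other and with the value `c` seen so far (if any). -/
def agree {n : ℕ} {κ : Type} [DecidableEq κ] (Z : Fin n → Option κ) :
    List (Fin n) → Option κ → RandComp Bool
  | [], _ => return true
  | v :: vs, c => do
    tick 1
    match Z v, c with
    | none, _ => agree Z vs c
    | some a, none => agree Z vs (some a)
    | some a, some b => if a = b then agree Z vs (some a) else return false

/-- Whether no hyperedge in a list is monochromatic with respect to `X`. -/
def allProper {n m q : ℕ} {H : Hypergraph (Fin n)} (I : IncidenceLists H m) (X : Fin n → Fin q) :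
    List (Fin m) → RandComp Bool
  | [] => return true
  | e :: es => do
    tick 1
    if ← agree (fun v => some (X v)) (I.verts e) none then return false else allProper I X es

/-- Draw a colour for a vertex from its colour list: `h⁻¹(j)` if its image is `j`, and `[q]` if it
has no image. -/
def drawColour {q s : ℕ} (h : ProjectionScheme q s) : Option (Fin s) → RandComp (Fin q)
  | some j => draw (colourCost q) (h.fibre j) (h.fibre_nonempty j)
  | none => draw (colourCost q) Finset.univ h.univ_colours_nonempty

/-- Independently draw a colour from its colour list for each vertex of a list, and write it to
the array `X`. -/
def drawColours {n q s : ℕ} (h : ProjectionScheme q s) (Y : Fin n → Option (Fin s)) :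
    List (Fin n) → (Fin n → Fin q) → RandComp (Fin n → Fin q)
  | [], X => return X
  | v :: vs, X => do
    tick 1
    let c ← drawColour h (Y v)
    drawColours h Y vs (Function.update X v c)

/-- Rejection sampling on a sub-hypergraph given by the lists of its vertices and hyperedges, with
the partial image `Y`: at most `R` trials; `none` if all of them fail. -/
def rejectionSample {n m q s : ℕ} {H : Hypergraph (Fin n)} (I : IncidenceLists H m)
    (h : ProjectionScheme q s) (Y : Fin n → Option (Fin s)) (vs : List (Fin n))
    (es : List (Fin m)) : ℕ → (Fin n → Fin q) → RandComp (Option (Fin n → Fin q))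
  | 0, _ => return none
  | R + 1, X => do
    tick 1
    let X' ← drawColours h Y vs X
    if ← allProper I X' es then return some X' else rejectionSample I h Y vs es R X'

/-! ## The connected components that meet `S` -/

/-- The state of the depth-first search: the vertices and hyperedges that have been marked in this
call (marks carry the number of the call, so that no reset is needed), the stack, and the lists of
the vertices and of the hyperedges of the current component, with the length of the latter. -/
structure SearchState (n m : ℕ) where
  markedV : Finset (Fin n)
  markedE : Finset (Fin m)
  stack : List (Fin n)
  compV : List (Fin n)
  compE : List (Fin m)
  numE : ℕ

/-- Mark the unmarked vertices of a list, and add them to the component and to the stack. -/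
def pushVertices {n m : ℕ} : List (Fin n) → SearchState n m → RandComp (SearchState n m)
  | [], σ => return σ
  | v :: vs, σ => do
    tick 1
    if v ∈ σ.markedV then pushVertices vs σ
    else pushVertices vs { σ with
      markedV := insert v σ.markedV, stack := v :: σ.stack, compV := v :: σ.compV }

/-- Go through a list of hyperedges; those that are not marked and not satisfied by `Y` are added
to the component with all their vertices. Stop with `none` once the component has more than `K`
hyperedges. -/
def scanEdges {n m s : ℕ} {H : Hypergraph (Fin n)} (I : IncidenceLists H m)
    (Y : Fin n → Option (Fin s)) (K : ℝ) :
    List (Fin m) → SearchState n m → RandComp (Option (SearchState n m))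
  | [], σ => return some σ
  | e :: es, σ => do
    tick 1
    if e ∈ σ.markedE then scanEdges I Y K es σ
    else if ← agree Y (I.verts e) none then
      if ((σ.numE + 1 : ℕ) : ℝ) > K then return none
      else
        let σ' ← pushVertices (I.verts e) { σ with
          markedE := insert e σ.markedE, compE := e :: σ.compE, numE := σ.numE + 1 }
        scanEdges I Y K es σ'
    else scanEdges I Y K es σ

/-- Process the stack until it is empty, for at most `f` rounds. -/
def search {n m s : ℕ} {H : Hypergraph (Fin n)} (I : IncidenceLists H m)
    (Y : Fin n → Option (Fin s)) (K : ℝ) :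
    ℕ → SearchState n m → RandComp (Option (SearchState n m))
  | 0, σ => return some σ
  | f + 1, σ => do
    tick 1
    match σ.stack with
    | [] => return some σ
    | v :: st =>
      match ← scanEdges I Y K (I.inc v) { σ with stack := st } with
      | none => return none
      | some σ' => search I Y K f σ'

/-- The connected components, in the hypergraph of the hyperedges not satisfied by `Y`, that contain
a vertex of the list `S`; `none` if one of them has more than `K` hyperedges. Each vertex
enters the stack at most once, hence `n` rounds are enough for a component. -/
def components {n m s : ℕ} {H : Hypergraph (Fin n)} (I : IncidenceLists H m)
    (Y : Fin n → Option (Fin s)) (K : ℝ) :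
    List (Fin n) → Finset (Fin n) → Finset (Fin m) →
      RandComp (Option (List (List (Fin n) × List (Fin m))))
  | [], _, _ => return some []
  | w :: ws, MV, ME => do
    tick 1
    if w ∈ MV then components I Y K ws MV ME
    else
      match ← search I Y K n ⟨insert w MV, ME, [w], [w], [], 0⟩ with
      | none => return none
      | some σ =>
        match ← components I Y K ws σ.markedV σ.markedE with
        | none => return none
        | some cs => return some ((σ.compV, σ.compE) :: cs)

/-! ## The subroutine `Sample` -/

/-- `η = (1/Δ) (q/100)^((k-3)/2)`. -/
def eta (k Δ q : ℕ) : ℝ := (1 / (Δ : ℝ)) * ((q : ℝ) / 100) ^ (((k : ℝ) - 3) / 2)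

/-- The bound `4 Δ k³ log(nΔ/ζ)` on the number of hyperedges of a component. -/
def sizeBound (n k Δ : ℕ) (ζ : ℝ) : ℝ := 4 * Δ * (k : ℝ) ^ 3 * Real.log (n * Δ / ζ)

/-- The number `⌈10 (nΔ/ζ)^(1/(1000η)) log(n/ζ)⌉` of trials of the rejection sampling. -/
def numTrials (n k Δ q : ℕ) (ζ : ℝ) : ℕ :=
  ⌈10 * ((n : ℝ) * Δ / ζ) ^ (1 / (1000 * eta k Δ q)) * Real.log (n / ζ)⌉₊

/-- Rejection sampling with `R` trials on each component of a list; `none` if one of them fails. -/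
def sampleComponents {n m q s : ℕ} {H : Hypergraph (Fin n)} (I : IncidenceLists H m)
    (h : ProjectionScheme q s) (Y : Fin n → Option (Fin s)) (R : ℕ) :
    List (List (Fin n) × List (Fin m)) → (Fin n → Fin q) → RandComp (Option (Fin n → Fin q))
  | [], X => return some X
  | c :: cs, X => do
    tick 1
    match ← rejectionSample I h Y c.1 c.2 R X with
    | none => return none
    | some X' => sampleComponents I h Y R cs X'

/-- `Sample(H, h, S, Y_Λ, ζ)`. The partial image `Y_Λ` is given by `Y`, with `Λ` the set of vertices
at which `Y` is not `none`, and `S` is given as a list. The result is an array `X` whose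
entries `X v`, `v ∈ S`, are the returned colours; the other entries are irrelevant. -/
def sample {n m q s : ℕ} {H : Hypergraph (Fin n)} (I : IncidenceLists H m)
    (h : ProjectionScheme q s) (k Δ : ℕ) (S : List (Fin n)) (Y : Fin n → Option (Fin s))
    (ζ : ℝ) : RandComp (Fin n → Fin q) := do
  tick 1
  match ← components I Y (sizeBound n k Δ ζ) S ∅ ∅ with
  | none => drawColours h (fun _ => none) S fun _ => h.someColour
  | some cs =>
    match ← sampleComponents I h Y (numTrials n k Δ q ζ) cs fun _ => h.someColour with
    | none => drawColours h (fun _ => none) S fun _ => h.someColour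
    | some X => return X

/-! ## The sampling algorithm -/

/-- The number `T = ⌈50 n log(2nΔ/ε)⌉` of steps of the systematic scan. -/
def numSteps (n Δ : ℕ) (ε : ℝ) : ℕ := ⌈50 * n * Real.log (2 * n * Δ / ε)⌉₊

/-- Write an independent uniform bucket to each entry of a list of vertices. -/
def drawBuckets {n q s : ℕ} (h : ProjectionScheme q s) :
    List (Fin n) → (Fin n → Fin s) → RandComp (Fin n → Fin s)
  | [], Y => return Y
  | v :: vs, Y => do
    tick 1
    let j ← draw (colourCost q) Finset.univ h.univ_buckets_nonempty
    drawBuckets h vs (Function.update Y v j)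

/-- The update of the vertex `v`. -/
def scanStep {n m q s : ℕ} {H : Hypergraph (Fin n)} (I : IncidenceLists H m)
    (h : ProjectionScheme q s) (k Δ : ℕ) (ζ : ℝ) (v : Fin n) (Y : Fin n → Fin s) :
    RandComp (Fin n → Fin s) := do
  tick 1
  let X ← sample I h k Δ [v] (Function.update (fun u => some (Y u)) v none) ζ
  tick (colourCost q)
  return Function.update Y v (h.toFun (X v))

/-- The first `t` steps of the systematic scan; step number `t` updates the vertex `t mod n`. -/
def scan {n m q s : ℕ} [NeZero n] {H : Hypergraph (Fin n)} (I : IncidenceLists H m)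
    (h : ProjectionScheme q s) (k Δ : ℕ) (ζ : ℝ) :
    ℕ → (Fin n → Fin s) → RandComp (Fin n → Fin s)
  | 0, Y => return Y
  | t + 1, Y => do
    let Y' ← scan I h k Δ ζ t Y
    scanStep I h k Δ ζ (Fin.ofNat n (t + 1)) Y'

/-- The sampling algorithm for hypergraph colourings: a uniform `Y ∈ [s]^V`, then `T` steps of the
systematic scan, then a colouring sampled given `Y`. -/
def samplingAlgorithm {n m q s : ℕ} [NeZero n] {H : Hypergraph (Fin n)} (I : IncidenceLists H m)
    (h : ProjectionScheme q s) (k Δ : ℕ) (ε : ℝ) : RandComp (Fin n → Fin q) := do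
  tick 1
  let Y₀ ← drawBuckets h (List.finRange n) fun _ => h.toFun h.someColour
  let Y ← scan I h k Δ (ε / (4 * numSteps n Δ ε)) (numSteps n Δ ε) Y₀
  sample I h k Δ (List.finRange n) (fun v => some (Y v)) (ε / (4 * numSteps n Δ ε))

end HypergraphSampling

end

open HypergraphSampling

noncomputable section

namespace HypergraphSampling

set_option linter.unusedSectionVars false

/-! ### Expectations with respect to a probability mass function -/

/-! Map a uniform proper colouring to its image under h, a random element of [s]^V. The loop of the
algorithm is the systematic-scan Glauber dynamics for this image law, except that `sample` only
approximates the exact conditional updates; the last call lifts the image Y back to a proper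
colouring from the lists h⁻¹(Y_v). The error has three sources: the mixing of the exact scan, the
truncation of the rejection sampling, and large clusters of hyperedges on which Y is constant.

Everything rests on a local lemma for product measures on lists (`avg_and_le`). With y = √(q/100)
every list has at least 8y colours, so a hyperedge is monochromatic with probability at most p =
(8y)^(-(k-1)), and the assumption on q makes pΔk small. Hence proper colourings exist, a component
with K hyperedges is accepted with probability at least (1-2p)^K (`pow_le_avg`), and conditioning on
properness costs only a bounded factor per exposed vertex (`pow_mul_avg_mul_le`).

Mixing. Take independent proper colourings Z, Z' from lists that differ only at u. Call a hyperedge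
bad if one colour c occurs at each of its vertices in Z or in Z'. Exchanging Z and Z' off the
cluster of bad hyperedges around u preserves properness, so the colour at v feels the list of u only
if v lies in that cluster (`cond_sub_le`). A shortest connection from v to u is, by linearity, a
path whose hyperedges bring k-1 fresh vertices each, so its probability is bounded by a product
(`avg_avg_badPath_le`). The influences on a vertex add up to at most 1/2. A weighted oscillation
argument turns this into a contraction by 1/2 per sweep (`exists_osc_updates`, `scanEx_le`).

Large clusters. At every time of the exact scan, prescribed buckets on W have probability at most
(2/s)^|W| (`scanEx_cylinder_le`). A large cluster contains many disjoint blocks of θ = ⌈2/δ⌉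
connected hyperedges, each block being constant under Y and having at least (k-θ)θ vertices, again
by linearity (`explore_of_cluster`). A union bound over queue explorations gives a factor 1/4 per
block (`explore_le`, `block_weight_le`).

The approximate scan is compared with the exact one step by step, and large clusters are measured
only under the exact scan (`ex_scan_le`). The running time is a worst-case count on the support of
the computation. -/

/-- The expectation of a nonnegative function. -/
def lexp {α : Type} (p : PMF α) (G : α → ENNReal) : ENNReal := ∑' a, p a * G a

theorem lexp_pure {α : Type} (a : α) (G : α → ENNReal) : lexp (PMF.pure a) G = G a := by
  unfold lexp
  rw [tsum_eq_single a]
  · simp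
  · intro b hb
    simp [PMF.pure_apply, hb]

theorem lexp_bind {α β : Type} (p : PMF α) (f : α → PMF β) (G : β → ENNReal) :
    lexp (p.bind f) G = lexp p fun a => lexp (f a) G := by
  unfold lexp
  simp only [PMF.bind_apply, ← ENNReal.tsum_mul_right, ← ENNReal.tsum_mul_left]
  rw [ENNReal.tsum_comm]
  simp only [mul_assoc]

theorem lexp_map {α β : Type} (p : PMF α) (φ : α → β) (G : β → ENNReal) :
    lexp (p.map φ) G = lexp p (G ∘ φ) := by
  unfold PMF.map
  rw [lexp_bind]
  simp [lexp_pure, Function.comp_def]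

theorem lexp_le_one {α : Type} (p : PMF α) {G : α → ENNReal} (hG : ∀ a, G a ≤ 1) :
    lexp p G ≤ 1 := by
  rw [← p.tsum_coe]
  exact ENNReal.tsum_le_tsum fun a => mul_le_of_le_one_right' (hG a)

/-! ### Randomised computations -/

/-- A property of the results and step counts that holds for all random choices. -/
def RandComp.Spec {α : Type} (x : RandComp α) (P : α → ℕ → Prop) : Prop :=
  ∀ p ∈ x.law.support, P p.1 p.2

theorem RandComp.Spec.mono {α : Type} {x : RandComp α} {P Q : α → ℕ → Prop} (h : x.Spec P)
    (hPQ : ∀ a t, P a t → Q a t) : x.Spec Q := fun p hp => hPQ _ _ (h p hp)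

theorem law_bind {α β : Type} (x : RandComp α) (f : α → RandComp β) :
    (x >>= f).law = PMF.bind x.law fun p => PMF.map (fun r => (r.1, p.2 + r.2)) (f p.1).law := rfl

theorem law_pure {α : Type} (a : α) : (pure a : RandComp α).law = PMF.pure (a, 0) := rfl

theorem law_tick (c : ℕ) : (tick c).law = PMF.pure ((), c) := rfl

theorem law_draw {α : Type} (c : ℕ) (S : Finset α) (hS : S.Nonempty) :
    (draw c S hS).law = (PMF.uniformOfFinset S hS).map fun a => (a, c) := rfl

theorem spec_pure {α : Type} {a : α} {P : α → ℕ → Prop} (h : P a 0) :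
    (pure a : RandComp α).Spec P := by
  intro p hp
  rw [law_pure, PMF.support_pure, Set.mem_singleton_iff] at hp
  subst hp
  exact h

theorem spec_bind {α β : Type} {x : RandComp α} {f : α → RandComp β} {P : α → ℕ → Prop}
    {Q : β → ℕ → Prop} (hx : x.Spec P)
    (hf : ∀ a t, P a t → (f a).Spec fun b t' => Q b (t + t')) : (x >>= f).Spec Q := by
  intro p hp
  rw [law_bind, PMF.mem_support_bind_iff] at hp
  obtain ⟨a, ha, hb⟩ := hp
  rw [PMF.mem_support_map_iff] at hb
  obtain ⟨r, hr, rfl⟩ := hb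
  exact hf a.1 a.2 (hx a ha) r hr

theorem spec_tick {c : ℕ} {P : Unit → ℕ → Prop} (h : P () c) : (tick c).Spec P := by
  intro p hp
  rw [law_tick, PMF.support_pure, Set.mem_singleton_iff] at hp
  subst hp
  exact h

theorem spec_tick_bind {β : Type} {c : ℕ} {f : Unit → RandComp β} {Q : β → ℕ → Prop}
    (hf : (f ()).Spec fun b t => Q b (c + t)) : (tick c >>= f).Spec Q :=
  spec_bind (P := fun _ t => t = c) (spec_tick rfl) (by rintro a t rfl; exact hf)

theorem spec_draw {α : Type} {c : ℕ} {S : Finset α} (hS : S.Nonempty) {P : α → ℕ → Prop}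
    (h : ∀ a ∈ S, P a c) : (draw c S hS).Spec P := by
  intro p hp
  rw [law_draw, PMF.mem_support_map_iff] at hp
  obtain ⟨a, ha, rfl⟩ := hp
  exact h a (by simpa using ha)

theorem RandComp.Spec.runsIn {α : Type} {x : RandComp α} {b : ℝ}
    (h : x.Spec fun _ t => (t : ℝ) ≤ b) : x.RunsIn b := h

/-- The expected value of a function, with values in `[0, 1]`, of the result. -/
def RandComp.ex {α : Type} (x : RandComp α) (g : α → ℝ) : ℝ :=
  (lexp x.law fun p => ENNReal.ofReal (g p.1)).toReal

/-- Functions with values in the unit interval. -/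
def UnitValued {α : Type} (g : α → ℝ) : Prop := ∀ a, 0 ≤ g a ∧ g a ≤ 1

theorem RandComp.lexp_ne_top {α : Type} (x : RandComp α) {g : α → ℝ} (hg : UnitValued g) :
    (lexp x.law fun p => ENNReal.ofReal (g p.1)) ≠ ⊤ :=
  ne_top_of_le_ne_top ENNReal.one_ne_top
    (lexp_le_one _ fun p => ENNReal.ofReal_le_one.2 (hg p.1).2)

theorem RandComp.ofReal_ex {α : Type} (x : RandComp α) {g : α → ℝ} (hg : UnitValued g) :
    ENNReal.ofReal (x.ex g) = lexp x.law fun p => ENNReal.ofReal (g p.1) :=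
  ENNReal.ofReal_toReal (x.lexp_ne_top hg)

theorem RandComp.ex_nonneg {α : Type} (x : RandComp α) (g : α → ℝ) : 0 ≤ x.ex g :=
  ENNReal.toReal_nonneg

theorem RandComp.ex_le_one {α : Type} (x : RandComp α) {g : α → ℝ} (hg : UnitValued g) :
    x.ex g ≤ 1 := by
  have := ENNReal.toReal_mono ENNReal.one_ne_top
    (lexp_le_one x.law fun p => ENNReal.ofReal_le_one.2 (hg p.1).2)
  rwa [ENNReal.toReal_one] at this

theorem RandComp.unitValued_ex {α β : Type} (f : α → RandComp β) {g : β → ℝ}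
    (hg : UnitValued g) : UnitValued fun a => (f a).ex g :=
  fun a => ⟨(f a).ex_nonneg g, (f a).ex_le_one hg⟩

theorem ex_pure {α : Type} (a : α) {g : α → ℝ} (hg : UnitValued g) :
    (pure a : RandComp α).ex g = g a := by
  unfold RandComp.ex
  rw [law_pure, lexp_pure, ENNReal.toReal_ofReal (hg a).1]

theorem ex_bind {α β : Type} (x : RandComp α) (f : α → RandComp β) {g : β → ℝ}
    (hg : UnitValued g) : (x >>= f).ex g = x.ex fun a => (f a).ex g := by
  unfold RandComp.ex
  rw [law_bind, lexp_bind]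
  simp only [lexp_map, Function.comp_def]
  congr 2
  funext p
  rw [ENNReal.ofReal_toReal ((f p.1).lexp_ne_top hg)]

theorem ex_tick_bind {β : Type} (c : ℕ) (f : Unit → RandComp β) {g : β → ℝ}
    (hg : UnitValued g) : (tick c >>= f).ex g = (f ()).ex g := by
  rw [ex_bind _ _ hg]
  rw [RandComp.ex, law_tick, lexp_pure, ENNReal.toReal_ofReal ((f ()).ex_nonneg g)]

theorem ex_draw {α : Type} (c : ℕ) {S : Finset α} (hS : S.Nonempty) {g : α → ℝ}
    (hg : UnitValued g) : (draw c S hS).ex g = (∑ a ∈ S, g a) / S.card := by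
  rw [RandComp.ex, law_draw, lexp_map]
  unfold lexp
  rw [tsum_eq_sum (s := S)]
  · rw [ENNReal.toReal_sum]
    · rw [Finset.sum_div]
      refine Finset.sum_congr rfl fun a ha => ?_
      simp [PMF.uniformOfFinset_apply, ha, ENNReal.toReal_mul, ENNReal.toReal_ofReal (hg a).1]
      ring
    · intro a ha
      simp [PMF.uniformOfFinset_apply, ha, ENNReal.mul_eq_top, hS.ne_empty]
  · intro a ha
    simp [PMF.uniformOfFinset_apply, ha]

/-- A bound valid for all random choices passes to the expectation. This is how the deterministic
specifications of the search and of the scans of lists enter the probabilistic estimates. -/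
theorem RandComp.Spec.le_ex {α : Type} {x : RandComp α} {P : α → ℕ → Prop} (h : x.Spec P)
    {g : α → ℝ} (hg : UnitValued g) {c : ℝ} (hc : ∀ a t, P a t → c ≤ g a) : c ≤ x.ex g := by
  rcases le_or_gt c 0 with h0 | h0
  · exact h0.trans (x.ex_nonneg g)
  rw [← ENNReal.ofReal_le_ofReal_iff (x.ex_nonneg g), x.ofReal_ex hg]
  have h1 : ENNReal.ofReal c = ∑' p, x.law p * ENNReal.ofReal c := by
    rw [ENNReal.tsum_mul_right, x.law.tsum_coe, one_mul]
  rw [h1]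
  refine ENNReal.tsum_le_tsum fun p => ?_
  by_cases hp : p ∈ x.law.support
  · exact mul_le_mul_right (ENNReal.ofReal_le_ofReal (hc _ _ (h p hp))) _
  · rw [PMF.mem_support_iff, not_not] at hp
    simp [hp]

theorem RandComp.ex_one_sub {α : Type} (x : RandComp α) {g : α → ℝ} (hg : UnitValued g) :
    x.ex (fun a => 1 - g a) = 1 - x.ex g := by
  have hg' : UnitValued fun a => 1 - g a := fun a =>
    ⟨sub_nonneg.2 (hg a).2, sub_le_self _ (hg a).1⟩
  have h : (lexp x.law fun p => ENNReal.ofReal (1 - g p.1)) +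
      (lexp x.law fun p => ENNReal.ofReal (g p.1)) = 1 := by
    unfold lexp
    rw [← ENNReal.tsum_add, ← x.law.tsum_coe]
    congr 1
    funext p
    rw [← mul_add, ← ENNReal.ofReal_add (hg' _).1 (hg _).1]
    simp
  have h' := congrArg ENNReal.toReal h
  rw [ENNReal.toReal_add (x.lexp_ne_top hg') (x.lexp_ne_top hg)] at h'
  simp only [ENNReal.toReal_one] at h'
  unfold RandComp.ex
  linarith

/-- For a computation with finitely many possible results, the expectation is a finite sum. -/
theorem RandComp.ex_eq_sum {α : Type} [Fintype α] (x : RandComp α) {g : α → ℝ}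
    (hg : UnitValued g) : x.ex g = ∑ a, (x.output a).toReal * g a := by
  have h : (lexp x.law fun p => ENNReal.ofReal (g p.1)) =
      lexp x.output fun a => ENNReal.ofReal (g a) := by
    unfold RandComp.output
    rw [lexp_map]
    rfl
  unfold RandComp.ex
  rw [h]
  unfold lexp
  rw [tsum_fintype, ENNReal.toReal_sum]
  · refine Finset.sum_congr rfl fun a _ => ?_
    rw [ENNReal.toReal_mul, ENNReal.toReal_ofReal (hg a).1]
  · intro a _
    exact ENNReal.mul_ne_top (PMF.apply_ne_top _ _) ENNReal.ofReal_ne_top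

theorem PMF.sum_toReal {Ω : Type} [Fintype Ω] (μ : PMF Ω) : ∑ x, (μ x).toReal = 1 := by
  rw [← ENNReal.toReal_sum fun a _ => PMF.apply_ne_top _ _]
  have := μ.tsum_coe
  rw [tsum_fintype] at this
  rw [this]; simp

/-- The total variation distance is bounded by comparing expectations of `[0, 1]`-valued
functions. -/
theorem tvDist_le {Ω : Type} [Fintype Ω] {μ ν : PMF Ω} {c : ℝ}
    (h : ∀ g : Ω → ℝ, UnitValued g →
      ∑ x, (μ x).toReal * g x ≤ ∑ x, (ν x).toReal * g x + c) : tvDist μ ν ≤ c := by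
  classical
  -- The indicator of the set where μ dominates ν realises the distance, so one-sided inequalities
  -- suffice.
  have h1 := h (fun x => if (ν x).toReal ≤ (μ x).toReal then 1 else 0)
    (fun a => by dsimp only; split_ifs <;> norm_num)
  have h2 : ∑ x, |(μ x).toReal - (ν x).toReal| =
      ∑ x, (2 * ((μ x).toReal * (if (ν x).toReal ≤ (μ x).toReal then 1 else 0)) -
        2 * ((ν x).toReal * (if (ν x).toReal ≤ (μ x).toReal then 1 else 0)) -
        (μ x).toReal + (ν x).toReal) := by
    refine Finset.sum_congr rfl fun x _ => ?_
    split_ifs with hx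
    · rw [abs_of_nonneg (sub_nonneg.2 hx)]; ring
    · rw [abs_of_neg (sub_neg.2 (not_le.1 hx))]; ring
  unfold tvDist
  rw [h2, Finset.sum_add_distrib, Finset.sum_sub_distrib, Finset.sum_sub_distrib,
    ← Finset.mul_sum, ← Finset.mul_sum, PMF.sum_toReal, PMF.sum_toReal]
  linarith

/-! ### Abstract expectations -/

/-- The indicator of a proposition. -/
def ind (p : Prop) : ℝ := by classical exact if p then 1 else 0

theorem ind_true {p : Prop} (h : p) : ind p = 1 := by simp [ind, h]

theorem ind_false {p : Prop} (h : ¬ p) : ind p = 0 := by simp [ind, h]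

theorem ind_nonneg (p : Prop) : 0 ≤ ind p := by unfold ind; split_ifs <;> norm_num

theorem ind_le_one (p : Prop) : ind p ≤ 1 := by unfold ind; split_ifs <;> norm_num

theorem ind_and (p r : Prop) : ind (p ∧ r) = ind p * ind r := by
  by_cases h : p <;> by_cases h' : r <;> simp [ind, h, h']

theorem ind_mono {p r : Prop} (h : p → r) : ind p ≤ ind r := by
  by_cases hp : p
  · rw [ind_true hp, ind_true (h hp)]
  · rw [ind_false hp]; exact ind_nonneg r

theorem ind_congr {p r : Prop} (h : p ↔ r) : ind p = ind r := by rw [propext h]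

theorem ind_or_le (p r : Prop) : ind (p ∨ r) ≤ ind p + ind r := by
  by_cases h : p <;> by_cases h' : r <;> simp [ind, h, h']

theorem ind_exists_le {ι : Type} {s : Finset ι} {p : ι → Prop} :
    ind (∃ i ∈ s, p i) ≤ ∑ i ∈ s, ind (p i) := by
  by_cases h : ∃ i ∈ s, p i
  · obtain ⟨i, hi, hp⟩ := h
    rw [ind_true ⟨i, hi, hp⟩, ← ind_true hp]
    exact Finset.single_le_sum (f := fun i => ind (p i)) (fun j _ => ind_nonneg _) hi
  · rw [ind_false h]
    exact Finset.sum_nonneg fun j _ => ind_nonneg _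

/-- Positive normalised linear functionals on the functions on `Ω`. -/
structure IsExpectation {Ω : Type} (Φ : (Ω → ℝ) → ℝ) : Prop where
  add : ∀ f g, Φ (fun x => f x + g x) = Φ f + Φ g
  smul : ∀ (c : ℝ) f, Φ (fun x => c * f x) = c * Φ f
  mono : ∀ f g, (∀ x, f x ≤ g x) → Φ f ≤ Φ g
  one : Φ (fun _ => 1) = 1

namespace IsExpectation

variable {Ω : Type} {Φ : (Ω → ℝ) → ℝ}

theorem const (h : IsExpectation Φ) (c : ℝ) : Φ (fun _ => c) = c := by
  have := h.smul c fun _ => 1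
  simpa [h.one] using this

theorem nonneg (h : IsExpectation Φ) {f : Ω → ℝ} (hf : ∀ x, 0 ≤ f x) : 0 ≤ Φ f := by
  rw [← h.const 0]
  exact h.mono _ _ hf

theorem sub (h : IsExpectation Φ) (f g : Ω → ℝ) :
    Φ (fun x => f x - g x) = Φ f - Φ g := by
  have := h.add (fun x => f x - g x) g
  simp only [sub_add_cancel] at this
  linarith

theorem sum (h : IsExpectation Φ) {ι : Type} (s : Finset ι) (f : ι → Ω → ℝ) :
    Φ (fun x => ∑ i ∈ s, f i x) = ∑ i ∈ s, Φ (f i) := by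
  classical
  induction s using Finset.induction_on with
  | empty => simpa using h.const 0
  | insert a s ha ih =>
    simp only [Finset.sum_insert ha]
    rw [h.add, ih]

theorem unitValued (h : IsExpectation Φ) {g : Ω → ℝ} (hg : UnitValued g) :
    0 ≤ Φ g ∧ Φ g ≤ 1 := by
  refine ⟨h.nonneg fun x => (hg x).1, ?_⟩
  rw [← h.one]
  exact h.mono _ _ fun x => (hg x).2

theorem bind {Ω' : Type} (h : IsExpectation Φ) {Ψ : Ω → (Ω' → ℝ) → ℝ}
    (h' : ∀ x, IsExpectation (Ψ x)) : IsExpectation fun g => Φ fun x => Ψ x g where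
  add _ _ := by simp only [(h' _).add, h.add]
  smul _ _ := by simp only [(h' _).smul, h.smul]
  mono _ _ hfg := h.mono _ _ fun x => (h' x).mono _ _ hfg
  one := by simp only [(h' _).one, h.one]

theorem map {Ω' : Type} (h : IsExpectation Φ) (φ : Ω → Ω') :
    IsExpectation fun g : Ω' → ℝ => Φ fun x => g (φ x) where
  add _ _ := h.add _ _
  smul _ _ := h.smul _ _
  mono _ _ hfg := h.mono _ _ fun _ => hfg _
  one := h.one

/-- Two expectations of a function whose values differ by at most `D` differ by at most `D`. -/
theorem le_add {Φ Ψ : (Ω → ℝ) → ℝ} (h : IsExpectation Φ) (h' : IsExpectation Ψ) {f : Ω → ℝ}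
    {D : ℝ} (hf : ∀ x y, f x ≤ f y + D) : Φ f ≤ Ψ f + D := by
  have h1 : ∀ y, Φ f ≤ f y + D := fun y => by
    rw [← h.const (f y + D)]
    exact h.mono _ _ fun x => hf x y
  have h2 := h'.mono (fun _ => Φ f) (fun y => f y + D) h1
  rw [h'.const, h'.add, h'.const] at h2
  exact h2

end IsExpectation

/-! ### Averages over list colourings -/


section Avg

variable {V κ : Type} [Fintype V] [DecidableEq V]

/-- The average of a function over all colourings from the lists `L`. -/
def avg (L : V → Finset κ) (F : (V → κ) → ℝ) : ℝ :=
  (∑ Z ∈ Fintype.piFinset L, F Z) / (Fintype.piFinset L).card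

theorem card_piFinset_pos {L : V → Finset κ} (hL : ∀ v, (L v).Nonempty) :
    (0 : ℝ) < (Fintype.piFinset L).card := by
  exact_mod_cast Finset.card_pos.2 (Fintype.piFinset_nonempty.2 hL)

theorem isExpectation_avg {L : V → Finset κ} (hL : ∀ v, (L v).Nonempty) :
    IsExpectation (avg L) where
  add f g := by simp [avg, Finset.sum_add_distrib, add_div]
  smul c f := by simp [avg, ← Finset.mul_sum, mul_div_assoc]
  mono f g h := by
    unfold avg
    gcongr
    exact h _
  one := by
    have := (card_piFinset_pos hL).ne'
    simp only [avg, Finset.sum_const, nsmul_eq_mul, mul_one]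
    exact div_self this

theorem avg_congr {L : V → Finset κ} {F G : (V → κ) → ℝ}
    (h : ∀ Z, (∀ v, Z v ∈ L v) → F Z = G Z) : avg L F = avg L G := by
  unfold avg
  congr 1
  exact Finset.sum_congr rfl fun Z hZ => h Z (Fintype.mem_piFinset.1 hZ)

theorem avg_mono {L : V → Finset κ} {F G : (V → κ) → ℝ}
    (h : ∀ Z, (∀ v, Z v ∈ L v) → F Z ≤ G Z) : avg L F ≤ avg L G := by
  unfold avg
  gcongr with Z hZ
  exact h Z (Fintype.mem_piFinset.1 hZ)

theorem avg_nonneg {L : V → Finset κ} {F : (V → κ) → ℝ}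
    (h : ∀ Z, (∀ v, Z v ∈ L v) → 0 ≤ F Z) : 0 ≤ avg L F :=
  div_nonneg (Finset.sum_nonneg fun Z hZ => h Z (Fintype.mem_piFinset.1 hZ)) (Nat.cast_nonneg _)

theorem avg_mul_left (L : V → Finset κ) (c : ℝ) (F : (V → κ) → ℝ) :
    avg L (fun Z => c * F Z) = c * avg L F := by
  simp [avg, ← Finset.mul_sum, mul_div_assoc]

theorem avg_mul_right (L : V → Finset κ) (c : ℝ) (F : (V → κ) → ℝ) :
    avg L (fun Z => F Z * c) = avg L F * c := by
  simp [avg, ← Finset.sum_mul, div_mul_eq_mul_div]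

theorem avg_add (L : V → Finset κ) (F G : (V → κ) → ℝ) :
    avg L (fun Z => F Z + G Z) = avg L F + avg L G := by
  simp [avg, Finset.sum_add_distrib, add_div]

theorem avg_sub (L : V → Finset κ) (F G : (V → κ) → ℝ) :
    avg L (fun Z => F Z - G Z) = avg L F - avg L G := by
  simp [avg, Finset.sum_sub_distrib, sub_div]

theorem avg_sum (L : V → Finset κ) {ι : Type} (s : Finset ι) (F : ι → (V → κ) → ℝ) :
    avg L (fun Z => ∑ i ∈ s, F i Z) = ∑ i ∈ s, avg L (F i) := by
  unfold avg
  rw [Finset.sum_comm, Finset.sum_div]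

theorem avg_const {L : V → Finset κ} (hL : ∀ v, (L v).Nonempty) (c : ℝ) :
    avg L (fun _ => c) = c := (isExpectation_avg hL).const c

theorem avg_avg (L₁ L₂ : V → Finset κ) (F : (V → κ) → (V → κ) → ℝ) :
    avg L₁ (fun Z => avg L₂ (F Z)) =
      (∑ p ∈ Fintype.piFinset L₁ ×ˢ Fintype.piFinset L₂, F p.1 p.2) /
        ((Fintype.piFinset L₁).card * (Fintype.piFinset L₂).card) := by
  unfold avg
  rw [Finset.sum_product, ← Finset.sum_div, div_div, mul_comm]

/-- The colouring that agrees with `Z` on `W` and with `Z'` elsewhere. -/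
def mix (W : Finset V) (Z Z' : V → κ) : V → κ := fun v => if v ∈ W then Z v else Z' v

/-- Exchanging two colourings off a set `W` of vertices, which may depend on the colourings as long
as the exchange does not alter it. -/
theorem avg_swap {L₁ L₂ : V → Finset κ} (W : (V → κ) → (V → κ) → Finset V)
    (hW : ∀ Z Z', W (mix (W Z Z') Z Z') (mix (W Z Z') Z' Z) = W Z Z')
    (hL : ∀ Z Z' v, v ∉ W Z Z' → L₁ v = L₂ v) (F : (V → κ) → (V → κ) → ℝ) :
    avg L₁ (fun Z => avg L₂ (F Z)) =
      avg L₁ fun Z => avg L₂ fun Z' =>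
        F (mix (W Z Z') Z Z') (mix (W Z Z') Z' Z) := by
  rw [avg_avg, avg_avg]
  congr 1
  have key : ∀ Z Z' : V → κ,
      mix (W Z Z') (mix (W Z Z') Z Z') (mix (W Z Z') Z' Z) = Z := by
    intro Z Z'
    funext v
    by_cases hv : v ∈ W Z Z' <;> simp [mix, hv]
  have key' : ∀ Z Z' : V → κ,
      mix (W Z Z') (mix (W Z Z') Z' Z) (mix (W Z Z') Z Z') = Z' := by
    intro Z Z'
    funext v
    by_cases hv : v ∈ W Z Z' <;> simp [mix, hv]
  have hmem : ∀ p ∈ Fintype.piFinset L₁ ×ˢ Fintype.piFinset L₂,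
      (mix (W p.1 p.2) p.1 p.2, mix (W p.1 p.2) p.2 p.1) ∈
        Fintype.piFinset L₁ ×ˢ Fintype.piFinset L₂ := by
    rintro ⟨Z, Z'⟩ hp
    simp only [Finset.mem_product, Fintype.mem_piFinset] at hp ⊢
    constructor <;> intro v <;> by_cases hv : v ∈ W Z Z'
    · simpa [mix, hv] using hp.1 v
    · simpa [mix, hv, hL Z Z' v hv] using hp.2 v
    · simpa [mix, hv] using hp.2 v
    · simpa [mix, hv, ← hL Z Z' v hv] using hp.1 v
  -- The exchange is its own inverse, because `hW` makes the second exchange use the same set.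
  refine Finset.sum_nbij'
    (fun p => (mix (W p.1 p.2) p.1 p.2, mix (W p.1 p.2) p.2 p.1))
    (fun p => (mix (W p.1 p.2) p.1 p.2, mix (W p.1 p.2) p.2 p.1))
    hmem hmem ?_ ?_ ?_
  · rintro ⟨Z, Z'⟩ _
    simp only [hW, key, key']
  · rintro ⟨Z, Z'⟩ _
    simp only [hW, key, key']
  · rintro ⟨Z, Z'⟩ _
    simp only [hW, key, key']

/-- `F` depends only on the colours in `W`. -/
def DepOn {β : Type} (F : (V → κ) → β) (W : Finset V) : Prop :=
  ∀ Z Z', (∀ v ∈ W, Z v = Z' v) → F Z = F Z'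

theorem DepOn.mono {β : Type} {F : (V → κ) → β} {W W' : Finset V} (h : DepOn F W)
    (hW : W ⊆ W') : DepOn F W' := fun Z Z' hZ => h Z Z' fun v hv => hZ v (hW hv)

theorem DepOn.comp {β γ : Type} {F : (V → κ) → β} {W : Finset V} (h : DepOn F W) (φ : β → γ) :
    DepOn (fun Z => φ (F Z)) W := fun Z Z' hZ => congrArg φ (h Z Z' hZ)

theorem DepOn.mul {F G : (V → κ) → ℝ} {W : Finset V} (hF : DepOn F W) (hG : DepOn G W) :
    DepOn (fun Z => F Z * G Z) W := fun Z Z' hZ => by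
  dsimp only
  rw [hF Z Z' hZ, hG Z Z' hZ]

theorem DepOn.ind {P : (V → κ) → Prop} {W : Finset V} (h : DepOn P W) :
    DepOn (fun Z => HypergraphSampling.ind (P Z)) W := h.comp _

/-- Disjoint sets of vertices are coloured independently. -/
theorem avg_avg_of_disjoint {L : V → Finset κ} (hL : ∀ v, (L v).Nonempty) {W W' : Finset V}
    (hd : Disjoint W W') {F : (V → κ) → (V → κ) → ℝ} (h : ∀ Z', DepOn (fun Z => F Z Z') W)
    (h' : ∀ Z, DepOn (F Z) W') :
    avg L (fun Z => avg L (F Z)) = avg L fun Z => F Z Z := by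
  -- After exchanging off `W`, the first argument agrees with `Z` on `W` and the second agrees with
  -- `Z` on `W'`: two independent colourings have been merged into one.
  have h1 := avg_swap (L₁ := L) (L₂ := L) (fun _ _ => W) (fun _ _ => rfl) (fun _ _ _ _ => rfl) F
  rw [h1]
  have h2 : ∀ Z, avg L (fun Z' => F (mix W Z Z') (mix W Z' Z)) = F Z Z := by
    intro Z
    rw [← avg_const hL (F Z Z)]
    congr 1
    funext Z'
    have h3 : F (mix W Z Z') (mix W Z' Z) = F Z (mix W Z' Z) :=
      h (mix W Z' Z) (mix W Z Z') Z fun v hv => by simp [mix, hv]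
    rw [h3]
    exact h' Z _ _ fun v hv => by
      simp [mix, Finset.disjoint_right.1 hd hv]
  simp only [h2]

theorem avg_mul_of_disjoint {L : V → Finset κ} (hL : ∀ v, (L v).Nonempty) {W W' : Finset V}
    (hd : Disjoint W W') {f g : (V → κ) → ℝ} (hf : DepOn f W) (hg : DepOn g W') :
    avg L (fun Z => f Z * g Z) = avg L f * avg L g := by
  rw [← avg_avg_of_disjoint hL hd (F := fun Z Z' => f Z * g Z') (fun Z' => hf.comp (· * g Z'))
    (fun Z => hg.comp (f Z * ·))]
  simp only [avg_mul_left, avg_mul_right]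

theorem avg_prod (L : V → Finset κ) (f : V → κ → ℝ) :
    avg L (fun Z => ∏ v, f v (Z v)) = ∏ v, (∑ c ∈ L v, f v c) / (L v).card := by
  unfold avg
  rw [← Finset.prod_univ_sum, Fintype.card_piFinset, Finset.prod_div_distrib]
  push_cast
  rfl

/-- Resampling the colour of one vertex. -/
theorem avg_update {L : V → Finset κ} (hL : ∀ v, (L v).Nonempty) (v : V)
    (F : (V → κ) → ℝ) :
    avg L F = (∑ c ∈ L v, avg L fun Z => F (Function.update Z v c)) / (L v).card := by
  have h1 := avg_avg_of_disjoint hL (W := {v}) (W' := Finset.univ.erase v)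
    (by simp) (F := fun Z Z' => F (Function.update Z' v (Z v)))
    (fun Z' Z₁ Z₂ hZ => by simp [hZ v (Finset.mem_singleton_self v)])
    (fun Z Z₁ Z₂ hZ => by
      refine congrArg F (funext fun w => ?_)
      by_cases hw : w = v
      · subst hw; simp
      · simp [Function.update_of_ne hw, hZ w (by simp [hw])])
  simp only [Function.update_eq_self] at h1
  rw [← h1]
  have h2 : (fun Z : V → κ => avg L fun Z' => F (Function.update Z' v (Z v))) =
      fun Z => avg L (fun Z' => F (Function.update Z' v (Z v))) *
        ∏ w, (fun _ => 1 : V → κ → ℝ) w (Z w) := by simp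
  have h3 : ∀ φ : κ → ℝ, avg L (fun Z => φ (Z v)) = (∑ c ∈ L v, φ c) / (L v).card := by
    intro φ
    have h4 := avg_prod L fun w c => if w = v then φ c else 1
    have h5 : ∀ Z : V → κ, (∏ w, if w = v then φ (Z w) else 1) = φ (Z v) := by
      intro Z
      rw [Finset.prod_ite_eq' Finset.univ v fun w => φ (Z w)]
      simp
    simp only [h5] at h4
    rw [h4, Finset.prod_eq_single v]
    · simp
    · intro w _ hw
      have : ((L w).card : ℝ) ≠ 0 := by exact_mod_cast (Finset.card_pos.2 (hL w)).ne'
      simp [hw, this]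
    · simp
  rw [h3 fun c => avg L fun Z' => F (Function.update Z' v c)]

theorem avg_cylinder_le {L : V → Finset κ} {b : ℝ} (hb : 0 < b) (hL : ∀ v, b ≤ (L v).card)
    (W : Finset V) (τ : V → κ) :
    avg L (fun Z => ind (∀ v ∈ W, Z v = τ v)) ≤ (1 / b) ^ W.card := by
  have h1 : ∀ Z : V → κ, ind (∀ v ∈ W, Z v = τ v) =
      ∏ v, (if v ∈ W then ind (Z v = τ v) else 1) := by
    intro Z
    rw [Finset.prod_ite_mem]
    by_cases h : ∀ v ∈ W, Z v = τ v
    · rw [ind_true h, Finset.univ_inter, Finset.prod_eq_one fun v hv => ind_true (h v hv)]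
    · rw [ind_false h]
      push Not at h
      obtain ⟨v, hv, hne⟩ := h
      exact (Finset.prod_eq_zero (i := v) (by simpa using hv) (ind_false hne)).symm
  simp only [h1]
  rw [avg_prod L fun v c => if v ∈ W then ind (c = τ v) else 1]
  have h2 : (1 / b) ^ W.card = ∏ v : V, if v ∈ W then 1 / b else 1 := by
    rw [Finset.prod_ite_mem]
    simp
  rw [h2]
  refine Finset.prod_le_prod (fun v _ => ?_) fun v _ => ?_
  · refine div_nonneg (Finset.sum_nonneg fun c _ => ?_) (Nat.cast_nonneg _)
    split_ifs
    · exact ind_nonneg _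
    · norm_num
  · have hpos : (0 : ℝ) < (L v).card := hb.trans_le (hL v)
    split_ifs with hv
    · have : ∑ c ∈ L v, ind (c = τ v) ≤ 1 := by
        classical
        calc ∑ c ∈ L v, ind (c = τ v) = ∑ c ∈ L v, if c = τ v then (1 : ℝ) else 0 :=
              Finset.sum_congr rfl fun c _ => by
                split_ifs with h
                · exact ind_true h
                · exact ind_false h
          _ ≤ 1 := by
              rw [Finset.sum_ite_eq']
              split_ifs <;> norm_num
      gcongr
      exact hL v
    · simp [hpos.ne']

/-! ### The local lemma -/

variable {ι : Type} [Fintype ι] [DecidableEq ι]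

/-- A system of bad events: the event `A e` depends on the colours in `ed e` and has probability at
most `p`, and `ed e` meets at most `d` of the sets `ed f`, where `4pd ≤ 1`. -/
structure LocalSystem (L : V → Finset κ) (ed : ι → Finset V) (A : ι → (V → κ) → Prop)
    (p : ℝ) (d : ℕ) : Prop where
  nonempty : ∀ v, (L v).Nonempty
  dep : ∀ e, DepOn (A e) (ed e)
  prob : ∀ e, avg L (fun Z => ind (A e Z)) ≤ p
  deg : ∀ e, (Finset.univ.filter fun f => ¬ Disjoint (ed f) (ed e)).card ≤ d
  nonneg : 0 ≤ p
  small : 4 * p * d ≤ 1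

/-- None of the bad events in `E` occurs. -/
def Avoids (A : ι → (V → κ) → Prop) (E : Finset ι) (Z : V → κ) : Prop := ∀ e ∈ E, ¬ A e Z

theorem Avoids.dep {A : ι → (V → κ) → Prop} {ed : ι → Finset V} (h : ∀ e, DepOn (A e) (ed e))
    (E : Finset ι) : DepOn (Avoids A E) (E.biUnion ed) := by
  intro Z Z' hZ
  unfold Avoids
  refine propext (forall₂_congr fun e he => ?_)
  rw [h e Z Z' fun v hv => hZ v (Finset.mem_biUnion.2 ⟨e, he, hv⟩)]

namespace LocalSystem

variable {L : V → Finset κ} {ed : ι → Finset V} {A : ι → (V → κ) → Prop} {p : ℝ} {d : ℕ}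

theorem avg_indep (h : LocalSystem L ed A p d) {W : Finset V} {g : (V → κ) → ℝ}
    (hg : DepOn g W) (E : Finset ι) (hE : ∀ e ∈ E, Disjoint (ed e) W) :
    avg L (fun Z => g Z * ind (Avoids A E Z)) = avg L g * avg L fun Z => ind (Avoids A E Z) :=
  avg_mul_of_disjoint h.nonempty
    (Finset.disjoint_biUnion_right _ _ _ |>.2 fun e he => (hE e he).symm) hg
    (Avoids.dep h.dep E).ind

theorem ind_avoids_sub_le (E₁ E₂ : Finset ι) (Z : V → κ) :
    ind (Avoids A E₁ Z) - ∑ f ∈ E₂, ind (A f Z ∧ Avoids A E₁ Z) ≤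
      ind (Avoids A (E₁ ∪ E₂) Z) := by
  have h1 := ind_exists_le (s := E₂) (p := fun f => A f Z ∧ Avoids A E₁ Z)
  by_cases hA : Avoids A (E₁ ∪ E₂) Z
  · have := ind_le_one (Avoids A E₁ Z)
    rw [ind_true hA]
    linarith [Finset.sum_nonneg fun f (_ : f ∈ E₂) => ind_nonneg (A f Z ∧ Avoids A E₁ Z)]
  · rw [ind_false hA]
    by_cases hA' : Avoids A E₁ Z
    · have : ∃ f ∈ E₂, A f Z ∧ Avoids A E₁ Z := by
        by_contra hc
        push Not at hc
        refine hA fun e he => ?_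
        rcases Finset.mem_union.1 he with he | he
        · exact hA' e he
        · exact fun hAe => hc e he hAe hA'
      rw [ind_true this] at h1
      linarith [ind_le_one (Avoids A E₁ Z)]
    · rw [ind_false hA']
      linarith [Finset.sum_nonneg fun f (_ : f ∈ E₂) => ind_nonneg (A f Z ∧ Avoids A E₁ Z)]

theorem avg_sub_le (E₁ E₂ : Finset ι) :
    avg L (fun Z => ind (Avoids A E₁ Z)) -
        ∑ f ∈ E₂, avg L (fun Z => ind (A f Z ∧ Avoids A E₁ Z)) ≤
      avg L fun Z => ind (Avoids A (E₁ ∪ E₂) Z) := by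
  rw [← avg_sum, ← avg_sub]
  exact avg_mono fun Z _ => ind_avoids_sub_le E₁ E₂ Z

/-- Conditionally on avoiding other bad events, a bad event has probability at most `2p`. -/
theorem avg_and_le (h : LocalSystem L ed A p d) (E : Finset ι) :
    ∀ e, avg L (fun Z => ind (A e Z ∧ Avoids A E Z)) ≤
      2 * p * avg L fun Z => ind (Avoids A E Z) := by
  induction E using Finset.strongInduction with
  | H E ih =>
    intro e
    -- `N` collects the events near `e`; those in `E'` are independent of `A e`. Dropping `N` yields
    -- the bound p times the probability of avoiding `E'`. Restoring `N` costs at most a factor 2: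
    -- by induction each of its at most d events has conditional probability at most 2p, and 2pd ≤
    -- 1/2.
    set N := E.filter fun f => ¬ Disjoint (ed f) (ed e) with hN
    set E' := E.filter fun f => Disjoint (ed f) (ed e) with hE'
    have hEN : E' ∪ N = E := Finset.filter_union_filter_not_eq _ _
    have h1 : avg L (fun Z => ind (A e Z ∧ Avoids A E Z)) ≤
        p * avg L fun Z => ind (Avoids A E' Z) := by
      calc avg L (fun Z => ind (A e Z ∧ Avoids A E Z))
          ≤ avg L (fun Z => ind (A e Z) * ind (Avoids A E' Z)) := avg_mono fun Z _ => by
            rw [← ind_and]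
            exact ind_mono fun hZ => ⟨hZ.1, fun f hf => hZ.2 f (Finset.mem_filter.1 hf).1⟩
        _ = avg L (fun Z => ind (A e Z)) * avg L fun Z => ind (Avoids A E' Z) :=
            h.avg_indep (h.dep e).ind E' fun f hf => (Finset.mem_filter.1 hf).2
        _ ≤ _ := mul_le_mul_of_nonneg_right (h.prob e) (avg_nonneg fun Z _ => ind_nonneg _)
    have h2 : avg L (fun Z => ind (Avoids A E' Z)) ≤
        2 * avg L fun Z => ind (Avoids A E Z) := by
      have hpos : 0 ≤ avg L fun Z => ind (Avoids A E' Z) := avg_nonneg fun Z _ => ind_nonneg _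
      -- If `N` is empty then `E'` is all of `E`, and the induction hypothesis is neither available
      -- nor needed.
      rcases N.eq_empty_or_nonempty with hNe | ⟨f₀, hf₀⟩
      · rw [hNe, Finset.union_empty] at hEN
        rw [hEN] at hpos ⊢
        linarith
      · have hlt : E' ⊂ E := by
          refine Finset.ssubset_iff_subset_ne.2 ⟨Finset.filter_subset _ _, fun heq => ?_⟩
          rw [hN, Finset.mem_filter] at hf₀
          have := hf₀.1
          rw [← heq, hE', Finset.mem_filter] at this
          exact hf₀.2 this.2
        have h3 := avg_sub_le (L := L) (A := A) E' N
        rw [hEN] at h3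
        have h4 : ∑ f ∈ N, avg L (fun Z => ind (A f Z ∧ Avoids A E' Z)) ≤
            d * (2 * p * avg L fun Z => ind (Avoids A E' Z)) := by
          calc _ ≤ ∑ f ∈ N, 2 * p * avg L (fun Z => ind (Avoids A E' Z)) :=
                Finset.sum_le_sum fun f _ => ih E' hlt f
            _ = N.card * (2 * p * avg L fun Z => ind (Avoids A E' Z)) := by
                rw [Finset.sum_const, nsmul_eq_mul]
            _ ≤ _ := by
                have : N.card ≤ d := (Finset.card_le_card
                  (Finset.filter_subset_filter _ (Finset.subset_univ _))).trans (h.deg e)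
                have hp := h.nonneg
                gcongr
        have h5 := mul_le_mul_of_nonneg_right h.small hpos
        nlinarith
    nlinarith [h.nonneg]

theorem two_p_le (h : LocalSystem L ed A p d) (hd : 1 ≤ d) : 2 * p ≤ 1 / 2 := by
  have := h.small
  have hd' : (1 : ℝ) ≤ d := by exact_mod_cast hd
  nlinarith [h.nonneg]

/-- Chain rule: the events of `E₂` are avoided one after the other, and each keeps at least the
fraction 1 - 2p by `avg_and_le`. -/
theorem pow_mul_avg_le (h : LocalSystem L ed A p d) (hd : 1 ≤ d) (E₁ E₂ : Finset ι) :
    (1 - 2 * p) ^ E₂.card * avg L (fun Z => ind (Avoids A E₁ Z)) ≤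
      avg L fun Z => ind (Avoids A (E₁ ∪ E₂) Z) := by
  have hp := h.two_p_le hd
  induction E₂ using Finset.induction_on with
  | empty => simp
  | insert f E₂ hf ih =>
    rw [Finset.card_insert_of_notMem hf]
    have h1 := avg_sub_le (L := L) (A := A) (E₁ ∪ E₂) {f}
    rw [Finset.sum_singleton] at h1
    have h2 := h.avg_and_le (E₁ ∪ E₂) f
    have h3 : E₁ ∪ insert f E₂ = E₁ ∪ E₂ ∪ {f} := by
      ext; simp
    rw [h3]
    have h4 : (1 - 2 * p) * ((1 - 2 * p) ^ E₂.card * avg L fun Z => ind (Avoids A E₁ Z)) ≤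
        (1 - 2 * p) * avg L fun Z => ind (Avoids A (E₁ ∪ E₂) Z) :=
      mul_le_mul_of_nonneg_left ih (by linarith)
    rw [pow_succ]
    linarith

theorem pow_le_avg (h : LocalSystem L ed A p d) (hd : 1 ≤ d) (E : Finset ι) :
    (1 - 2 * p) ^ E.card ≤ avg L fun Z => ind (Avoids A E Z) := by
  have h1 := h.pow_mul_avg_le hd ∅ E
  have h2 : avg L (fun Z => ind (Avoids A ∅ Z)) = 1 := by
    rw [← avg_const h.nonempty 1]
    congr 1
    funext Z
    exact ind_true (by simp [Avoids])
  rwa [h2, mul_one, Finset.empty_union] at h1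

theorem avg_avoids_pos (h : LocalSystem L ed A p d) (hd : 1 ≤ d) (E : Finset ι) :
    0 < avg L fun Z => ind (Avoids A E Z) :=
  lt_of_lt_of_le (pow_pos (by linarith [h.two_p_le hd]) _) (h.pow_le_avg hd E)

/-- Conditioning on avoiding all bad events increases the expectation of a function of the colours
of few vertices by a bounded factor only. -/
theorem pow_mul_avg_mul_le (h : LocalSystem L ed A p d) (hd : 1 ≤ d) {W : Finset V} {t : ℕ}
    (ht : (Finset.univ.filter fun f => ¬ Disjoint (ed f) W).card ≤ t) {g : (V → κ) → ℝ}
    (hg : DepOn g W) (hg0 : ∀ Z, 0 ≤ g Z) :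
    (1 - 2 * p) ^ t * avg L (fun Z => g Z * ind (Avoids A Finset.univ Z)) ≤
      avg L g * avg L fun Z => ind (Avoids A Finset.univ Z) := by
  have hp := h.two_p_le hd
  set N := Finset.univ.filter fun f => ¬ Disjoint (ed f) W with hN
  set E' := Finset.univ.filter fun f => Disjoint (ed f) W with hE'
  have hEN : E' ∪ N = Finset.univ := Finset.filter_union_filter_not_eq _ _
  -- Forget the events that touch `W`; `g` is independent of the others. The forgotten ones are then
  -- restored at a cost of 1 - 2p each.
  have h1 : avg L (fun Z => g Z * ind (Avoids A Finset.univ Z)) ≤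
      avg L g * avg L fun Z => ind (Avoids A E' Z) := by
    rw [← h.avg_indep hg E' fun f hf => (Finset.mem_filter.1 hf).2]
    exact avg_mono fun Z _ => mul_le_mul_of_nonneg_left
      (ind_mono fun hZ f _ => hZ f (Finset.mem_univ f)) (hg0 Z)
  have h2 := h.pow_mul_avg_le hd E' N
  rw [hEN] at h2
  have h3 : (1 - 2 * p) ^ t ≤ (1 - 2 * p) ^ N.card :=
    pow_le_pow_of_le_one (by linarith) (by linarith [h.nonneg]) ht
  have hg1 : 0 ≤ avg L g := avg_nonneg fun Z _ => hg0 Z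
  have hE1 : 0 ≤ avg L fun Z => ind (Avoids A E' Z) := avg_nonneg fun Z _ => ind_nonneg _
  calc (1 - 2 * p) ^ t * avg L (fun Z => g Z * ind (Avoids A Finset.univ Z))
      ≤ (1 - 2 * p) ^ N.card * (avg L g * avg L fun Z => ind (Avoids A E' Z)) := by
        exact mul_le_mul h3 h1 (avg_nonneg fun Z _ => mul_nonneg (hg0 Z) (ind_nonneg _))
          (pow_nonneg (by linarith) _)
    _ = avg L g * ((1 - 2 * p) ^ N.card * avg L fun Z => ind (Avoids A E' Z)) := by ring
    _ ≤ _ := mul_le_mul_of_nonneg_left h2 hg1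

end LocalSystem

end Avg

/-! ### Linear families: monochromatic and bad hyperedges under independent colours -/

section Influence

variable {V κ ι : Type} [Fintype V] [DecidableEq V] [Fintype ι] [DecidableEq ι]

/-- A family of `k`-element sets with pairwise intersections of size at most one, such that every
vertex lies in at most `Δ` of them. -/
structure LinearFamily (ed : ι → Finset V) (k Δ : ℕ) : Prop where
  card : ∀ e, (ed e).card = k
  simple : ∀ e f, e ≠ f → (ed e ∩ ed f).card ≤ 1
  deg : ∀ v, (Finset.univ.filter fun e => v ∈ ed e).card ≤ Δ

theorem LinearFamily.card_touching_le {ed : ι → Finset V} {k Δ : ℕ} (h : LinearFamily ed k Δ)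
    (W : Finset V) : (Finset.univ.filter fun f => ¬ Disjoint (ed f) W).card ≤ Δ * W.card := by
  have h1 : (Finset.univ.filter fun f => ¬ Disjoint (ed f) W) ⊆
      W.biUnion fun v => Finset.univ.filter fun e => v ∈ ed e := by
    intro f hf
    rw [Finset.mem_filter, Finset.not_disjoint_iff] at hf
    obtain ⟨_, v, hv, hvW⟩ := hf
    exact Finset.mem_biUnion.2 ⟨v, hvW, by simpa using hv⟩
  refine (Finset.card_le_card h1).trans (Finset.card_biUnion_le.trans ?_)
  calc ∑ v ∈ W, (Finset.univ.filter fun e => v ∈ ed e).card ≤ ∑ v ∈ W, Δ :=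
        Finset.sum_le_sum fun v _ => h.deg v
    _ = Δ * W.card := by rw [Finset.sum_const, smul_eq_mul, mul_comm]

theorem LinearFamily.eq_of_mem {ed : ι → Finset V} {k Δ : ℕ} (h : LinearFamily ed k Δ) {e f : ι}
    {x y : V} (hxy : x ≠ y) (hxe : x ∈ ed e) (hye : y ∈ ed e) (hxf : x ∈ ed f) (hyf : y ∈ ed f) :
    e = f := by
  by_contra hef
  have h1 := h.simple e f hef
  have h2 : ({x, y} : Finset V) ⊆ ed e ∩ ed f := by
    intro z hz
    simp only [Finset.mem_insert, Finset.mem_singleton] at hz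
    rcases hz with rfl | rfl <;> simp [*]
  have h3 := Finset.card_le_card h2
  rw [Finset.card_pair hxy] at h3
  omega

/-- All vertices of `W` have the same colour. -/
def Mono (W : Finset V) (Z : V → κ) : Prop := ∃ c, ∀ v ∈ W, Z v = c

theorem Mono.dep (W : Finset V) : DepOn (Mono W : (V → κ) → Prop) W := by
  intro Z Z' h
  unfold Mono
  exact propext (exists_congr fun c => forall₂_congr fun v hv => by rw [h v hv])

/-- Reveal the colour of one vertex of `W`; each of the others matches it with probability at most
1/b. -/
theorem avg_mono_le {L : V → Finset κ} {b : ℝ} (hb : 0 < b) (hL : ∀ v, b ≤ (L v).card)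
    {W : Finset V} (hW : W.Nonempty) :
    avg L (fun Z => ind (Mono W Z)) ≤ (1 / b) ^ (W.card - 1) := by
  have hne : ∀ v, (L v).Nonempty := fun v => Finset.card_pos.1 (by
    have := hb.trans_le (hL v); exact_mod_cast this)
  obtain ⟨w, hw⟩ := hW
  have h1 : avg L (fun Z => ind (Mono W Z)) ≤
      avg L fun Z => ind (∀ v ∈ W.erase w, Z v = Z w) := avg_mono fun Z _ => ind_mono fun ⟨c, hc⟩ v hv => by
    rw [hc v (Finset.mem_of_mem_erase hv), hc w hw]
  refine h1.trans ?_
  rw [avg_update hne w]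
  have hpos : (0 : ℝ) < (L w).card := hb.trans_le (hL w)
  rw [div_le_iff₀ hpos, ← Finset.card_erase_of_mem hw, mul_comm, ← nsmul_eq_mul]
  refine Finset.sum_le_card_nsmul _ _ _ fun c _ => ?_
  refine le_trans (avg_mono fun Z _ => ind_mono fun h v hv => ?_)
    (avg_cylinder_le hb hL (W.erase w) fun _ => c)
  have := h v hv
  rwa [Function.update_self, Function.update_of_ne (Finset.ne_of_mem_erase hv)] at this

theorem LinearFamily.localSystem {ed : ι → Finset V} {k Δ : ℕ} (h : LinearFamily ed k Δ)
    (hk : 1 ≤ k) {L : V → Finset κ} {b : ℝ} (hb : 0 < b) (hL : ∀ v, b ≤ (L v).card)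
    (hsmall : 4 * (1 / b) ^ (k - 1) * (Δ * k : ℕ) ≤ 1) :
    LocalSystem L ed (fun e => Mono (ed e)) ((1 / b) ^ (k - 1)) (Δ * k) where
  nonempty v := Finset.card_pos.1 (by have := hb.trans_le (hL v); exact_mod_cast this)
  dep e := Mono.dep _
  prob e := by
    have := avg_mono_le hb hL (W := ed e) (Finset.card_pos.1 (by rw [h.card]; omega))
    rwa [h.card] at this
  deg e := by
    have := h.card_touching_le (ed e)
    rwa [h.card] at this
  nonneg := by positivity
  small := hsmall

/-- A colour is available for all vertices of `W` in one of two colourings. -/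
def Bad (W : Finset V) (Z Z' : V → κ) : Prop := ∃ c, ∀ v ∈ W, Z v = c ∨ Z' v = c

theorem Bad.mono {W W' : Finset V} (h : W' ⊆ W) {Z Z' : V → κ} (hb : Bad W Z Z') :
    Bad W' Z Z' := hb.imp fun _ hc v hv => hc v (h hv)

theorem avg_comm (L₁ L₂ : V → Finset κ) (F : (V → κ) → (V → κ) → ℝ) :
    avg L₁ (fun Z => avg L₂ (F Z)) = avg L₂ fun Z' => avg L₁ fun Z => F Z Z' := by
  unfold avg
  simp only [← Finset.sum_div]
  rw [Finset.sum_comm, div_right_comm]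

theorem sum_ind_eq_le (S : Finset κ) (c : κ) : ∑ c' ∈ S, ind (c' = c) ≤ 1 := by
  classical
  calc ∑ c' ∈ S, ind (c' = c) = ∑ c' ∈ S, if c' = c then (1 : ℝ) else 0 :=
        Finset.sum_congr rfl fun c' _ => by
          split_ifs with h
          · exact ind_true h
          · exact ind_false h
    _ ≤ 1 := by
        rw [Finset.sum_ite_eq']
        split_ifs <;> norm_num

theorem avg_avg_pair_le {L₁ L₂ : V → Finset κ} {b : ℝ} (hb : 0 < b)
    (hL₁ : ∀ v, b ≤ (L₁ v).card) (hL₂ : ∀ v, b ≤ (L₂ v).card) (W : Finset V) (c : κ) :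
    avg L₁ (fun Z => avg L₂ fun Z' => ind (∀ v ∈ W, Z v = c ∨ Z' v = c)) ≤
      (2 / b) ^ W.card := by
  set t : V → ℝ := fun v => (∑ c' ∈ L₂ v, ind (c' = c)) / (L₂ v).card with ht
  have hone : ∀ (L : V → Finset κ), (∀ v, b ≤ (L v).card) → ∀ v,
      (∑ c' ∈ L v, ind (c' = c)) / (L v).card ≤ 1 / b := fun L hL v => by
    have := sum_ind_eq_le (L v) c
    have hpos : (0 : ℝ) < (L v).card := hb.trans_le (hL v)
    gcongr
    exact hL v
  have ht0 : ∀ v, 0 ≤ t v := fun v =>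
    div_nonneg (Finset.sum_nonneg fun _ _ => ind_nonneg _) (Nat.cast_nonneg _)
  have h1 : ∀ Z Z' : V → κ, ind (∀ v ∈ W, Z v = c ∨ Z' v = c) ≤
      ∏ v, (if v ∈ W then ind (Z v = c) + ind (Z' v = c) else 1) := by
    intro Z Z'
    rw [Finset.prod_ite_mem, Finset.univ_inter]
    by_cases h : ∀ v ∈ W, Z v = c ∨ Z' v = c
    · rw [ind_true h, ← Finset.prod_const_one (s := W)]
      refine Finset.prod_le_prod (fun _ _ => zero_le_one) fun v hv => ?_
      have := ind_or_le (Z v = c) (Z' v = c)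
      rwa [ind_true (h v hv)] at this
    · rw [ind_false h]
      exact Finset.prod_nonneg fun v _ => add_nonneg (ind_nonneg _) (ind_nonneg _)
  have h2 : ∀ Z : V → κ, avg L₂ (fun Z' => ind (∀ v ∈ W, Z v = c ∨ Z' v = c)) ≤
      ∏ v, (if v ∈ W then ind (Z v = c) + t v else 1) := by
    intro Z
    refine (avg_mono fun Z' _ => h1 Z Z').trans ?_
    rw [avg_prod L₂ fun v c' => if v ∈ W then ind (Z v = c) + ind (c' = c) else 1]
    refine Finset.prod_le_prod (fun v _ => ?_) fun v _ => ?_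
    · refine div_nonneg (Finset.sum_nonneg fun _ _ => ?_) (Nat.cast_nonneg _)
      split_ifs
      · exact add_nonneg (ind_nonneg _) (ind_nonneg _)
      · norm_num
    · have hpos : (0 : ℝ) < (L₂ v).card := hb.trans_le (hL₂ v)
      split_ifs
      · rw [Finset.sum_add_distrib, add_div, Finset.sum_const, nsmul_eq_mul,
          mul_div_cancel_left₀ _ hpos.ne']
      · simp [hpos.ne']
  refine (avg_mono fun Z _ => h2 Z).trans ?_
  rw [avg_prod L₁ fun v c' => if v ∈ W then ind (c' = c) + t v else 1]
  have h3 : (2 / b) ^ W.card = ∏ v : V, if v ∈ W then 2 / b else 1 := by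
    rw [Finset.prod_ite_mem, Finset.univ_inter, Finset.prod_const]
  rw [h3]
  refine Finset.prod_le_prod (fun v _ => ?_) fun v _ => ?_
  · refine div_nonneg (Finset.sum_nonneg fun _ _ => ?_) (Nat.cast_nonneg _)
    split_ifs
    · exact add_nonneg (ind_nonneg _) (ht0 v)
    · norm_num
  · have hpos : (0 : ℝ) < (L₁ v).card := hb.trans_le (hL₁ v)
    split_ifs
    · rw [Finset.sum_add_distrib, add_div, Finset.sum_const, nsmul_eq_mul,
        mul_div_cancel_left₀ _ hpos.ne']
      have h4 := hone L₁ hL₁ v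
      have h5 := hone L₂ hL₂ v
      calc _ ≤ 1 / b + 1 / b := add_le_add h4 h5
        _ = 2 / b := by ring
    · simp [hpos.ne']

theorem avg_avg_first_le {L₁ L₂ : V → Finset κ} {b : ℝ} (hb : 0 < b)
    (hL₁ : ∀ v, b ≤ (L₁ v).card) (hL₂ : ∀ v, b ≤ (L₂ v).card) {W : Finset V} {w : V} :
    avg L₁ (fun Z => avg L₂ fun Z' => ind (∀ v ∈ W.erase w, Z v = Z w ∨ Z' v = Z w)) ≤
      (2 / b) ^ (W.erase w).card := by
  have hne : ∀ v, (L₁ v).Nonempty := fun v => Finset.card_pos.1 (by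
    have := hb.trans_le (hL₁ v); exact_mod_cast this)
  rw [avg_update hne w]
  have hpos : (0 : ℝ) < (L₁ w).card := hb.trans_le (hL₁ w)
  rw [div_le_iff₀ hpos, mul_comm, ← nsmul_eq_mul]
  refine Finset.sum_le_card_nsmul _ _ _ fun c _ => ?_
  refine le_trans (avg_mono fun Z _ => avg_mono fun Z' _ => ind_mono fun h v hv => ?_)
    (avg_avg_pair_le hb hL₁ hL₂ (W.erase w) c)
  have := h v hv
  rwa [Function.update_self, Function.update_of_ne (Finset.ne_of_mem_erase hv)] at this

/-- The common colour is the one of `w` in `Z` or in `Z'`, hence the leading 2. Given it, every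
other vertex has two chances of at most 1/b each. -/
theorem avg_avg_bad_le {L₁ L₂ : V → Finset κ} {b : ℝ} (hb : 0 < b)
    (hL₁ : ∀ v, b ≤ (L₁ v).card) (hL₂ : ∀ v, b ≤ (L₂ v).card) {W : Finset V}
    (hW : W.Nonempty) :
    avg L₁ (fun Z => avg L₂ fun Z' => ind (Bad W Z Z')) ≤ 2 * (2 / b) ^ (W.card - 1) := by
  obtain ⟨w, hw⟩ := hW
  have h1 : ∀ Z Z' : V → κ, ind (Bad W Z Z') ≤
      ind (∀ v ∈ W.erase w, Z v = Z w ∨ Z' v = Z w) +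
        ind (∀ v ∈ W.erase w, Z' v = Z' w ∨ Z v = Z' w) := by
    intro Z Z'
    refine (ind_mono ?_).trans (ind_or_le _ _)
    rintro ⟨c, hc⟩
    rcases hc w hw with h | h
    · exact Or.inl fun v hv => by rw [h]; exact hc v (Finset.mem_of_mem_erase hv)
    · exact Or.inr fun v hv => by rw [h]; exact (hc v (Finset.mem_of_mem_erase hv)).symm
  refine (avg_mono fun Z _ => avg_mono fun Z' _ => h1 Z Z').trans ?_
  simp only [avg_add]
  have h2 := avg_avg_first_le hb hL₁ hL₂ (W := W) (w := w)
  have h3 := avg_avg_first_le hb hL₂ hL₁ (W := W) (w := w)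
  rw [avg_comm] at h3
  rw [Finset.card_erase_of_mem hw] at h2 h3
  linarith

/-! ### Paths of bad hyperedges -/

/-- There is a path of `r` bad hyperedges from `w` to `u` in which every hyperedge avoids, except
for its first vertex, `F` and the preceding hyperedges. -/
def BadPath (ed : ι → Finset V) (u : V) (Z Z' : V → κ) : ℕ → V → Finset V → Prop
  | 0, w, _ => w = u
  | r + 1, w, F => ∃ e, w ∈ ed e ∧ Disjoint ((ed e).erase w) F ∧ Bad (ed e) Z Z' ∧
      ∃ w' ∈ ed e, BadPath ed u Z Z' r w' (F ∪ ed e)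

/-- There is a walk of `r` bad hyperedges from `w` to `u`. -/
def BadWalk (ed : ι → Finset V) (u : V) (Z Z' : V → κ) : ℕ → V → Prop
  | 0, w => w = u
  | r + 1, w => ∃ e, w ∈ ed e ∧ Bad (ed e) Z Z' ∧ ∃ w' ∈ ed e, BadWalk ed u Z Z' r w'

/-- Shortest walks are paths. Let a shortest walk leave w through e towards w', one step closer to
u. A vertex x ≠ w of e in `F` would, under the first alternative for `F`, be closer to u than
allowed. Under the second, linearity identifies the earlier hyperedge through x and w with e, all of
whose vertices, w' included, are then too far from u. -/
theorem LinearFamily.badPath_of_badWalk {ed : ι → Finset V} {k Δ : ℕ} (h : LinearFamily ed k Δ)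
    {u : V} {Z Z' : V → κ} (r : ℕ) : ∀ (w : V) (F : Finset V), BadWalk ed u Z Z' r w →
      (∀ j < r, ¬ BadWalk ed u Z Z' j w) →
      (∀ x ∈ F, x ≠ w → (∀ j < r + 1, ¬ BadWalk ed u Z Z' j x) ∨
        ∃ e, x ∈ ed e ∧ w ∈ ed e ∧ ∀ y ∈ ed e, ∀ j < r, ¬ BadWalk ed u Z Z' j y) →
      BadPath ed u Z Z' r w F := by
  induction r with
  | zero => intro w F hw _ _; exact hw
  | succ r ih =>
    intro w F hw hmin hF
    obtain ⟨e, hwe, hbad, w', hw'e, hw'⟩ := hw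
    have hdist : ∀ y ∈ ed e, ∀ j < r, ¬ BadWalk ed u Z Z' j y := fun y hy j hj hyj =>
      hmin (j + 1) (by omega) ⟨e, hwe, hbad, y, hy, hyj⟩
    refine ⟨e, hwe, ?_, hbad, w', hw'e, ih w' _ hw' (hdist w' hw'e) ?_⟩
    · rw [Finset.disjoint_left]
      intro x hx hxF
      have hxw := Finset.ne_of_mem_erase hx
      have hxe := Finset.mem_of_mem_erase hx
      rcases hF x hxF hxw with h1 | ⟨f, hxf, hwf, hf⟩
      · exact h1 (r + 1) (by omega) ⟨e, hxe, hbad, w', hw'e, hw'⟩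
      · have hef := h.eq_of_mem hxw hxe hwe hxf hwf
        subst hef
        exact hf w' hw'e r (by omega) hw'
    · intro x hx hxw'
      rcases Finset.mem_union.1 hx with hx | hx
      · by_cases hxw : x = w
        · subst hxw
          exact Or.inl hmin
        · rcases hF x hx hxw with h1 | ⟨f, hxf, hwf, hf⟩
          · exact Or.inl fun j hj => h1 j (by omega)
          · exact Or.inl fun j hj => hf x hxf j hj
      · exact Or.inr ⟨e, hx, hw'e, hdist⟩

/-- Every hyperedge brings k - 1 ≥ 1 vertices outside `F`. This makes the sum over path lengths
finite. -/
theorem LinearFamily.badPath_length {ed : ι → Finset V} {k Δ : ℕ} (h : LinearFamily ed k Δ)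
    (hk : 2 ≤ k) {u : V} {Z Z' : V → κ} (r : ℕ) : ∀ (w : V) (F : Finset V),
      BadPath ed u Z Z' r w F → r + F.card ≤ Fintype.card V := by
  induction r with
  | zero => intro w F _; rw [zero_add]; exact Finset.card_le_univ F
  | succ r ih =>
    rintro w F ⟨e, hwe, hd, _, w', _, hw'⟩
    have h1 := ih w' _ hw'
    have h2 : F.card + ((ed e).erase w).card ≤ (F ∪ ed e).card := by
      rw [← Finset.card_union_of_disjoint hd.symm]
      exact Finset.card_le_card (Finset.union_subset_union_right (Finset.erase_subset _ _))
    rw [Finset.card_erase_of_mem hwe, h.card] at h2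
    omega

/-- The total weight of the walks with `r` hyperedges from a vertex to `u`. -/
def walkWeight (ed : ι → Finset V) (β : ℝ) (u : V) : ℕ → V → ℝ
  | 0, w => ind (w = u)
  | r + 1, w => ∑ e ∈ Finset.univ.filter fun e => w ∈ ed e, ∑ w' ∈ ed e,
      β * walkWeight ed β u r w'

theorem walkWeight_nonneg (ed : ι → Finset V) {β : ℝ} (hβ : 0 ≤ β) (u : V) (r : ℕ) :
    ∀ w, 0 ≤ walkWeight ed β u r w := by
  induction r with
  | zero => intro w; exact ind_nonneg _
  | succ r ih =>
    intro w
    exact Finset.sum_nonneg fun e _ => Finset.sum_nonneg fun w' _ => mul_nonneg hβ (ih w')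

/-- With the start fixed and the end free, each step has at most Δk continuations. -/
theorem LinearFamily.sum_walkWeight_le {ed : ι → Finset V} {k Δ : ℕ} (h : LinearFamily ed k Δ)
    {β : ℝ} (hβ : 0 ≤ β) (r : ℕ) : ∀ w, ∑ u, walkWeight ed β u r w ≤ (β * (Δ * k)) ^ r := by
  induction r with
  | zero =>
    intro w
    have : ∑ u, walkWeight ed β u 0 w = ∑ u : V, ind (u = w) :=
      Finset.sum_congr rfl fun u _ => ind_congr eq_comm
    rw [this, pow_zero]
    exact sum_ind_eq_le _ _
  | succ r ih =>
    intro w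
    simp only [walkWeight]
    rw [Finset.sum_comm]
    calc _ ≤ ∑ e ∈ Finset.univ.filter (fun e => w ∈ ed e), k * (β * (β * (Δ * k)) ^ r) := by
          refine Finset.sum_le_sum fun e _ => ?_
          rw [Finset.sum_comm, ← h.card e, ← nsmul_eq_mul]
          refine Finset.sum_le_card_nsmul _ _ _ fun w' _ => ?_
          rw [← Finset.mul_sum]
          have := ih w'
          rw [h.card e]
          gcongr
      _ = (Finset.univ.filter (fun e => w ∈ ed e)).card * (k * (β * (β * (Δ * k)) ^ r)) := by
          rw [Finset.sum_const, nsmul_eq_mul]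
      _ ≤ Δ * (k * (β * (β * (Δ * k)) ^ r)) := by
          have : ((Finset.univ.filter (fun e => w ∈ ed e)).card : ℝ) ≤ Δ := by
            exact_mod_cast h.deg w
          gcongr
      _ = _ := by ring

/-- Dependence of a function of two colourings. -/
def DepOn₂ (G : (V → κ) → (V → κ) → ℝ) (F : Finset V) : Prop :=
  (∀ Z', DepOn (fun Z => G Z Z') F) ∧ ∀ Z, DepOn (G Z) F

theorem DepOn₂.mul {G G' : (V → κ) → (V → κ) → ℝ} {F : Finset V} (h : DepOn₂ G F)
    (h' : DepOn₂ G' F) : DepOn₂ (fun Z Z' => G Z Z' * G' Z Z') F :=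
  ⟨fun Z' => (h.1 Z').mul (h'.1 Z'), fun Z => (h.2 Z).mul (h'.2 Z)⟩

theorem DepOn₂.mono {G : (V → κ) → (V → κ) → ℝ} {F F' : Finset V} (h : DepOn₂ G F)
    (hF : F ⊆ F') : DepOn₂ G F' := ⟨fun Z' => (h.1 Z').mono hF, fun Z => (h.2 Z).mono hF⟩

theorem DepOn₂.avg {G : (V → κ) → (V → κ) → ℝ} {F : Finset V} (h : DepOn₂ G F)
    (L : V → Finset κ) : DepOn (fun Z => avg L (G Z)) F := fun Z₁ Z₂ hZ => by
  dsimp only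
  congr 1
  funext Z'
  exact h.1 Z' Z₁ Z₂ hZ

theorem DepOn₂.bad (W : Finset V) : DepOn₂ (fun Z Z' : V → κ => ind (Bad W Z Z')) W := by
  constructor
  · intro Z' Z₁ Z₂ hZ
    exact ind_congr (exists_congr fun c => forall₂_congr fun v hv => by rw [hZ v hv])
  · intro Z Z₁ Z₂ hZ
    exact ind_congr (exists_congr fun c => forall₂_congr fun v hv => by rw [hZ v hv])

theorem avg_avg_mul_of_disjoint {L₁ L₂ : V → Finset κ} (hL₁ : ∀ v, (L₁ v).Nonempty)
    (hL₂ : ∀ v, (L₂ v).Nonempty) {W W' : Finset V} (hd : Disjoint W W')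
    {f g : (V → κ) → (V → κ) → ℝ} (hf : DepOn₂ f W) (hg : DepOn₂ g W') :
    avg L₁ (fun Z => avg L₂ fun Z' => f Z Z' * g Z Z') =
      avg L₁ (fun Z => avg L₂ (f Z)) * avg L₁ (fun Z => avg L₂ (g Z)) := by
  rw [← avg_mul_of_disjoint hL₁ hd (hf.avg L₂) (hg.avg L₂)]
  congr 1
  funext Z
  exact avg_mul_of_disjoint hL₂ hd (hf.2 Z) (hg.2 Z)

/-- Two list assignments, such that the proper colourings from them can be analysed by the local
lemma with the constants `p`, `d`. -/
structure ListPair (ed : ι → Finset V) (k Δ : ℕ) (b : ℝ) (L₁ L₂ : V → Finset κ) : Prop where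
  family : LinearFamily ed k Δ
  two_le : 2 ≤ k
  one_le : 1 ≤ Δ
  pos : 0 < b
  card₁ : ∀ v, b ≤ (L₁ v).card
  card₂ : ∀ v, b ≤ (L₂ v).card
  small : 4 * (1 / b) ^ (k - 1) * (Δ * k : ℕ) ≤ 1

/-- No set `ed e` is monochromatic. -/
def Good (ed : ι → Finset V) (Z : V → κ) : Prop :=
  Avoids (fun e => Mono (ed e)) Finset.univ Z

namespace ListPair

variable {ed : ι → Finset V} {k Δ : ℕ} {b : ℝ} {L₁ L₂ : V → Finset κ}

theorem sys₁ (h : ListPair ed k Δ b L₁ L₂) :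
    LocalSystem L₁ ed (fun e => Mono (ed e)) ((1 / b) ^ (k - 1)) (Δ * k) :=
  h.family.localSystem (by have := h.two_le; omega) h.pos h.card₁ h.small

theorem sys₂ (h : ListPair ed k Δ b L₁ L₂) :
    LocalSystem L₂ ed (fun e => Mono (ed e)) ((1 / b) ^ (k - 1)) (Δ * k) :=
  h.family.localSystem (by have := h.two_le; omega) h.pos h.card₂ h.small

theorem one_le_deg (h : ListPair ed k Δ b L₁ L₂) : 1 ≤ Δ * k :=
  Nat.mul_pos h.one_le (by have := h.two_le; omega)

/-- The factor by which conditioning on properness may increase probabilities, per vertex. -/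
def factor (k Δ : ℕ) (b : ℝ) : ℝ := (((1 - 2 * (1 / b) ^ (k - 1)) ^ Δ) ^ 2)⁻¹

theorem base_pos (h : ListPair ed k Δ b L₁ L₂) : 0 < 1 - 2 * (1 / b) ^ (k - 1) := by
  linarith [h.sys₁.two_p_le h.one_le_deg]

theorem factor_pos (h : ListPair ed k Δ b L₁ L₂) : 0 < factor k Δ b := by
  have := h.base_pos
  unfold factor
  positivity

theorem one_le_factor (h : ListPair ed k Δ b L₁ L₂) : 1 ≤ factor k Δ b := by
  have := h.base_pos
  unfold factor
  rw [one_le_inv₀ (by positivity)]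
  refine pow_le_one₀ (by positivity) (pow_le_one₀ this.le ?_)
  have := h.sys₁.nonneg
  linarith

/-- `pow_mul_avg_mul_le` is applied to the two colourings in turn, which accounts for the square in
`factor`; `F` is touched by at most Δ|F| hyperedges. -/
theorem avg_avg_good_le (h : ListPair ed k Δ b L₁ L₂) {F : Finset V}
    {G : (V → κ) → (V → κ) → ℝ} (hG : DepOn₂ G F) (hG0 : ∀ Z Z', 0 ≤ G Z Z') :
    avg L₁ (fun Z => avg L₂ fun Z' => G Z Z' * ind (Good ed Z') * ind (Good ed Z)) ≤
      factor k Δ b ^ F.card * (avg L₁ (fun Z => ind (Good ed Z)) *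
        avg L₂ (fun Z => ind (Good ed Z)) * avg L₁ fun Z => avg L₂ (G Z)) := by
  set a := 1 - 2 * (1 / b) ^ (k - 1) with ha
  have hapos := h.base_pos
  have ht := h.family.card_touching_le F
  have h1 : ∀ Z, a ^ (Δ * F.card) * avg L₂ (fun Z' => G Z Z' * ind (Good ed Z')) ≤
      avg L₂ (G Z) * avg L₂ fun Z => ind (Good ed Z) := fun Z =>
    h.sys₂.pow_mul_avg_mul_le h.one_le_deg ht (hG.2 Z) (hG0 Z)
  have h2 := h.sys₁.pow_mul_avg_mul_le h.one_le_deg ht (hG.avg L₂)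
    (fun Z => avg_nonneg fun Z' _ => hG0 Z Z')
  have h3 : a ^ (Δ * F.card) * avg L₁ (fun Z => avg L₂ fun Z' =>
      G Z Z' * ind (Good ed Z') * ind (Good ed Z)) ≤
      avg L₁ (fun Z => avg L₂ (G Z) * ind (Good ed Z)) * avg L₂ fun Z => ind (Good ed Z) := by
    rw [← avg_mul_left, ← avg_mul_right]
    refine avg_mono fun Z _ => ?_
    rw [avg_mul_right, ← mul_assoc]
    calc _ ≤ (avg L₂ (G Z) * avg L₂ fun Z => ind (Good ed Z)) * ind (Good ed Z) :=
          mul_le_mul_of_nonneg_right (h1 Z) (ind_nonneg _)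
      _ = _ := by ring
  have hx : 0 < a ^ (Δ * F.card) := pow_pos hapos _
  have hf : factor k Δ b ^ F.card = (a ^ (Δ * F.card) * a ^ (Δ * F.card))⁻¹ := by
    unfold factor
    rw [← ha, inv_pow]
    congr 1
    ring
  rw [hf, ← div_eq_inv_mul, le_div_iff₀ (by positivity)]
  have hpos : 0 ≤ avg L₂ fun Z => ind (Good ed Z) := avg_nonneg fun Z _ => ind_nonneg _
  calc _ = a ^ (Δ * F.card) * (a ^ (Δ * F.card) * avg L₁ (fun Z => avg L₂ fun Z' =>
      G Z Z' * ind (Good ed Z') * ind (Good ed Z))) := by ring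
    _ ≤ a ^ (Δ * F.card) * (avg L₁ (fun Z => avg L₂ (G Z) * ind (Good ed Z)) *
        avg L₂ fun Z => ind (Good ed Z)) := mul_le_mul_of_nonneg_left h3 hx.le
    _ = a ^ (Δ * F.card) * avg L₁ (fun Z => avg L₂ (G Z) * ind (Good ed Z)) *
        avg L₂ (fun Z => ind (Good ed Z)) := by ring
    _ ≤ (avg L₁ (fun Z => avg L₂ (G Z)) * avg L₁ fun Z => ind (Good ed Z)) *
        avg L₂ (fun Z => ind (Good ed Z)) := mul_le_mul_of_nonneg_right h2 hpos
    _ = _ := by ring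

/-- The weight of a hyperedge in a path. -/
def edgeWeight (k : ℕ) (b : ℝ) : ℝ := 2 * (2 / b) ^ (k - 2)

/-- The function `G` lets the induction run: it carries the indicators of the bad hyperedges
traversed so far, which live on `F`. The next hyperedge meets `F` only in w, so its other vertices
are independent of `G`. Properness is dealt with only at the end of the path, where `factor` is paid
once per exposed vertex. -/
theorem avg_avg_badPath_le (h : ListPair ed k Δ b L₁ L₂) (u : V) (r : ℕ) :
    ∀ (w : V) (F : Finset V), w ∈ F → ∀ (G : (V → κ) → (V → κ) → ℝ), DepOn₂ G F →
      (∀ Z Z', 0 ≤ G Z Z') →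
      avg L₁ (fun Z => avg L₂ fun Z' => G Z Z' * ind (BadPath ed u Z Z' r w F) *
          ind (Good ed Z') * ind (Good ed Z)) ≤
        factor k Δ b ^ (F.card + r * k) * walkWeight ed (edgeWeight k b) u r w *
          (avg L₁ (fun Z => ind (Good ed Z)) * avg L₂ (fun Z => ind (Good ed Z)) *
            avg L₁ fun Z => avg L₂ (G Z)) := by
  have hβ : 0 ≤ edgeWeight k b := by
    have := h.pos
    unfold edgeWeight
    positivity
  have hne₁ := h.sys₁.nonempty
  have hne₂ := h.sys₂.nonempty
  have ha₁ : 0 ≤ avg L₁ fun Z => ind (Good ed Z) := avg_nonneg fun Z _ => ind_nonneg _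
  have ha₂ : 0 ≤ avg L₂ fun Z => ind (Good ed Z) := avg_nonneg fun Z _ => ind_nonneg _
  induction r with
  | zero =>
    intro w F hw G hG hG0
    simp only [BadPath, walkWeight, zero_mul, add_zero]
    by_cases hwu : w = u
    · rw [ind_true hwu]
      simpa using h.avg_avg_good_le hG hG0
    · rw [ind_false hwu]
      simp [avg]
  | succ r ih =>
    intro w F hw G hG hG0
    set S := Finset.univ.filter fun e => w ∈ ed e ∧ Disjoint ((ed e).erase w) F with hS
    have h1 : ∀ Z Z', G Z Z' * ind (BadPath ed u Z Z' (r + 1) w F) * ind (Good ed Z') *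
        ind (Good ed Z) ≤ ∑ e ∈ S, ∑ w' ∈ ed e, G Z Z' * ind (Bad ((ed e).erase w) Z Z') *
          ind (BadPath ed u Z Z' r w' (F ∪ ed e)) * ind (Good ed Z') * ind (Good ed Z) := by
      intro Z Z'
      have h2 : ind (BadPath ed u Z Z' (r + 1) w F) ≤ ∑ e ∈ S, ∑ w' ∈ ed e,
          ind (Bad ((ed e).erase w) Z Z') * ind (BadPath ed u Z Z' r w' (F ∪ ed e)) := by
        calc _ ≤ ind (∃ e ∈ S, ∃ w' ∈ ed e, Bad ((ed e).erase w) Z Z' ∧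
              BadPath ed u Z Z' r w' (F ∪ ed e)) := ind_mono fun ⟨e, hwe, hd, hb, w', hw', hp⟩ =>
              ⟨e, by simp [hS, hwe, hd], w', hw', hb.mono (Finset.erase_subset _ _), hp⟩
          _ ≤ ∑ e ∈ S, ind (∃ w' ∈ ed e, Bad ((ed e).erase w) Z Z' ∧
              BadPath ed u Z Z' r w' (F ∪ ed e)) := ind_exists_le
          _ ≤ _ := Finset.sum_le_sum fun e _ => by
              refine ind_exists_le.trans (le_of_eq (Finset.sum_congr rfl fun w' _ => ind_and _ _))
      have h3 : ∀ x y z t s : ℝ, x * (y * z) * t * s = x * y * z * t * s := fun _ _ _ _ _ => by ring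
      calc _ ≤ G Z Z' * (∑ e ∈ S, ∑ w' ∈ ed e, ind (Bad ((ed e).erase w) Z Z') *
            ind (BadPath ed u Z Z' r w' (F ∪ ed e))) * ind (Good ed Z') * ind (Good ed Z) := by
            refine mul_le_mul_of_nonneg_right (mul_le_mul_of_nonneg_right
              (mul_le_mul_of_nonneg_left h2 (hG0 Z Z')) (ind_nonneg _)) (ind_nonneg _)
        _ = _ := by simp only [Finset.mul_sum, Finset.sum_mul, h3]
    refine (avg_mono fun Z _ => avg_mono fun Z' _ => h1 Z Z').trans ?_
    simp only [avg_sum]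
    set C := avg L₁ (fun Z => ind (Good ed Z)) * avg L₂ (fun Z => ind (Good ed Z)) *
            avg L₁ fun Z => avg L₂ (G Z) with hC
    have hC0 : 0 ≤ C := mul_nonneg (mul_nonneg ha₁ ha₂)
      (avg_nonneg fun Z _ => avg_nonneg fun Z' _ => hG0 Z Z')
    have hstep : ∀ e ∈ S, ∀ w' ∈ ed e, avg L₁ (fun Z => avg L₂ fun Z' =>
        G Z Z' * ind (Bad ((ed e).erase w) Z Z') *
          ind (BadPath ed u Z Z' r w' (F ∪ ed e)) * ind (Good ed Z') * ind (Good ed Z)) ≤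
        factor k Δ b ^ (F.card + (r + 1) * k) *
          (edgeWeight k b * walkWeight ed (edgeWeight k b) u r w') * C := by
      intro e he w' hw'
      rw [hS, Finset.mem_filter] at he
      obtain ⟨_, hwe, hd⟩ := he
      have h4 := ih w' (F ∪ ed e) (Finset.mem_union_right _ hw')
        (fun Z Z' => G Z Z' * ind (Bad ((ed e).erase w) Z Z'))
        ((hG.mono Finset.subset_union_left).mul ((DepOn₂.bad _).mono
          ((Finset.erase_subset _ _).trans Finset.subset_union_right)))
        (fun Z Z' => mul_nonneg (hG0 Z Z') (ind_nonneg _))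
      refine h4.trans ?_
      rw [avg_avg_mul_of_disjoint hne₁ hne₂ hd.symm hG (DepOn₂.bad _)]
      have hcard : ((ed e).erase w).card = k - 1 := by
        rw [Finset.card_erase_of_mem hwe, h.family.card]
      -- The colours of w are already exposed; badness of the other k - 1 vertices has exponent k -
      -- 2, which is `edgeWeight`.
      have h5 := avg_avg_bad_le h.pos h.card₁ h.card₂ (W := (ed e).erase w)
        (Finset.card_pos.1 (by rw [hcard]; have := h.two_le; omega))
      rw [hcard, Nat.sub_sub] at h5
      have h6 : factor k Δ b ^ ((F ∪ ed e).card + r * k) ≤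
          factor k Δ b ^ (F.card + (r + 1) * k) := by
        refine pow_le_pow_right₀ h.one_le_factor ?_
        have := Finset.card_union_le F (ed e)
        rw [h.family.card] at this
        linarith
      have hw0 := walkWeight_nonneg ed hβ u r w'
      calc _ = factor k Δ b ^ ((F ∪ ed e).card + r * k) *
            walkWeight ed (edgeWeight k b) u r w' * C *
              avg L₁ (fun Z => avg L₂ fun Z' => ind (Bad ((ed e).erase w) Z Z')) := by
            rw [hC]; ring
        _ ≤ factor k Δ b ^ (F.card + (r + 1) * k) *
            walkWeight ed (edgeWeight k b) u r w' * C * edgeWeight k b := by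
            refine mul_le_mul (mul_le_mul_of_nonneg_right (mul_le_mul_of_nonneg_right h6 hw0) hC0)
              h5 (avg_nonneg fun Z _ => avg_nonneg fun Z' _ => ind_nonneg _) ?_
            have := h.factor_pos
            positivity
        _ = _ := by ring
    calc _ ≤ ∑ e ∈ S, ∑ w' ∈ ed e, factor k Δ b ^ (F.card + (r + 1) * k) *
          (edgeWeight k b * walkWeight ed (edgeWeight k b) u r w') * C :=
          Finset.sum_le_sum fun e he => Finset.sum_le_sum fun w' hw' => hstep e he w' hw'
      _ ≤ ∑ e ∈ Finset.univ.filter (fun e => w ∈ ed e), ∑ w' ∈ ed e,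
          factor k Δ b ^ (F.card + (r + 1) * k) *
          (edgeWeight k b * walkWeight ed (edgeWeight k b) u r w') * C := by
          refine Finset.sum_le_sum_of_subset_of_nonneg (fun e he => ?_) fun e _ _ =>
            Finset.sum_nonneg fun w' _ => ?_
          · simp only [hS, Finset.mem_filter] at he ⊢
            exact ⟨he.1, he.2.1⟩
          · have := walkWeight_nonneg ed hβ u r w'
            have := h.factor_pos
            positivity
      _ = _ := by
          simp only [walkWeight, ← Finset.mul_sum, ← Finset.sum_mul]

end ListPair

end Influence

/-! ### The exchange argument: influence of one list on the colour of another vertex -/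

section Cond

variable {V κ ι : Type} [Fintype V] [DecidableEq V] [Fintype ι] [DecidableEq ι]

/-- The expectation with respect to a uniform proper colouring from lists. -/
def cond (ed : ι → Finset V) (L : V → Finset κ) (g : (V → κ) → ℝ) : ℝ :=
  avg L (fun Z => g Z * ind (Good ed Z)) / avg L fun Z => ind (Good ed Z)

theorem isExpectation_cond {ed : ι → Finset V} {L : V → Finset κ}
    (h : 0 < avg L fun Z => ind (Good ed Z)) : IsExpectation (cond ed L) where
  add f g := by
    unfold cond
    simp only [add_mul, avg_add, add_div]
  smul c f := by
    unfold cond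
    simp only [mul_assoc, avg_mul_left, mul_div_assoc]
  mono f g hfg := by
    unfold cond
    refine div_le_div_of_nonneg_right (avg_mono fun Z _ => ?_) h.le
    exact mul_le_mul_of_nonneg_right (hfg Z) (ind_nonneg _)
  one := by
    unfold cond
    simp only [one_mul]
    exact div_self h.ne'

theorem cond_congr {ed : ι → Finset V} {L : V → Finset κ} {f g : (V → κ) → ℝ}
    (h : ∀ Z, (∀ v, Z v ∈ L v) → f Z = g Z) : cond ed L f = cond ed L g := by
  unfold cond
  rw [avg_congr fun Z hZ => by rw [h Z hZ]]

theorem badWalk_congr {ed : ι → Finset V} {u : V} {Z₁ Z₁' Z₂ Z₂' : V → κ}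
    (h : ∀ e, Bad (ed e) Z₁ Z₁' ↔ Bad (ed e) Z₂ Z₂') (r : ℕ) :
    ∀ w, BadWalk ed u Z₁ Z₁' r w ↔ BadWalk ed u Z₂ Z₂' r w := by
  induction r with
  | zero => intro w; rfl
  | succ r ih => intro w; simp only [BadWalk, ih, h]

open Classical in
/-- The vertices that are joined to `u` by a walk of bad hyperedges. -/
def cluster (ed : ι → Finset V) (u : V) (Z Z' : V → κ) : Finset V :=
  Finset.univ.filter fun w => ∃ r, BadWalk ed u Z Z' r w

theorem mem_cluster {ed : ι → Finset V} {u w : V} {Z Z' : V → κ} :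
    w ∈ cluster ed u Z Z' ↔ ∃ r, BadWalk ed u Z Z' r w := by simp [cluster]

/-- An exchange keeps the unordered pair of colours at every vertex. So badness, and with it the
cluster, is invariant, as `avg_swap` requires. -/
theorem bad_mix (W U : Finset V) (Z Z' : V → κ) :
    Bad W (mix U Z Z') (mix U Z' Z) ↔ Bad W Z Z' := by
  unfold Bad mix
  refine exists_congr fun c => forall₂_congr fun v _ => ?_
  by_cases hv : v ∈ U
  · simp [hv]
  · simp [hv, or_comm]

theorem cluster_mix (ed : ι → Finset V) (u : V) (U : Finset V) (Z Z' : V → κ) :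
    cluster ed u (mix U Z Z') (mix U Z' Z) = cluster ed u Z Z' := by
  ext w
  simp only [mem_cluster, badWalk_congr (fun e => bad_mix (ed e) U Z Z')]

theorem cluster_comm (ed : ι → Finset V) (u : V) (Z Z' : V → κ) :
    cluster ed u Z' Z = cluster ed u Z Z' := by
  ext w
  have : ∀ e, Bad (ed e) Z' Z ↔ Bad (ed e) Z Z' := fun e =>
    exists_congr fun c => forall₂_congr fun v _ => or_comm
  simp only [mem_cluster, badWalk_congr this]

theorem subset_cluster {ed : ι → Finset V} {u x : V} {Z Z' : V → κ} {e : ι} (hx : x ∈ ed e)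
    (hxC : x ∈ cluster ed u Z Z') (hb : Bad (ed e) Z Z') : ed e ⊆ cluster ed u Z Z' := by
  intro y hy
  obtain ⟨r, hr⟩ := mem_cluster.1 hxC
  exact mem_cluster.2 ⟨r + 1, e, hy, hb, x, hx, hr⟩

/-- A hyperedge that is monochromatic in the mixture is bad, so it lies inside the cluster as soon
as it meets it. Hence it takes all its colours from one of the two proper colourings. -/
theorem good_mix_cluster {ed : ι → Finset V} {u : V} {Z Z' : V → κ} (h : Good ed Z)
    (h' : Good ed Z') : Good ed (mix (cluster ed u Z Z') Z Z') := by
  rintro e he ⟨c, hc⟩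
  by_cases hx : ∃ x ∈ ed e, x ∈ cluster ed u Z Z'
  · obtain ⟨x, hx, hxC⟩ := hx
    have hb : Bad (ed e) Z Z' := ⟨c, fun v hv => by
      have := hc v hv
      unfold mix at this
      split_ifs at this
      · exact Or.inl this
      · exact Or.inr this⟩
    have hsub := subset_cluster hx hxC hb
    refine h e he ⟨c, fun v hv => ?_⟩
    have := hc v hv
    rwa [mix, if_pos (hsub hv)] at this
  · push Not at hx
    refine h' e he ⟨c, fun v hv => ?_⟩
    have := hc v hv
    rwa [mix, if_neg (hx v hv)] at this

theorem mix_mix (U : Finset V) (Z Z' : V → κ) : mix U (mix U Z Z') (mix U Z' Z) = Z := by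
  funext v
  by_cases hv : v ∈ U <;> simp [mix, hv]

theorem good_mix_iff {ed : ι → Finset V} {u : V} {Z Z' : V → κ} :
    (Good ed (mix (cluster ed u Z Z') Z Z') ∧ Good ed (mix (cluster ed u Z Z') Z' Z)) ↔
      Good ed Z ∧ Good ed Z' := by
  have key : ∀ Z Z' : V → κ, Good ed Z → Good ed Z' →
      Good ed (mix (cluster ed u Z Z') Z Z') ∧ Good ed (mix (cluster ed u Z Z') Z' Z) := by
    intro Z Z' h h'
    refine ⟨good_mix_cluster h h', ?_⟩
    rw [← cluster_comm]
    exact good_mix_cluster h' h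
  refine ⟨fun ⟨h, h'⟩ => ?_, fun ⟨h, h'⟩ => key Z Z' h h'⟩
  have h1 := key _ _ h h'
  rwa [cluster_mix, mix_mix, mix_mix] at h1

namespace ListPair

variable {ed : ι → Finset V} {k Δ : ℕ} {b : ℝ} {L₁ L₂ : V → Finset κ}

theorem avg_pos₁ (h : ListPair ed k Δ b L₁ L₂) : 0 < avg L₁ fun Z => ind (Good ed Z) :=
  h.sys₁.avg_avoids_pos h.one_le_deg _

theorem avg_pos₂ (h : ListPair ed k Δ b L₁ L₂) : 0 < avg L₂ fun Z => ind (Good ed Z) :=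
  h.sys₂.avg_avoids_pos h.one_le_deg _

/-- An upper bound for the influence of the list of `u` on the colour of `v`. -/
def influence (ed : ι → Finset V) (k Δ : ℕ) (b : ℝ) (u v : V) : ℝ :=
  ∑ r ∈ Finset.range (Fintype.card V),
    factor k Δ b ^ (1 + (r + 1) * k) * walkWeight ed (edgeWeight k b) u (r + 1) v

theorem influence_nonneg (h : ListPair ed k Δ b L₁ L₂) (u v : V) :
    0 ≤ influence ed k Δ b u v := by
  have hβ : 0 ≤ edgeWeight k b := by
    have := h.pos
    unfold edgeWeight
    positivity
  refine Finset.sum_nonneg fun r _ => mul_nonneg ?_ (walkWeight_nonneg ed hβ u _ v)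
  have := h.factor_pos
  positivity

theorem avg_avg_cluster_le (h : ListPair ed k Δ b L₁ L₂) {u v : V} (huv : v ≠ u) :
    avg L₁ (fun Z => avg L₂ fun Z' => ind (v ∈ cluster ed u Z Z') * ind (Good ed Z') *
      ind (Good ed Z)) ≤ influence ed k Δ b u v *
        (avg L₁ (fun Z => ind (Good ed Z)) * avg L₂ fun Z => ind (Good ed Z)) := by
  have h1 : ∀ Z Z' : V → κ, ind (v ∈ cluster ed u Z Z') ≤
      ∑ r ∈ Finset.range (Fintype.card V), ind (BadPath ed u Z Z' (r + 1) v {v}) := by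
    intro Z Z'
    refine (ind_mono fun hv => ?_).trans ind_exists_le
    rw [mem_cluster] at hv
    classical
    -- A walk of minimal length is a path. Length 0 is excluded by v ≠ u, hence the shift to r + 1.
    have hmin : ∀ j < Nat.find hv, ¬ BadWalk ed u Z Z' j v := fun j hj => Nat.find_min hv hj
    have hr := Nat.find_spec hv
    rcases hfind : Nat.find hv with _ | r
    · rw [hfind] at hr
      exact absurd hr huv
    · rw [hfind] at hr hmin
      have hp := h.family.badPath_of_badWalk (r + 1) v {v} hr hmin (by simp)
      have hl := h.family.badPath_length h.two_le _ _ _ hp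
      exact ⟨r, by rw [Finset.mem_range]; omega, hp⟩
  have h2 : ∀ r, avg L₁ (fun Z => avg L₂ fun Z' => ind (BadPath ed u Z Z' (r + 1) v {v}) *
      ind (Good ed Z') * ind (Good ed Z)) ≤
      factor k Δ b ^ (1 + (r + 1) * k) * walkWeight ed (edgeWeight k b) u (r + 1) v *
        (avg L₁ (fun Z => ind (Good ed Z)) * avg L₂ fun Z => ind (Good ed Z)) := by
    intro r
    have h3 := h.avg_avg_badPath_le u (r + 1) v {v} (Finset.mem_singleton_self v)
      (fun _ _ => 1) ⟨fun _ _ _ _ => rfl, fun _ _ _ _ => rfl⟩ (fun _ _ => zero_le_one)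
    simp only [one_mul, avg_const h.sys₁.nonempty, avg_const h.sys₂.nonempty,
      Finset.card_singleton, mul_one] at h3
    exact h3
  calc _ ≤ avg L₁ (fun Z => avg L₂ fun Z' => ∑ r ∈ Finset.range (Fintype.card V),
        ind (BadPath ed u Z Z' (r + 1) v {v}) * ind (Good ed Z') * ind (Good ed Z)) := by
        refine avg_mono fun Z _ => avg_mono fun Z' _ => ?_
        rw [← Finset.sum_mul, ← Finset.sum_mul]
        exact mul_le_mul_of_nonneg_right (mul_le_mul_of_nonneg_right (h1 Z Z') (ind_nonneg _))
          (ind_nonneg _)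
    _ ≤ _ := by
        simp only [avg_sum]
        unfold influence
        rw [Finset.sum_mul]
        exact Finset.sum_le_sum fun r _ => h2 r

/-- Changing the list of `u` has little influence on the colour of `v`. -/
theorem cond_sub_le (h : ListPair ed k Δ b L₁ L₂) {u v : V} (huv : v ≠ u)
    (hL : ∀ w, w ≠ u → L₁ w = L₂ w) {g : (V → κ) → ℝ} (hg : DepOn g {v}) {D : ℝ}
    (hD : ∀ Z Z', g Z - g Z' ≤ D) :
    cond ed L₁ g ≤ cond ed L₂ g + influence ed k Δ b u v * D := by
  have ha₁ := h.avg_pos₁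
  have ha₂ := h.avg_pos₂
  set a₁ := avg L₁ fun Z => ind (Good ed Z) with ha₁'
  set a₂ := avg L₂ fun Z => ind (Good ed Z) with ha₂'
  -- For two independent colourings, the average of `F` is a₁a₂ times the difference of the two
  -- conditional expectations.
  set F : (V → κ) → (V → κ) → ℝ := fun Z Z' =>
    (g Z - g Z') * (ind (Good ed Z') * ind (Good ed Z)) with hF
  have hFavg : avg L₁ (fun Z => avg L₂ (F Z)) = avg L₁ (fun Z => g Z * ind (Good ed Z)) * a₂ -
      a₁ * avg L₂ (fun Z => g Z * ind (Good ed Z)) := by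
    have h1 : ∀ Z, avg L₂ (F Z) = g Z * ind (Good ed Z) * a₂ -
        ind (Good ed Z) * avg L₂ (fun Z => g Z * ind (Good ed Z)) := by
      intro Z
      rw [ha₂', ← avg_mul_left, ← avg_mul_left, ← avg_sub]
      congr 1
      funext Z'
      simp only [hF]
      ring
    simp only [h1, avg_sub, avg_mul_right]
    rw [ha₁']
  have hswap := avg_swap (L₁ := L₁) (L₂ := L₂) (cluster ed u)
    (fun Z Z' => cluster_mix ed u _ Z Z')
    (fun Z Z' w hw => hL w fun hwu => hw (mem_cluster.2 ⟨0, hwu⟩)) F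
  -- If v is outside the cluster, the exchange interchanges its two colours and the two copies of
  -- `F` cancel. If v is inside, its colours stay and each copy is at most D.
  have hpt : ∀ Z Z' : V → κ, F Z Z' +
      F (mix (cluster ed u Z Z') Z Z') (mix (cluster ed u Z Z') Z' Z) ≤
        2 * D * (ind (v ∈ cluster ed u Z Z') * ind (Good ed Z') * ind (Good ed Z)) := by
    intro Z Z'
    have hgood : ind (Good ed (mix (cluster ed u Z Z') Z' Z)) *
        ind (Good ed (mix (cluster ed u Z Z') Z Z')) = ind (Good ed Z') * ind (Good ed Z) := by
      rw [← ind_and, ← ind_and, and_comm, ind_congr good_mix_iff, and_comm]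
    have h0 : 0 ≤ ind (Good ed Z') * ind (Good ed Z) := mul_nonneg (ind_nonneg _) (ind_nonneg _)
    simp only [hF, hgood]
    by_cases hv : v ∈ cluster ed u Z Z'
    · have e1 : g (mix (cluster ed u Z Z') Z Z') = g Z := hg _ _ (by simp [mix, hv])
      have e2 : g (mix (cluster ed u Z Z') Z' Z) = g Z' := hg _ _ (by simp [mix, hv])
      rw [e1, e2, ind_true hv]
      have := mul_le_mul_of_nonneg_right (hD Z Z') h0
      linarith
    · have e1 : g (mix (cluster ed u Z Z') Z Z') = g Z' := hg _ _ (by simp [mix, hv])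
      have e2 : g (mix (cluster ed u Z Z') Z' Z) = g Z := hg _ _ (by simp [mix, hv])
      rw [e1, e2, ind_false hv]
      apply le_of_eq
      ring
  have h2 : 2 * avg L₁ (fun Z => avg L₂ (F Z)) ≤
      2 * D * avg L₁ (fun Z => avg L₂ fun Z' => ind (v ∈ cluster ed u Z Z') *
        ind (Good ed Z') * ind (Good ed Z)) := by
    rw [two_mul]
    nth_rewrite 2 [hswap]
    simp only [← avg_add, ← avg_mul_left]
    exact avg_mono fun Z _ => avg_mono fun Z' _ => hpt Z Z'
  have h3 := h.avg_avg_cluster_le huv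
  have hD0 : 0 ≤ D := by
    obtain ⟨Z⟩ : Nonempty (V → κ) := ⟨fun w => (h.sys₁.nonempty w).choose⟩
    simpa using hD Z Z
  have h4 : avg L₁ (fun Z => avg L₂ (F Z)) ≤ D * (influence ed k Δ b u v * (a₁ * a₂)) := by
    have := mul_le_mul_of_nonneg_left h3 hD0
    linarith
  rw [hFavg] at h4
  unfold cond
  rw [← ha₁', ← ha₂', ← sub_le_iff_le_add', div_sub_div _ _ ha₁.ne' ha₂.ne',
    div_le_iff₀ (mul_pos ha₁ ha₂)]
  linarith

/-- The total influence on a vertex is at most `1/2`. -/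
theorem sum_influence_le (h : ListPair ed k Δ b L₁ L₂) (hf : factor k Δ b ^ k ≤ 2)
    (hw : edgeWeight k b * (Δ * k) ≤ 1 / 16) (v : V) :
    ∑ u, influence ed k Δ b u v ≤ 1 / 2 := by
  have hβ : 0 ≤ edgeWeight k b := by
    have := h.pos
    unfold edgeWeight
    positivity
  have hf0 := h.factor_pos
  have hf1 : factor k Δ b ≤ 2 := by
    refine le_trans ?_ hf
    have := pow_le_pow_right₀ h.one_le_factor (show 1 ≤ k by have := h.two_le; omega)
    rwa [pow_one] at this
  unfold influence
  rw [Finset.sum_comm]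
  -- Per hyperedge, conditioning costs at most 2 and the weighted branching at most 1/16, so the
  -- ratio is 1/8 and the geometric series sums to at most 2/7.
  have h1 : ∀ r ∈ Finset.range (Fintype.card V), ∑ u, factor k Δ b ^ (1 + (r + 1) * k) *
      walkWeight ed (edgeWeight k b) u (r + 1) v ≤ 2 * (1 / 8) ^ (r + 1) := by
    intro r _
    rw [← Finset.mul_sum]
    have h2 := h.family.sum_walkWeight_le hβ (r + 1) v
    have h3 : (edgeWeight k b * (Δ * k)) ^ (r + 1) ≤ (1 / 16) ^ (r + 1) :=
      pow_le_pow_left₀ (by positivity) hw _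
    have h4 : factor k Δ b ^ (1 + (r + 1) * k) ≤ 2 * 2 ^ (r + 1) := by
      rw [pow_add, pow_one, mul_comm (r + 1) k, pow_mul]
      exact mul_le_mul hf1 (pow_le_pow_left₀ (by positivity) hf _) (by positivity) (by norm_num)
    calc _ ≤ 2 * 2 ^ (r + 1) * (1 / 16 : ℝ) ^ (r + 1) :=
          mul_le_mul h4 (h2.trans h3)
            (Finset.sum_nonneg fun u _ => walkWeight_nonneg ed hβ u _ v) (by positivity)
      _ = 2 * (1 / 8) ^ (r + 1) := by
          rw [mul_assoc, ← mul_pow]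
          norm_num
  refine (Finset.sum_le_sum h1).trans ?_
  have h5 : ∀ n : ℕ, ∑ r ∈ Finset.range n, 2 * (1 / 8 : ℝ) ^ (r + 1) =
      2 / 7 * (1 - (1 / 8) ^ n) := by
    intro n
    induction n with
    | zero => simp
    | succ n ih => rw [Finset.sum_range_succ, ih]; ring
  rw [h5]
  have : (0 : ℝ) ≤ (1 / 8) ^ Fintype.card V := by positivity
  linarith

end ListPair

end Cond

/-! ### Systematic scan -/

section Scan

variable {V σ : Type} [Fintype V] [DecidableEq V]

/-- The values of `g` change by at most `o u` when the value at `u` is changed. -/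
def Osc (g : (V → σ) → ℝ) (o : V → ℝ) : Prop :=
  ∀ u Y a, g Y ≤ g (Function.update Y u a) + o u

theorem Osc.le_add_sum {g : (V → σ) → ℝ} {o : V → ℝ} (h : Osc g o) (Y Y' : V → σ) :
    g Y ≤ g Y' + ∑ u, o u := by
  have key : ∀ S : Finset V, g Y ≤ g (mix S Y' Y) + ∑ u ∈ S, o u := by
    intro S
    induction S using Finset.induction_on with
    | empty =>
      have : mix ∅ Y' Y = Y := by
        funext w
        simp [mix]
      simp [this]
    | insert u S hu ih =>
      rw [Finset.sum_insert hu]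
      have h1 := h u (mix S Y' Y) (Y' u)
      have h2 : Function.update (mix S Y' Y) u (Y' u) = mix (insert u S) Y' Y := by
        funext w
        by_cases hw : w = u
        · subst hw; simp [mix]
        · simp [mix, hw]
      rw [h2] at h1
      linarith
  have h1 := key Finset.univ
  have h2 : mix Finset.univ Y' Y = Y' := by
    funext w
    simp [mix]
  rwa [h2] at h1

/-- A family of single-site updates satisfying Dobrushin's condition: the update at `v` replaces the
bound `o` on the oscillations by the one stated. -/
structure Dobrushin (P : V → ((V → σ) → ℝ) → (V → σ) → ℝ) (J : V → V → ℝ) : Prop where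
  osc : ∀ v g o, (∀ u, 0 ≤ o u) → Osc g o →
    Osc (P v g) fun u => if u = v then 0 else o u + J u v * o v
  nonneg : ∀ u v, 0 ≤ J u v
  sum_le : ∀ v, ∑ u, J u v ≤ 1 / 2

/-- Apply the updates at the vertices of a list; the first one is applied to the state first. -/
def updates (P : V → ((V → σ) → ℝ) → (V → σ) → ℝ) : List V → ((V → σ) → ℝ) → (V → σ) → ℝ
  | [], g => g
  | v :: vs, g => P v (updates P vs g)

theorem updates_append (P : V → ((V → σ) → ℝ) → (V → σ) → ℝ) (l l' : List V)
    (g : (V → σ) → ℝ) : updates P (l ++ l') g = updates P l (updates P l' g) := by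
  induction l with
  | nil => rfl
  | cons v l ih => simp [updates, ih]

namespace Dobrushin

variable {P : V → ((V → σ) → ℝ) → (V → σ) → ℝ} {J : V → V → ℝ}

/-- With `S` the set of the vertices that have been updated. -/
theorem exists_osc_updates (h : Dobrushin P J) {g : (V → σ) → ℝ} {o : V → ℝ}
    (ho : ∀ u, 0 ≤ o u) (hg : Osc g o) (l : List V) : ∃ o' : V → ℝ, (∀ u, 0 ≤ o' u) ∧
      Osc (updates P l g) o' ∧
      ∑ u, (if u ∈ l then 2 else 1) * o' u ≤ ∑ u, o u := by
  induction l with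
  | nil => exact ⟨o, ho, hg, by simp⟩
  | cons v l ih =>
    obtain ⟨o', ho', hg', hs⟩ := ih
    refine ⟨_, fun u => ?_, h.osc v _ o' ho' hg', le_trans ?_ hs⟩
    · split_ifs
      · exact le_rfl
      · exact add_nonneg (ho' u) (mul_nonneg (h.nonneg _ _) (ho' v))
    -- The vertices of the list have weight 2. The update erases `o' v`, of weight at least 1, and
    -- spreads at most half of it over vertices of weight at most 2; the weighted sum does not grow.
    · have hJ : ∑ u, 2 * (J u v * o' v) ≤ o' v := by
        rw [← Finset.mul_sum, ← Finset.sum_mul]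
        have := mul_le_mul_of_nonneg_right (h.sum_le v) (ho' v)
        linarith
      have h1 : ∀ u, (if u ∈ v :: l then (2 : ℝ) else 1) *
          (if u = v then 0 else o' u + J u v * o' v) ≤
          (if u ∈ l then 2 else 1) * o' u + 2 * (J u v * o' v) -
            if u = v then o' v else 0 := by
        intro u
        have hJ0 := mul_nonneg (h.nonneg u v) (ho' v)
        have h0 := ho' u
        by_cases huv : u = v
        · subst huv
          simp only [if_true, mul_zero]
          split_ifs <;> linarith
        · simp only [huv, if_false, List.mem_cons, false_or]
          split_ifs <;> linarith
      refine (Finset.sum_le_sum fun u _ => h1 u).trans ?_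
      rw [Finset.sum_sub_distrib, Finset.sum_add_distrib, Finset.sum_ite_eq' Finset.univ v]
      simp only [Finset.mem_univ, if_true]
      linarith

/-- Once every vertex has been updated all weights equal 2, and the bound on the weighted sum
becomes a contraction by 1/2. -/
theorem exists_osc_updates_sweep (h : Dobrushin P J) {g : (V → σ) → ℝ} {o : V → ℝ}
    (ho : ∀ u, 0 ≤ o u) (hg : Osc g o) {l : List V} (hl : ∀ v, v ∈ l) : ∃ o' : V → ℝ,
      (∀ u, 0 ≤ o' u) ∧ Osc (updates P l g) o' ∧ ∑ u, o' u ≤ (1 / 2) * ∑ u, o u := by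
  obtain ⟨o', ho', hg', hs⟩ := h.exists_osc_updates ho hg l
  refine ⟨o', ho', hg', ?_⟩
  simp only [hl, if_true, ← Finset.mul_sum] at hs
  linarith

end Dobrushin

end Scan

/-! ### Large clusters: blocks of hyperedges, queue explorations and the union bound -/

section Clusters

variable {V ι : Type} [Fintype V] [DecidableEq V] [Fintype ι] [DecidableEq ι]

/-- The hyperedges that can be reached from the set `W` of vertices through hyperedges satisfying
`U`. -/
inductive EdgeReach (ed : ι → Finset V) (U : ι → Prop) (W : Finset V) : ι → Prop
  | base (e : ι) : U e → ¬ Disjoint (ed e) W → EdgeReach ed U W e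
  | step (e f : ι) : EdgeReach ed U W f → U e → ¬ Disjoint (ed e) (ed f) → EdgeReach ed U W e

theorem EdgeReach.prop {ed : ι → Finset V} {U : ι → Prop} {W : Finset V} {e : ι}
    (h : EdgeReach ed U W e) : U e := by
  cases h with
  | base e h _ => exact h
  | step e f _ h _ => exact h

theorem EdgeReach.mono {ed : ι → Finset V} {U U' : ι → Prop} (hU : ∀ e, U e → U' e)
    {W : Finset V} {e : ι} (h : EdgeReach ed U W e) : EdgeReach ed U' W e := by
  induction h with
  | base e h h' => exact .base e (hU e h) h'
  | step e f _ h h' ih => exact .step e f ih (hU e h) h'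

/-- The sets of `i` hyperedges that arise by successively adding hyperedges that touch `W` or one of
the preceding hyperedges. -/
def attached (ed : ι → Finset V) (W : Finset V) : ℕ → Finset (Finset ι)
  | 0 => {∅}
  | i + 1 => (attached ed W i).biUnion fun S =>
      (Finset.univ.filter fun g => g ∉ S ∧ ¬ Disjoint (ed g) (W ∪ S.biUnion ed)).image
        fun g => insert g S

theorem card_of_mem_attached {ed : ι → Finset V} {W : Finset V} {i : ℕ} :
    ∀ S ∈ attached ed W i, S.card = i := by
  induction i with
  | zero => intro S hS; simp [attached] at hS; simp [hS]
  | succ i ih =>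
    intro S hS
    simp only [attached, Finset.mem_biUnion, Finset.mem_image, Finset.mem_filter] at hS
    obtain ⟨S', hS', g, ⟨_, hg, _⟩, rfl⟩ := hS
    rw [Finset.card_insert_of_notMem hg, ih S' hS']

/-- An attached subset of `R` that cannot be enlarged within `R` is closed under reachability and
hence contains `R`; below the cardinality of `R` there is always a next hyperedge. -/
theorem exists_mem_attached {ed : ι → Finset V} {U : ι → Prop} {W : Finset V} {R : Finset ι}
    (hR : ∀ e, e ∈ R ↔ EdgeReach ed U W e) (i : ℕ) (hi : i ≤ R.card) :
    ∃ S ∈ attached ed W i, S ⊆ R := by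
  induction i with
  | zero => exact ⟨∅, by simp [attached], Finset.empty_subset _⟩
  | succ i ih =>
    obtain ⟨S, hS, hSR⟩ := ih (by omega)
    have hcard := card_of_mem_attached S hS
    have : ∃ g ∈ R, g ∉ S ∧ ¬ Disjoint (ed g) (W ∪ S.biUnion ed) := by
      by_contra hc
      push Not at hc
      have hsub : R ⊆ S := by
        intro e he
        rw [hR] at he
        induction he with
        | base e h h' =>
          by_contra heS
          refine h' (Disjoint.mono_right Finset.subset_union_left
            (hc e ((hR e).2 (.base e h h')) heS))
        | step e f hf h h' ih =>
          by_contra heS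
          refine h' (Disjoint.mono_right ?_ (hc e ((hR e).2 (.step e f hf h h')) heS))
          exact (Finset.subset_biUnion_of_mem ed ih).trans Finset.subset_union_right
      have := Finset.card_le_card hsub
      omega
    obtain ⟨g, hgR, hgS, hg⟩ := this
    refine ⟨insert g S, ?_, Finset.insert_subset hgR hSR⟩
    simp only [attached, Finset.mem_biUnion, Finset.mem_image, Finset.mem_filter]
    exact ⟨S, hS, g, ⟨Finset.mem_univ _, hgS, hg⟩, rfl⟩

namespace LinearFamily

variable {ed : ι → Finset V} {k Δ : ℕ}

theorem card_biUnion_le (h : LinearFamily ed k Δ) (S : Finset ι) :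
    (S.biUnion ed).card ≤ k * S.card := by
  refine Finset.card_biUnion_le.trans ?_
  rw [Finset.sum_congr rfl fun e _ => h.card e, Finset.sum_const, smul_eq_mul, mul_comm]

/-- By linearity a new hyperedge shares at most one vertex with each of fewer than θ others, so at
least k - θ of its vertices are new. -/
theorem le_card_biUnion (h : LinearFamily ed k Δ) {θ : ℕ} (S : Finset ι) (hS : S.card ≤ θ) :
    (k - θ) * S.card ≤ (S.biUnion ed).card := by
  induction S using Finset.induction_on with
  | empty => simp
  | insert g S hg ih =>
    rw [Finset.card_insert_of_notMem hg] at hS ⊢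
    have h1 := ih (by omega)
    rw [Finset.biUnion_insert]
    have h2 := Finset.card_union_add_card_inter (ed g) (S.biUnion ed)
    have h3 : (ed g ∩ S.biUnion ed).card ≤ S.card := by
      rw [Finset.inter_biUnion]
      refine Finset.card_biUnion_le.trans ?_
      rw [Finset.card_eq_sum_ones]
      refine Finset.sum_le_sum fun f hf => h.simple g f ?_
      rintro rfl
      exact hg hf
    have h4 := Finset.card_le_card (Finset.inter_subset_left (s₁ := ed g) (s₂ := S.biUnion ed))
    rw [h.card g] at h2 h4
    rw [mul_add, mul_one]
    omega

/-- When hyperedge number i + 1 is chosen, at most k + ki ≤ kθ vertices are present, each in at most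
Δ hyperedges. -/
theorem card_attached_le (h : LinearFamily ed k Δ) {θ : ℕ} {W : Finset V} (hW : W.card ≤ k)
    (i : ℕ) (hi : i ≤ θ) : (attached ed W i).card ≤ (Δ * (k * θ)) ^ i := by
  induction i with
  | zero => simp [attached]
  | succ i ih =>
    have h1 := ih (by omega)
    simp only [attached]
    refine Finset.card_biUnion_le.trans ?_
    calc _ ≤ ∑ S ∈ attached ed W i, Δ * (k * θ) := by
          refine Finset.sum_le_sum fun S hS => Finset.card_image_le.trans ?_
          refine le_trans (Finset.card_le_card fun g hg => ?_)
            ((h.card_touching_le (W ∪ S.biUnion ed)).trans (Nat.mul_le_mul_left Δ ?_))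
          · simp only [Finset.mem_filter] at hg ⊢
            exact ⟨hg.1, hg.2.2⟩
          · have h2 := h.card_biUnion_le S
            rw [card_of_mem_attached S hS] at h2
            have h3 := Finset.card_union_le W (S.biUnion ed)
            have h4 : k * (i + 1) ≤ k * θ := Nat.mul_le_mul_left k hi
            rw [mul_add, mul_one] at h4
            omega
      _ = (attached ed W i).card * (Δ * (k * θ)) := by rw [Finset.sum_const, smul_eq_mul]
      _ ≤ _ := by
          rw [pow_succ]
          exact Nat.mul_le_mul_right _ h1

end LinearFamily

/-- The sets of `θ` hyperedges that avoid `A` and are attached to a hyperedge containing `w`. -/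
def blocks (ed : ι → Finset V) (θ : ℕ) (w : V) (A : Finset V) : Finset (Finset ι) :=
  ((Finset.univ.filter fun f => w ∈ ed f).biUnion fun f => attached ed (ed f) θ).filter
    fun S => Disjoint (S.biUnion ed) A

theorem LinearFamily.card_blocks_le {ed : ι → Finset V} {k Δ : ℕ} (h : LinearFamily ed k Δ)
    (θ : ℕ) (w : V) (A : Finset V) : (blocks ed θ w A).card ≤ Δ * (Δ * (k * θ)) ^ θ := by
  refine (Finset.card_filter_le _ _).trans (Finset.card_biUnion_le.trans ?_)
  calc _ ≤ ∑ f ∈ Finset.univ.filter (fun f => w ∈ ed f), (Δ * (k * θ)) ^ θ :=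
        Finset.sum_le_sum fun f _ => h.card_attached_le (h.card f).le θ le_rfl
    _ = (Finset.univ.filter fun f => w ∈ ed f).card * (Δ * (k * θ)) ^ θ := by
        rw [Finset.sum_const, smul_eq_mul]
    _ ≤ _ := Nat.mul_le_mul_right _ (h.deg w)

theorem card_of_mem_blocks {ed : ι → Finset V} {θ : ℕ} {w : V} {A : Finset V} {S : Finset ι}
    (hS : S ∈ blocks ed θ w A) : S.card = θ := by
  simp only [blocks, Finset.mem_filter, Finset.mem_biUnion] at hS
  obtain ⟨⟨f, _, hf⟩, _⟩ := hS
  exact card_of_mem_attached S hf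

variable {σ : Type}

/-- Starting from the set `A` of vertices, a queue exploration finds `l` further blocks each of which
is monochromatic. -/
inductive Explore (ed : ι → Finset V) (θ : ℕ) (Y : V → σ) : ℕ → List V → Finset V → Prop
  | done (Q : List V) (A : Finset V) : Explore ed θ Y 0 Q A
  | skip (l : ℕ) (w : V) (Q : List V) (A : Finset V) : Explore ed θ Y (l + 1) Q A →
      Explore ed θ Y (l + 1) (w :: Q) A
  | block (l : ℕ) (w : V) (Q : List V) (A : Finset V) (S : Finset ι) : S ∈ blocks ed θ w A →
      Mono (S.biUnion ed) Y →
      Explore ed θ Y l (w :: Q ++ (S.biUnion ed).toList) (A ∪ S.biUnion ed) →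
      Explore ed θ Y (l + 1) (w :: Q) A

/-- Reachability from `w₀` through hyperedges that are monochromatic off `w₀`. -/
def ClusterEdge (ed : ι → Finset V) (w₀ : V) (Y : V → σ) (e : ι) : Prop :=
  EdgeReach ed (fun e => Mono ((ed e).erase w₀) Y) {w₀} e

/-- The hyperedges of `S` avoid w₀, so they are constant on all their vertices. The colour of `f`
off w₀ propagates to them through intersections, none of which contains w₀. -/
theorem mono_of_edgeReach {ed : ι → Finset V} {w₀ : V} {Y : V → σ} {A : Finset V}
    (hA : w₀ ∈ A) {f : ι} (hf : ClusterEdge ed w₀ Y f) {S : Finset ι}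
    (hS : ∀ g ∈ S, EdgeReach ed (fun g => ClusterEdge ed w₀ Y g ∧ Disjoint (ed g) A) (ed f) g) :
    Mono (S.biUnion ed) Y := by
  obtain ⟨c, hc⟩ := hf.prop
  have key : ∀ g, EdgeReach ed (fun g => ClusterEdge ed w₀ Y g ∧ Disjoint (ed g) A) (ed f) g →
      ∀ v ∈ ed g, Y v = c := by
    have hmono : ∀ g, ClusterEdge ed w₀ Y g → Disjoint (ed g) A → ∀ x ∈ ed g, Y x = c →
        ∀ v ∈ ed g, Y v = c := by
      intro g hg hgA x hx hxc v hv
      obtain ⟨c', hc'⟩ := hg.prop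
      have hne : ∀ y ∈ ed g, y ≠ w₀ := fun y hy hyw =>
        Finset.disjoint_left.1 hgA hy (hyw ▸ hA)
      rw [hc' v (Finset.mem_erase.2 ⟨hne v hv, hv⟩), ← hxc,
        hc' x (Finset.mem_erase.2 ⟨hne x hx, hx⟩)]
    intro g hg
    induction hg with
    | base g h h' =>
      rw [Finset.not_disjoint_iff] at h'
      obtain ⟨x, hxg, hxf⟩ := h'
      refine hmono g h.1 h.2 x hxg (hc x (Finset.mem_erase.2 ⟨?_, hxf⟩))
      rintro rfl
      exact Finset.disjoint_left.1 h.2 hxg hA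
    | step g g' _ h h' ih =>
      rw [Finset.not_disjoint_iff] at h'
      obtain ⟨x, hxg, hxg'⟩ := h'
      exact hmono g h.1 h.2 x hxg (ih x hxg')
  refine ⟨c, fun v hv => ?_⟩
  obtain ⟨g, hg, hvg⟩ := Finset.mem_biUnion.1 hv
  exact key g (hS g hg) v hvg

open Classical in
/-- The part of the cluster that hangs on `f` and avoids `A`. -/
def hanging (ed : ι → Finset V) (w₀ : V) (Y : V → σ) (f : ι) (A : Finset V) : Finset ι :=
  Finset.univ.filter
    (EdgeReach ed (fun g => ClusterEdge ed w₀ Y g ∧ Disjoint (ed g) A) (ed f))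

theorem mem_hanging {ed : ι → Finset V} {w₀ : V} {Y : V → σ} {f : ι} {A : Finset V} {g : ι} :
    g ∈ hanging ed w₀ Y f A ↔
      EdgeReach ed (fun g => ClusterEdge ed w₀ Y g ∧ Disjoint (ed g) A) (ed f) g := by
  simp [hanging]

theorem hanging_anti {ed : ι → Finset V} {w₀ : V} {Y : V → σ} {f : ι} {A A' : Finset V}
    (h : A ⊆ A') : hanging ed w₀ Y f A' ⊆ hanging ed w₀ Y f A := fun g hg => by
  rw [mem_hanging] at hg ⊢
  exact hg.mono fun e he => ⟨he.1, Disjoint.mono_right h he.2⟩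

/-- No block can be attached at `w`. -/
def Stuck (ed : ι → Finset V) (w₀ : V) (Y : V → σ) (θ : ℕ) (w : V) (A : Finset V) : Prop :=
  ∀ f, w ∈ ed f → ClusterEdge ed w₀ Y f → (hanging ed w₀ Y f A).card < θ

/-- Every hyperedge of the cluster meets `A` or hangs on one that does. At most Δ|A| hyperedges meet
`A`, and each accounts for itself and fewer than θ hanging ones. -/
theorem LinearFamily.card_le_of_stuck {ed : ι → Finset V} {k Δ : ℕ} (h : LinearFamily ed k Δ)
    {w₀ : V} {Y : V → σ} {θ : ℕ} {A : Finset V} (hA : w₀ ∈ A)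
    (hs : ∀ w ∈ A, Stuck ed w₀ Y θ w A) {E : Finset ι} (hE : ∀ e ∈ E, ClusterEdge ed w₀ Y e) :
    E.card ≤ A.card * (Δ * θ) := by
  classical
  have h1 : ∀ e, ClusterEdge ed w₀ Y e → ¬ Disjoint (ed e) A ∨
      ∃ f, ClusterEdge ed w₀ Y f ∧ ¬ Disjoint (ed f) A ∧ e ∈ hanging ed w₀ Y f A := by
    intro e he
    have he' := he
    unfold ClusterEdge at he'
    induction he' with
    | base e h h' =>
      refine Or.inl fun hd => h' (Disjoint.mono_right (by simpa using hA) hd)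
    | step e f hf h h' ih =>
      by_cases hd : Disjoint (ed e) A
      · right
        rcases ih hf with hfA | ⟨f', hf', hfA', hff'⟩
        · exact ⟨f, hf, hfA, mem_hanging.2 (.base e ⟨he, hd⟩ h')⟩
        · exact ⟨f', hf', hfA', mem_hanging.2 (.step e f (mem_hanging.1 hff') ⟨he, hd⟩ h')⟩
      · exact Or.inl hd
  have h2 : E ⊆ A.biUnion fun w => (Finset.univ.filter fun f => w ∈ ed f ∧
      ClusterEdge ed w₀ Y f).biUnion fun f => insert f (hanging ed w₀ Y f A) := by
    intro e he
    simp only [Finset.mem_biUnion, Finset.mem_filter, Finset.mem_univ, true_and,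
      Finset.mem_insert]
    rcases h1 e (hE e he) with h3 | ⟨f, hf, hfA, hef⟩
    · obtain ⟨x, hx, hxA⟩ := Finset.not_disjoint_iff.1 h3
      exact ⟨x, hxA, e, ⟨hx, hE e he⟩, Or.inl rfl⟩
    · obtain ⟨x, hx, hxA⟩ := Finset.not_disjoint_iff.1 hfA
      exact ⟨x, hxA, f, ⟨hx, hf⟩, Or.inr hef⟩
  refine (Finset.card_le_card h2).trans (Finset.card_biUnion_le.trans ?_)
  rw [← smul_eq_mul]
  refine Finset.sum_le_card_nsmul _ _ _ fun w hw => ?_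
  refine Finset.card_biUnion_le.trans ?_
  refine (Finset.sum_le_card_nsmul _ _ θ fun f hf => ?_).trans ?_
  · rw [Finset.mem_filter] at hf
    have := hs w hw f hf.2.1 hf.2.2
    have := Finset.card_insert_le f (hanging ed w₀ Y f A)
    omega
  · rw [smul_eq_mul]
    refine Nat.mul_le_mul_right _ ((Finset.card_le_card fun f hf => ?_).trans (h.deg w))
    simp only [Finset.mem_filter] at hf ⊢
    exact ⟨hf.1, hf.2.1⟩

/-- A large cluster contains many blocks. -/
theorem LinearFamily.explore_of_cluster {ed : ι → Finset V} {k Δ : ℕ}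
    (h : LinearFamily ed k Δ) {w₀ : V} {Y : V → σ} {θ M : ℕ} {E : Finset ι}
    (hE : ∀ e ∈ E, ClusterEdge ed w₀ Y e) (hM : M * (Δ * θ) < E.card) (l : ℕ) :
    ∀ (Q : List V) (A : Finset V), w₀ ∈ A →
      (∀ w ∈ A, w ∉ Q → Stuck ed w₀ Y θ w A) → A.card + k * θ * l ≤ M → Explore ed θ Y l Q A := by
  -- Nested induction on the number of blocks still to be found and on the queue. Enlarging `A` only
  -- shrinks the hanging parts, so stuck vertices stay stuck and can be removed for good. If the
  -- queue ran empty too early, the cluster would have at most MΔθ hyperedges.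
  induction l with
  | zero => intro Q A _ _ _; exact .done Q A
  | succ l ihl =>
    intro Q
    induction Q with
    | nil =>
      intro A hA hs hAM
      exfalso
      have h1 := h.card_le_of_stuck hA (fun w hw => hs w hw (by simp)) hE
      have h2 : A.card * (Δ * θ) ≤ M * (Δ * θ) := Nat.mul_le_mul_right _ (by omega)
      omega
    | cons w Q ihQ =>
      intro A hA hs hAM
      by_cases hw : Stuck ed w₀ Y θ w A
      · refine .skip l w Q A (ihQ A hA (fun w' hw' hwQ => ?_) hAM)
        by_cases hww : w' = w
        · subst hww; exact hw
        · exact hs w' hw' (by simp [hww, hwQ])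
      · unfold Stuck at hw
        push Not at hw
        obtain ⟨f, hwf, hf, hcard⟩ := hw
        obtain ⟨S, hS, hSR⟩ := exists_mem_attached (fun e => mem_hanging) θ hcard
        have hreach := fun g (hg : g ∈ S) => mem_hanging.1 (hSR hg)
        have hdis : Disjoint (S.biUnion ed) A :=
          (Finset.disjoint_biUnion_left _ _ _).2 fun g hg => (hreach g hg).prop.2
        have hblock : S ∈ blocks ed θ w A := by
          simp only [blocks, Finset.mem_filter, Finset.mem_biUnion]
          exact ⟨⟨f, ⟨Finset.mem_univ _, hwf⟩, hS⟩, hdis⟩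
        -- The vertex w stays at the head of the queue, since further blocks may be attached to it.
        refine .block l w Q A S hblock (mono_of_edgeReach hA hf hreach)
          (ihl _ _ (Finset.mem_union_left _ hA) (fun w' hw' hwQ => ?_) ?_)
        · simp only [List.mem_append, Finset.mem_toList, not_or] at hwQ
          rcases Finset.mem_union.1 hw' with hw' | hw'
          · intro f' hf' hcf'
            exact (Finset.card_le_card (hanging_anti Finset.subset_union_left)).trans_lt
              (hs w' hw' hwQ.1 f' hf' hcf')
          · exact absurd hw' hwQ.2
        · have h1 := h.card_biUnion_le S
          rw [card_of_mem_attached S hS] at h1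
          have h2 := Finset.card_union_le A (S.biUnion ed)
          rw [mul_add, mul_one] at hAM
          omega

/-- The probability that an exploration finds `l` blocks. -/
theorem LinearFamily.explore_le {ed : ι → Finset V} {k Δ : ℕ} (h : LinearFamily ed k Δ)
    [Fintype σ] {Φ : ((V → σ) → ℝ) → ℝ} (hΦ : IsExpectation Φ) {π ρ : ℝ} (hπ0 : 0 ≤ π)
    (hπ1 : π ≤ 1) (hcyl : ∀ (W : Finset V) (τ : V → σ),
      Φ (fun Y => ind (∀ v ∈ W, Y v = τ v)) ≤ π ^ W.card) {θ : ℕ} (hρ0 : 0 ≤ ρ)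
    (hρ : (Δ * (Δ * (k * θ)) ^ θ : ℕ) * (Fintype.card σ * π ^ ((k - θ) * θ)) * 2 ^ (k * θ + 1) ≤ ρ)
    (l : ℕ) : ∀ (Q : List V) (A W : Finset V) (τ : V → σ), W ⊆ A →
      Φ (fun Y => ind ((∀ v ∈ W, Y v = τ v) ∧ Explore ed θ Y l Q A)) ≤
        π ^ W.card * 2 ^ Q.length * ρ ^ l := by
  -- `W` records the vertices whose buckets are already fixed. The weight 2^|Q| balances the
  -- recursion: with `Q` the tail of the queue, skipping its head and attaching a block each
  -- contribute at most π^|W| 2^|Q| ρ^(l+1). A block keeps the head and appends at most kθ vertices,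
  -- which explains 2^(kθ+1) in `hρ`.
  induction l with
  | zero =>
    intro Q A W τ _
    refine (hΦ.mono _ _ fun Y => ind_mono fun hY => hY.1).trans ((hcyl W τ).trans ?_)
    rw [pow_zero, mul_one]
    exact le_mul_of_one_le_right (by positivity) (one_le_pow₀ (by norm_num))
  | succ l ihl =>
    intro Q
    induction Q with
    | nil =>
      intro A W τ _
      have : ∀ Y : V → σ, ind ((∀ v ∈ W, Y v = τ v) ∧ Explore ed θ Y (l + 1) [] A) = 0 := by
        intro Y
        refine ind_false fun hY => ?_
        cases hY.2
      simp only [this, hΦ.const]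
      positivity
    | cons w Q ihQ =>
      intro A W τ hWA
      set B := blocks ed θ w A with hB
      have h1 : ∀ Y : V → σ, ind ((∀ v ∈ W, Y v = τ v) ∧ Explore ed θ Y (l + 1) (w :: Q) A) ≤
          ind ((∀ v ∈ W, Y v = τ v) ∧ Explore ed θ Y (l + 1) Q A) +
          ∑ S ∈ B, ∑ c : σ, ind ((∀ v ∈ W ∪ S.biUnion ed, Y v = if v ∈ W then τ v else c) ∧
            Explore ed θ Y l (w :: Q ++ (S.biUnion ed).toList) (A ∪ S.biUnion ed)) := by
        intro Y
        have h2 : ∑ S ∈ B, ind (∃ c ∈ (Finset.univ : Finset σ),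
            (∀ v ∈ W ∪ S.biUnion ed, Y v = if v ∈ W then τ v else c) ∧
            Explore ed θ Y l (w :: Q ++ (S.biUnion ed).toList) (A ∪ S.biUnion ed)) ≤
            ∑ S ∈ B, ∑ c : σ, ind ((∀ v ∈ W ∪ S.biUnion ed, Y v = if v ∈ W then τ v else c) ∧
            Explore ed θ Y l (w :: Q ++ (S.biUnion ed).toList) (A ∪ S.biUnion ed)) :=
          Finset.sum_le_sum fun S _ => ind_exists_le
        refine le_trans ?_ (add_le_add le_rfl (ind_exists_le.trans h2))
        refine le_trans (ind_mono ?_) (ind_or_le _ _)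
        rintro ⟨hY, hexp⟩
        cases hexp with
        | skip _ _ _ _ h => exact Or.inl ⟨hY, h⟩
        | block _ _ _ _ S hS hmono h =>
          obtain ⟨c, hc⟩ := hmono
          refine Or.inr ⟨S, hS, c, Finset.mem_univ _, fun v hv => ?_, h⟩
          split_ifs with hvW
          · exact hY v hvW
          · exact hc v ((Finset.mem_union.1 hv).resolve_left hvW)
      refine (hΦ.mono _ _ h1).trans ?_
      rw [hΦ.add, hΦ.sum]
      have h3 : ∀ S ∈ B, Φ (fun Y => ∑ c : σ,
          ind ((∀ v ∈ W ∪ S.biUnion ed, Y v = if v ∈ W then τ v else c) ∧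
            Explore ed θ Y l (w :: Q ++ (S.biUnion ed).toList) (A ∪ S.biUnion ed))) ≤
          Fintype.card σ * (π ^ W.card * π ^ ((k - θ) * θ) *
            2 ^ (Q.length + 1 + k * θ) * ρ ^ l) := by
        intro S hS
        rw [hΦ.sum, ← nsmul_eq_mul]
        refine Finset.sum_le_card_nsmul _ _ _ fun c _ => ?_
        refine (ihl _ _ _ _ (Finset.union_subset_union_left hWA)).trans ?_
        have hScard := card_of_mem_blocks hS
        have hdis : Disjoint W (S.biUnion ed) := by
          simp only [hB, blocks, Finset.mem_filter] at hS
          exact (Disjoint.mono_right hWA hS.2).symm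
        have h4 := h.card_biUnion_le S
        have h5 := h.le_card_biUnion S hScard.le
        rw [hScard] at h4 h5
        rw [Finset.card_union_of_disjoint hdis, pow_add]
        have h6 : π ^ (S.biUnion ed).card ≤ π ^ ((k - θ) * θ) :=
          pow_le_pow_of_le_one hπ0 hπ1 h5
        have h7 : (2 : ℝ) ^ (w :: Q ++ (S.biUnion ed).toList).length ≤
            2 ^ (Q.length + 1 + k * θ) := by
          refine pow_le_pow_right₀ (by norm_num) ?_
          simp only [List.length_append, List.length_cons, Finset.length_toList]
          omega
        gcongr
      have h8 : ∑ S ∈ B, Φ (fun Y => ∑ c : σ,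
          ind ((∀ v ∈ W ∪ S.biUnion ed, Y v = if v ∈ W then τ v else c) ∧
            Explore ed θ Y l (w :: Q ++ (S.biUnion ed).toList) (A ∪ S.biUnion ed))) ≤
          π ^ W.card * 2 ^ Q.length * ρ ^ l * ρ := by
        refine (Finset.sum_le_card_nsmul _ _ _ h3).trans ?_
        rw [nsmul_eq_mul]
        have h9 : (B.card : ℝ) ≤ (Δ * (Δ * (k * θ)) ^ θ : ℕ) := by
          exact_mod_cast h.card_blocks_le θ w A
        calc _ ≤ ((Δ * (Δ * (k * θ)) ^ θ : ℕ) : ℝ) * (Fintype.card σ * (π ^ W.card *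
              π ^ ((k - θ) * θ) * 2 ^ (Q.length + 1 + k * θ) * ρ ^ l)) := by gcongr
          _ = π ^ W.card * 2 ^ Q.length * ρ ^ l * ((Δ * (Δ * (k * θ)) ^ θ : ℕ) *
              (Fintype.card σ * π ^ ((k - θ) * θ)) * 2 ^ (k * θ + 1)) := by
              rw [show Q.length + 1 + k * θ = Q.length + (k * θ + 1) by ring, pow_add]
              ring
          _ ≤ _ := by gcongr
      refine (add_le_add (ihQ A W τ hWA) h8).trans (le_of_eq ?_)
      rw [List.length_cons]
      ring

/-- Large clusters are unlikely. -/
theorem LinearFamily.cluster_le {ed : ι → Finset V} {k Δ : ℕ} (h : LinearFamily ed k Δ)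
    [Fintype σ] [Nonempty σ] {Φ : ((V → σ) → ℝ) → ℝ} (hΦ : IsExpectation Φ) {π ρ : ℝ}
    (hπ0 : 0 ≤ π) (hπ1 : π ≤ 1) (hcyl : ∀ (W : Finset V) (τ : V → σ),
      Φ (fun Y => ind (∀ v ∈ W, Y v = τ v)) ≤ π ^ W.card) {θ : ℕ} (hρ0 : 0 ≤ ρ)
    (hρ : (Δ * (Δ * (k * θ)) ^ θ : ℕ) * (Fintype.card σ * π ^ ((k - θ) * θ)) * 2 ^ (k * θ + 1) ≤ ρ)
    (l : ℕ) (w₀ : V) :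
    Φ (fun Y => ind (∃ E : Finset ι, (∀ e ∈ E, ClusterEdge ed w₀ Y e) ∧
      (1 + k * θ * l) * (Δ * θ) < E.card)) ≤ 2 * ρ ^ l := by
  have h1 := h.explore_le hΦ hπ0 hπ1 hcyl hρ0 hρ l [w₀] {w₀} ∅
    (fun _ => Classical.arbitrary σ) (Finset.empty_subset _)
  simp only [Finset.card_empty, pow_zero, one_mul, List.length_singleton, pow_one] at h1
  refine (hΦ.mono _ _ fun Y => ind_mono ?_).trans h1
  rintro ⟨E, hE, hcard⟩
  refine ⟨by simp, h.explore_of_cluster hE hcard l [w₀] {w₀} (Finset.mem_singleton_self _)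
    (fun w hw hw' => ?_) (by simp)⟩
  rw [Finset.mem_singleton] at hw
  exact absurd (by simp [hw]) hw'

end Clusters

/-! ### The deterministic parts of the algorithm -/

section Specs

/-- All values of `Z` on a list and the value `c`, as far as they are defined, agree. -/
def Agrees {n : ℕ} {κ : Type} (Z : Fin n → Option κ) (l : List (Fin n)) (c : Option κ) : Prop :=
  ∃ a, (∀ b, c = some b → b = a) ∧ ∀ v ∈ l, ∀ b, Z v = some b → b = a

theorem spec_agree {n : ℕ} {κ : Type} [DecidableEq κ] [Nonempty κ] (Z : Fin n → Option κ)
    (l : List (Fin n)) : ∀ c : Option κ,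
      (agree Z l c).Spec fun b t => (b = true ↔ Agrees Z l c) ∧ t ≤ l.length := by
  induction l with
  | nil =>
    intro c
    refine spec_pure ⟨iff_of_true rfl ?_, le_rfl⟩
    rcases c with _ | b
    · exact ⟨Classical.arbitrary κ, by simp, by simp⟩
    · exact ⟨b, by simp, by simp⟩
  | cons v vs ih =>
    intro c
    refine spec_tick_bind ?_
    have hlen : ∀ t, t ≤ vs.length → 1 + t ≤ (v :: vs).length := fun t ht => by
      rw [List.length_cons]; omega
    rcases hv : Z v with _ | a <;> rcases c with _ | b
    · refine (ih none).mono fun r t h => ⟨h.1.trans ?_, hlen t h.2⟩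
      unfold Agrees
      simp [hv]
    · refine (ih (some b)).mono fun r t h => ⟨h.1.trans ?_, hlen t h.2⟩
      unfold Agrees
      simp [hv]
    · refine (ih (some a)).mono fun r t h => ⟨h.1.trans ?_, hlen t h.2⟩
      unfold Agrees
      simp [hv]
    · dsimp only
      split_ifs with hab
      · refine (ih (some a)).mono fun r t h => ⟨h.1.trans ?_, hlen t h.2⟩
        unfold Agrees
        simp [hv, hab]
      · refine spec_pure ⟨?_, by simp⟩
        simp only [Bool.false_eq_true, false_iff]
        rintro ⟨x, hx, hx'⟩
        exact hab ((hx' v (by simp) a hv).trans (hx b rfl).symm)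

variable {n m s q : ℕ} {H : Hypergraph (Fin n)}

/-- The vertex set of a numbered hyperedge. -/
def IncidenceLists.ed (I : IncidenceLists H m) (e : Fin m) : Finset (Fin n) := (I.verts e).toFinset

theorem spec_allProper (I : IncidenceLists H m) {k : ℕ} (hk : ∀ e, (I.verts e).length = k)
    [Nonempty (Fin q)] (X : Fin n → Fin q) (es : List (Fin m)) :
    (allProper I X es).Spec fun b t => (b = true ↔ ∀ e ∈ es, ¬ Mono (I.ed e) X) ∧
      t ≤ es.length * (k + 1) := by
  induction es with
  | nil => exact spec_pure (by simp)
  | cons e es ih =>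
    refine spec_tick_bind (spec_bind (spec_agree _ _ _) ?_)
    rintro b t ⟨hb, ht⟩
    rw [hk] at ht
    have hmono : Agrees (fun v => some (X v)) (I.verts e) none ↔ Mono (I.ed e) X := by
      unfold Agrees Mono IncidenceLists.ed
      simp
    rw [hmono] at hb
    split_ifs with h
    · refine spec_pure ⟨?_, ?_⟩
      · simp only [Bool.false_eq_true, false_iff]
        exact fun hc => hc e (by simp) (hb.1 h)
      · rw [List.length_cons, add_mul]; omega
    · refine ih.mono fun b' t' h' => ⟨h'.1.trans ?_, ?_⟩
      · have h1 : ¬ Mono (I.ed e) X := fun hm => h (hb.2 hm)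
        simp [h1]
      · rw [List.length_cons, add_mul]; omega

theorem spec_pushVertices (l : List (Fin n)) : ∀ σ : SearchState n m,
    (pushVertices l σ).Spec fun σ' t => t ≤ l.length ∧ ∃ new : List (Fin n), new.Nodup ∧
      (∀ v, v ∈ new ↔ v ∈ l ∧ v ∉ σ.markedV) ∧
      σ' = { σ with
        markedV := σ.markedV ∪ l.toFinset, stack := new ++ σ.stack, compV := new ++ σ.compV } := by
  induction l with
  | nil => exact fun σ => spec_pure ⟨le_rfl, [], by simp⟩
  | cons v vs ih =>
    intro σ
    refine spec_tick_bind ?_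
    split_ifs with hv
    · refine (ih σ).mono ?_
      rintro σ' t ⟨ht, new, hnd, hmem, rfl⟩
      refine ⟨by rw [List.length_cons]; omega, new, hnd, fun x => ?_, ?_⟩
      · rw [hmem, List.mem_cons]
        constructor
        · rintro ⟨h1, h2⟩; exact ⟨Or.inr h1, h2⟩
        · rintro ⟨rfl | h1, h2⟩
          · exact absurd hv h2
          · exact ⟨h1, h2⟩
      · congr 1
        rw [List.toFinset_cons]
        ext x
        simp only [Finset.mem_union, Finset.mem_insert]
        constructor
        · rintro (h | h) <;> simp [h]
        · rintro (h | rfl | h) <;> simp [*]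
    · refine (ih _).mono ?_
      rintro σ' t ⟨ht, new, hnd, hmem, rfl⟩
      refine ⟨by rw [List.length_cons]; omega, new ++ [v], ?_, fun x => ?_, ?_⟩
      · rw [List.nodup_append]
        refine ⟨hnd, List.nodup_singleton v, ?_⟩
        rintro x hx y hy rfl
        rw [List.mem_singleton] at hy
        subst hy
        have := ((hmem x).1 hx).2
        simp at this
      · simp only [List.mem_append, hmem, Finset.mem_insert, List.mem_cons, List.not_mem_nil,
          or_false]
        constructor
        · rintro (⟨h1, h2⟩ | rfl)
          · exact ⟨Or.inr h1, fun h => h2 (Or.inr h)⟩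
          · exact ⟨Or.inl rfl, hv⟩
        · rintro ⟨rfl | h1, h2⟩
          · exact Or.inr rfl
          · by_cases hxv : x = v
            · exact Or.inr hxv
            · exact Or.inl ⟨h1, by simp [hxv, h2]⟩
      · simp only [List.append_assoc, List.singleton_append]
        congr 1
        rw [List.toFinset_cons]
        ext x
        simp only [Finset.mem_union, Finset.mem_insert]
        tauto

/-- The hyperedge `e` is not satisfied by the partial image `Y`. -/
def Unsat (I : IncidenceLists H m) (Y : Fin n → Option (Fin s)) (e : Fin m) : Prop :=
  Agrees Y (I.verts e) none

/-- The cluster of `w` has more than `K` hyperedges. -/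
def Large (I : IncidenceLists H m) (Y : Fin n → Option (Fin s)) (K : ℝ) (w : Fin n) : Prop :=
  ∃ E : Finset (Fin m), (∀ e ∈ E, EdgeReach I.ed (Unsat I Y) {w} e) ∧ K < E.card

/-- Marks that consist of complete connected components. -/
structure ClosedMarks (I : IncidenceLists H m) (Y : Fin n → Option (Fin s)) (MV : Finset (Fin n))
    (ME : Finset (Fin m)) : Prop where
  mem : ∀ e, Unsat I Y e → ¬ Disjoint (I.ed e) MV → e ∈ ME
  subset : ∀ e ∈ ME, I.ed e ⊆ MV

/-- The invariant of the depth-first search from `w`. -/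
structure SearchInv (I : IncidenceLists H m) (Y : Fin n → Option (Fin s)) (K : ℝ)
    (MV : Finset (Fin n)) (ME : Finset (Fin m)) (w : Fin n) (σ : SearchState n m) : Prop where
  markedV : σ.markedV = MV ∪ σ.compV.toFinset
  markedE : σ.markedE = ME ∪ σ.compE.toFinset
  nodupV : σ.compV.Nodup
  nodupE : σ.compE.Nodup
  disjV : ∀ v ∈ σ.compV, v ∉ MV
  numE : σ.numE = σ.compE.length
  numE_le : (σ.numE : ℝ) ≤ K
  unsat : ∀ e ∈ σ.compE, Unsat I Y e ∧ I.ed e ⊆ σ.compV.toFinset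
  reach : ∀ e ∈ σ.compE, EdgeReach I.ed (Unsat I Y) {w} e
  mem_w : w ∈ σ.compV
  mem_compV : ∀ v ∈ σ.compV, v = w ∨ ∃ e ∈ σ.compE, v ∈ I.ed e
  lengthV : ∀ k, (∀ e, (I.verts e).length = k) → σ.compV.length ≤ 1 + k * σ.numE
  stack : ∀ v ∈ σ.stack, v ∈ σ.compV

/-- An entry costs one step, plus at most k for `agree` and k for pushing vertices. Earlier marks
form complete components, so an unmarked unsatisfied hyperedge is disjoint from them and belongs to
the current component. -/
theorem spec_scanEdges (I : IncidenceLists H m) [Nonempty (Fin s)] {k : ℕ}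
    (hk : ∀ e, (I.verts e).length = k) {Y : Fin n → Option (Fin s)} {K : ℝ}
    {MV : Finset (Fin n)} {ME : Finset (Fin m)} (hM : ClosedMarks I Y MV ME) {w v : Fin n}
    (es : List (Fin m)) : ∀ σ : SearchState n m, SearchInv I Y K MV ME w σ → v ∈ σ.compV →
      (∀ e ∈ es, v ∈ I.ed e) →
      (scanEdges I Y K es σ).Spec fun r t => t ≤ es.length * (2 * k + 1) ∧
        (r = none → Large I Y K w) ∧
        ∀ σ', r = some σ' → SearchInv I Y K MV ME w σ' ∧
          (∃ new : List (Fin n), σ'.compV = new ++ σ.compV ∧ σ'.stack = new ++ σ.stack) ∧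
          σ.markedE ⊆ σ'.markedE ∧ ∀ e ∈ es, Unsat I Y e → e ∈ σ'.markedE := by
  induction es with
  | nil =>
    intro σ hσ _ _
    refine spec_pure ⟨by simp, by simp, ?_⟩
    rintro σ' h
    obtain rfl := Option.some.inj h
    exact ⟨hσ, ⟨[], by simp⟩, subset_rfl, by simp⟩
  | cons e es ih =>
    intro σ hσ hv hes
    have hes' : ∀ e ∈ es, v ∈ I.ed e := fun f hf => hes f (List.mem_cons_of_mem _ hf)
    refine spec_tick_bind ?_
    by_cases he : e ∈ σ.markedE
    · rw [if_pos he]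
      refine (ih σ hσ hv hes').mono ?_
      rintro r t ⟨ht, hnone, hsome⟩
      refine ⟨by rw [List.length_cons, add_mul]; omega, hnone, fun σ' hr => ?_⟩
      obtain ⟨h1, h2, h3, h4⟩ := hsome σ' hr
      refine ⟨h1, h2, h3, fun f hf hfu => ?_⟩
      rcases List.mem_cons.1 hf with rfl | hf
      · exact h3 he
      · exact h4 f hf hfu
    · rw [if_neg he]
      refine spec_bind (spec_agree _ _ _) ?_
      rintro b t ⟨hb, ht⟩
      rw [hk] at ht
      change b = true ↔ Unsat I Y e at hb
      split_ifs with hbt hK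
      · have heu := hb.1 hbt
        have hve := hes e (by simp)
        have heC : e ∉ σ.compE := fun h => he (by rw [hσ.markedE]; simp [h])
        have hereach : EdgeReach I.ed (Unsat I Y) {w} e := by
          rcases hσ.mem_compV v hv with rfl | ⟨f, hf, hvf⟩
          · exact .base e heu (by simpa using hve)
          · exact .step e f (hσ.reach f hf) heu (Finset.not_disjoint_iff.2 ⟨v, hve, hvf⟩)
        refine spec_pure ⟨by rw [List.length_cons, add_mul]; omega, fun _ => ?_, by simp⟩
        -- The hyperedge that triggers the stop is reachable and new, and exceeds the threshold
        -- together with those collected before.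
        refine ⟨insert e σ.compE.toFinset, fun f hf => ?_, ?_⟩
        · rcases Finset.mem_insert.1 hf with rfl | hf
          · exact hereach
          · exact hσ.reach f (by simpa using hf)
        · rw [Finset.card_insert_of_notMem (by simpa using heC),
            List.toFinset_card_of_nodup hσ.nodupE, ← hσ.numE]
          exact hK
      · have heu := hb.1 hbt
        have hve := hes e (by simp)
        have heC : e ∉ σ.compE := fun h => he (by rw [hσ.markedE]; simp [h])
        have hereach : EdgeReach I.ed (Unsat I Y) {w} e := by
          rcases hσ.mem_compV v hv with rfl | ⟨f, hf, hvf⟩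
          · exact .base e heu (by simpa using hve)
          · exact .step e f (hσ.reach f hf) heu (Finset.not_disjoint_iff.2 ⟨v, hve, hvf⟩)
        have heMV : Disjoint (I.ed e) MV := by
          by_contra hd
          exact he (by rw [hσ.markedE]; exact Finset.mem_union_left _ (hM.mem e heu hd))
        refine spec_bind (spec_pushVertices _ _) ?_
        rintro σ₁ t₁ ⟨ht₁, new, hnd, hmem, rfl⟩
        rw [hk] at ht₁
        have hnew : ∀ x, x ∈ new ↔ x ∈ I.verts e ∧ x ∉ σ.compV := by
          intro x
          rw [hmem]
          dsimp only
          rw [hσ.markedV]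
          constructor
          · rintro ⟨h1, h2⟩
            exact ⟨h1, fun h => h2 (by simp [h])⟩
          · rintro ⟨h1, h2⟩
            refine ⟨h1, fun h => ?_⟩
            rcases Finset.mem_union.1 h with h | h
            · exact Finset.disjoint_left.1 heMV (by simpa [IncidenceLists.ed] using h1) h
            · exact h2 (by simpa using h)
        have hsubset : I.ed e ⊆ (new ++ σ.compV).toFinset := by
          intro x hx
          rw [List.mem_toFinset, List.mem_append, hnew]
          have hx' : x ∈ I.verts e := by simpa [IncidenceLists.ed] using hx
          by_cases hxc : x ∈ σ.compV
          · exact Or.inr hxc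
          · exact Or.inl ⟨hx', hxc⟩
        have hInv : SearchInv I Y K MV ME w
            { σ with
              markedV := σ.markedV ∪ (I.verts e).toFinset, markedE := insert e σ.markedE,
              stack := new ++ σ.stack, compV := new ++ σ.compV, compE := e :: σ.compE,
              numE := σ.numE + 1 } :=
          { markedV := by
              dsimp only
              rw [hσ.markedV]
              ext x
              simp only [Finset.mem_union, List.mem_toFinset, List.mem_append, hnew]
              tauto
            markedE := by
              dsimp only
              rw [hσ.markedE, List.toFinset_cons, Finset.union_insert]
            nodupV := by
              dsimp only
              rw [List.nodup_append]
              refine ⟨hnd, hσ.nodupV, ?_⟩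
              rintro x hx y hy rfl
              exact ((hnew x).1 hx).2 hy
            nodupE := List.nodup_cons.2 ⟨heC, hσ.nodupE⟩
            disjV := by
              intro x hx
              rcases List.mem_append.1 hx with hx | hx
              · exact Finset.disjoint_left.1 heMV
                  (by simpa [IncidenceLists.ed] using ((hnew x).1 hx).1)
              · exact hσ.disjV x hx
            numE := by simp [hσ.numE]
            numE_le := not_lt.1 hK
            unsat := by
              intro f hf
              rcases List.mem_cons.1 hf with rfl | hf
              · exact ⟨heu, hsubset⟩
              · refine ⟨(hσ.unsat f hf).1, (hσ.unsat f hf).2.trans fun x hx => ?_⟩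
                rw [List.mem_toFinset] at hx ⊢
                exact List.mem_append_right _ hx
            reach := by
              intro f hf
              rcases List.mem_cons.1 hf with rfl | hf
              · exact hereach
              · exact hσ.reach f hf
            mem_w := List.mem_append_right _ hσ.mem_w
            mem_compV := by
              intro x hx
              rcases List.mem_append.1 hx with hx | hx
              · exact Or.inr ⟨e, by simp, by simpa [IncidenceLists.ed] using ((hnew x).1 hx).1⟩
              · rcases hσ.mem_compV x hx with h | ⟨f, hf, hxf⟩
                · exact Or.inl h
                · exact Or.inr ⟨f, by simp [hf], hxf⟩
            lengthV := by
              intro k' hk'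
              have h1 := hσ.lengthV k' hk'
              have h2 : new.length ≤ k' := by
                rw [← hk' e, ← List.toFinset_card_of_nodup hnd,
                  ← List.toFinset_card_of_nodup (I.nodup_verts e)]
                refine Finset.card_le_card fun x hx => ?_
                rw [List.mem_toFinset] at hx ⊢
                exact ((hnew x).1 hx).1
              dsimp only
              rw [List.length_append, mul_add]
              omega
            stack := by
              intro x hx
              rcases List.mem_append.1 hx with hx | hx
              · exact List.mem_append_left _ hx
              · exact List.mem_append_right _ (hσ.stack x hx) }
        refine (ih _ hInv (List.mem_append_right _ hv) hes').mono ?_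
        rintro r t₂ ⟨ht₂, hnone, hsome⟩
        refine ⟨by rw [List.length_cons, add_mul]; omega, hnone, fun σ' hr => ?_⟩
        obtain ⟨h1, ⟨new', h2, h2'⟩, h3, h4⟩ := hsome σ' hr
        refine ⟨h1, ⟨new' ++ new, by simp [h2], by simp [h2']⟩,
          (Finset.subset_insert e σ.markedE).trans h3, fun f hf hfu => ?_⟩
        rcases List.mem_cons.1 hf with rfl | hf
        · exact h3 (Finset.mem_insert_self _ _)
        · exact h4 f hf hfu
      · refine (ih σ hσ hv hes').mono ?_
        rintro r t' ⟨ht', hnone, hsome⟩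
        refine ⟨by rw [List.length_cons, add_mul]; omega, hnone, fun σ' hr => ?_⟩
        obtain ⟨h1, h2, h3, h4⟩ := hsome σ' hr
        refine ⟨h1, h2, h3, fun f hf hfu => ?_⟩
        rcases List.mem_cons.1 hf with rfl | hf
        · exact absurd (hb.2 hfu) hbt
        · exact h4 f hf hfu

/-- Here p counts the vertices already taken off the stack. As p plus the height of the stack is the
size of the component, at most n, the fuel n - p suffices. A round costs at most 1 + Δ(2k + 1); a
component has at most 1 + k⌊K⌋ vertices, and one last round may find the stack empty, hence the 2.
-/
theorem spec_search (I : IncidenceLists H m) [Nonempty (Fin s)] {k Δ : ℕ}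
    (hk : ∀ e, (I.verts e).length = k) (hΔ : ∀ v, (I.inc v).length ≤ Δ)
    {Y : Fin n → Option (Fin s)} {K : ℝ} {MV : Finset (Fin n)} {ME : Finset (Fin m)}
    (hM : ClosedMarks I Y MV ME) {w : Fin n} (f : ℕ) : ∀ (σ : SearchState n m) (p : ℕ),
      SearchInv I Y K MV ME w σ → σ.compV.length = p + σ.stack.length → f + p = n →
      (∀ v ∈ σ.compV, v ∈ σ.stack ∨ ∀ e, Unsat I Y e → v ∈ I.ed e → e ∈ σ.markedE) →
      (search I Y K f σ).Spec fun r t =>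
        t + p * (1 + Δ * (2 * k + 1)) ≤ (2 + k * ⌊K⌋₊) * (1 + Δ * (2 * k + 1)) ∧
        (r = none → Large I Y K w) ∧
        ∀ σ', r = some σ' → SearchInv I Y K MV ME w σ' ∧
          ∀ v ∈ σ'.compV, ∀ e, Unsat I Y e → v ∈ I.ed e → e ∈ σ'.markedE := by
  have hbound : ∀ (σ : SearchState n m) (p : ℕ), SearchInv I Y K MV ME w σ →
      σ.compV.length = p + σ.stack.length → p + σ.stack.length ≤ 1 + k * ⌊K⌋₊ := by
    intro σ p hσ hp
    have h1 := hσ.lengthV k hk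
    have h2 : σ.numE ≤ ⌊K⌋₊ := Nat.le_floor hσ.numE_le
    have h3 := Nat.mul_le_mul_left k h2
    omega
  induction f with
  | zero =>
    intro σ p hσ hp hfp hcl
    have h1 := hσ.nodupV.length_le_card
    rw [Fintype.card_fin] at h1
    have hst : σ.stack = [] := List.length_eq_zero_iff.1 (by omega)
    have h2 := hbound σ p hσ hp
    refine spec_pure ⟨?_, by simp, ?_⟩
    · rw [zero_add]
      exact Nat.mul_le_mul_right _ (by omega)
    · rintro σ' h
      obtain rfl := Option.some.inj h
      refine ⟨hσ, fun v hv => (hcl v hv).resolve_left (by simp [hst])⟩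
  | succ f ih =>
    intro σ p hσ hp hfp hcl
    have h2 := hbound σ p hσ hp
    refine spec_tick_bind ?_
    rcases hst : σ.stack with _ | ⟨v, st⟩
    · refine spec_pure ⟨?_, by simp, ?_⟩
      · calc 1 + 0 + p * (1 + Δ * (2 * k + 1)) ≤ (1 + p) * (1 + Δ * (2 * k + 1)) := by
              rw [add_mul]; omega
          _ ≤ _ := Nat.mul_le_mul_right _ (by omega)
      · rintro σ' h
        obtain rfl := Option.some.inj h
        refine ⟨hσ, fun v hv => (hcl v hv).resolve_left (by simp [hst])⟩
    · dsimp only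
      rw [hst] at h2 hp
      simp only [List.length_cons] at h2 hp
      have hσ₀ : SearchInv I Y K MV ME w { σ with stack := st } :=
        { hσ with stack := fun x hx => hσ.stack x (by rw [hst]; exact List.mem_cons_of_mem _ hx) }
      have hvC : v ∈ σ.compV := hσ.stack v (by simp [hst])
      refine spec_bind (spec_scanEdges I hk hM (v := v) (I.inc v) _ hσ₀ hvC (fun e he => by
        rw [I.mem_inc] at he
        simpa [IncidenceLists.ed] using he)) ?_
      rintro r t ⟨ht, hnone, hsome⟩
      have ht' : t ≤ Δ * (2 * k + 1) := ht.trans (Nat.mul_le_mul_right _ (hΔ v))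
      rcases r with _ | σ₁
      · refine spec_pure ⟨?_, fun _ => hnone rfl, by simp⟩
        calc 1 + (t + 0) + p * (1 + Δ * (2 * k + 1)) ≤ (1 + p) * (1 + Δ * (2 * k + 1)) := by
              rw [add_mul]; omega
          _ ≤ _ := Nat.mul_le_mul_right _ (by omega)
      · obtain ⟨h3, ⟨new, h4, h4'⟩, h5, h6⟩ := hsome σ₁ rfl
        refine (ih σ₁ (p + 1) h3 ?_ (by omega) ?_).mono ?_
        · rw [h4, h4']
          simp only [List.length_append]
          omega
        · intro x hx
          rw [h4] at hx
          rw [h4']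
          rcases List.mem_append.1 hx with hx | hx
          · exact Or.inl (List.mem_append_left _ hx)
          · by_cases hxv : x = v
            · subst hxv
              exact Or.inr fun e heu hxe => h6 e (by
                rw [I.mem_inc]
                simpa [IncidenceLists.ed] using hxe) heu
            · rcases hcl x hx with h | h
              · rw [hst] at h
                exact Or.inl (List.mem_append_right _ ((List.mem_cons.1 h).resolve_left hxv))
              · exact Or.inr fun e heu hxe => h5 (h e heu hxe)
        · rintro r t₁ ⟨ht₁, h7, h8⟩
          refine ⟨?_, h7, h8⟩
          rw [add_mul p 1, one_mul] at ht₁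
          omega

/-- A list of complete connected components, disjoint from `MV`. -/
structure CompsOK (I : IncidenceLists H m) (Y : Fin n → Option (Fin s)) (k : ℕ) (K : ℝ)
    (MV : Finset (Fin n)) (cs : List (List (Fin n) × List (Fin m))) : Prop where
  nodup : ∀ c ∈ cs, c.1.Nodup
  edges : ∀ c ∈ cs, ∀ e ∈ c.2, I.ed e ⊆ c.1.toFinset
  closed : ∀ c ∈ cs, ∀ e, Unsat I Y e → ¬ Disjoint (I.ed e) c.1.toFinset → e ∈ c.2
  lengthE : ∀ c ∈ cs, c.2.length ≤ ⌊K⌋₊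
  lengthV : ∀ c ∈ cs, c.1.length ≤ 1 + k * ⌊K⌋₊
  pairwise : cs.Pairwise fun c c' => Disjoint c.1.toFinset c'.1.toFinset
  disj : ∀ c ∈ cs, Disjoint c.1.toFinset MV

/-- Completing a component leaves the marks closed, so the search from the next vertex of `S` starts
under the same hypothesis and yields disjoint components. -/
theorem spec_components (I : IncidenceLists H m) [Nonempty (Fin s)] {k Δ : ℕ}
    (hk : ∀ e, (I.verts e).length = k) (hΔ : ∀ v, (I.inc v).length ≤ Δ)
    {Y : Fin n → Option (Fin s)} {K : ℝ} (hK : 0 ≤ K) (S : List (Fin n)) :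
    ∀ (MV : Finset (Fin n)) (ME : Finset (Fin m)), ClosedMarks I Y MV ME →
      (components I Y K S MV ME).Spec fun r t =>
        t ≤ S.length * (1 + (2 + k * ⌊K⌋₊) * (1 + Δ * (2 * k + 1))) ∧
        (r = none → ∃ w ∈ S, Large I Y K w) ∧
        ∀ cs, r = some cs → CompsOK I Y k K MV cs ∧ cs.length ≤ S.length ∧
          ∀ w ∈ S, w ∈ MV ∨ ∃ c ∈ cs, w ∈ c.1 := by
  induction S with
  | nil =>
    intro MV ME hM
    refine spec_pure ⟨by simp, by simp, ?_⟩
    rintro cs h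
    obtain rfl := Option.some.inj h
    exact ⟨⟨by simp, by simp, by simp, by simp, by simp, by simp, by simp⟩, by simp, by simp⟩
  | cons w ws ih =>
    intro MV ME hM
    refine spec_tick_bind ?_
    split_ifs with hw
    · refine (ih MV ME hM).mono ?_
      rintro r t ⟨ht, hnone, hsome⟩
      refine ⟨?_, ?_, ?_⟩
      · rw [List.length_cons, add_mul]; omega
      · intro hr
        obtain ⟨x, hx, hx'⟩ := hnone hr
        exact ⟨x, List.mem_cons_of_mem _ hx, hx'⟩
      · intro cs hr
        obtain ⟨h1, h2, h3⟩ := hsome cs hr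
        refine ⟨h1, by rw [List.length_cons]; omega, fun x hx => ?_⟩
        rcases List.mem_cons.1 hx with rfl | hx
        · exact Or.inl hw
        · exact h3 x hx
    · have hInv : SearchInv I Y K MV ME w ⟨insert w MV, ME, [w], [w], [], 0⟩ :=
        { markedV := by
            ext x; simp only [Finset.mem_insert, Finset.mem_union, List.mem_toFinset,
              List.mem_singleton]; tauto
          markedE := by simp
          nodupV := by simp
          nodupE := by simp
          disjV := by simpa using hw
          numE := by simp
          numE_le := by simpa using hK
          unsat := by simp
          reach := by simp
          mem_w := by simp
          mem_compV := by simp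
          lengthV := by simp
          stack := by simp }
      refine spec_bind (spec_search I hk hΔ hM n _ 0 hInv (by simp) (by simp) (by simp)) ?_
      rintro r t ⟨ht, hnone, hsome⟩
      rw [zero_mul, add_zero] at ht
      rcases r with _ | σ
      · refine spec_pure ⟨?_, fun _ => ⟨w, by simp, hnone rfl⟩, by simp⟩
        rw [List.length_cons, add_mul]; omega
      · obtain ⟨hσ, hcl⟩ := hsome σ rfl
        have hclosed : ∀ e, Unsat I Y e → ¬ Disjoint (I.ed e) σ.compV.toFinset → e ∈ σ.compE := by
          intro e heu hd
          obtain ⟨x, hxe, hx⟩ := Finset.not_disjoint_iff.1 hd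
          rw [List.mem_toFinset] at hx
          have h1 := hcl x hx e heu hxe
          rw [hσ.markedE] at h1
          rcases Finset.mem_union.1 h1 with h1 | h1
          · exact absurd (hM.subset e h1 hxe) (hσ.disjV x hx)
          · simpa using h1
        have hM' : ClosedMarks I Y σ.markedV σ.markedE :=
          { mem := by
              intro e heu hd
              rw [hσ.markedV, Finset.disjoint_union_right, not_and_or] at hd
              rw [hσ.markedE]
              rcases hd with hd | hd
              · exact Finset.mem_union_left _ (hM.mem e heu hd)
              · exact Finset.mem_union_right _ (by simpa using hclosed e heu hd)
            subset := by
              intro e he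
              rw [hσ.markedE] at he
              rw [hσ.markedV]
              rcases Finset.mem_union.1 he with he | he
              · exact (hM.subset e he).trans Finset.subset_union_left
              · exact (hσ.unsat e (by simpa using he)).2.trans Finset.subset_union_right }
        have hMVsub : MV ⊆ σ.markedV := by rw [hσ.markedV]; exact Finset.subset_union_left
        have hCsub : σ.compV.toFinset ⊆ σ.markedV := by
          rw [hσ.markedV]; exact Finset.subset_union_right
        dsimp only
        refine spec_bind (ih _ _ hM') ?_
        rintro r t' ⟨ht', hnone', hsome'⟩
        rcases r with _ | cs
        · refine spec_pure ⟨?_, fun _ => ?_, by simp⟩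
          · rw [List.length_cons, add_mul]; omega
          · obtain ⟨x, hx, hx'⟩ := hnone' rfl
            exact ⟨x, List.mem_cons_of_mem _ hx, hx'⟩
        · obtain ⟨h1, h2, h3⟩ := hsome' cs rfl
          refine spec_pure ⟨?_, by simp, ?_⟩
          · rw [List.length_cons, add_mul]; omega
          · rintro cs' h
            obtain rfl := Option.some.inj h
            refine ⟨⟨?_, ?_, ?_, ?_, ?_, ?_, ?_⟩, ?_, ?_⟩
            · exact List.forall_mem_cons.2 ⟨hσ.nodupV, h1.nodup⟩
            · exact List.forall_mem_cons.2 ⟨fun e he => (hσ.unsat e he).2, h1.edges⟩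
            · exact List.forall_mem_cons.2 ⟨hclosed, h1.closed⟩
            · refine List.forall_mem_cons.2 ⟨?_, h1.lengthE⟩
              dsimp only
              rw [← hσ.numE]
              exact Nat.le_floor hσ.numE_le
            · refine List.forall_mem_cons.2 ⟨?_, h1.lengthV⟩
              have h4 := hσ.lengthV k hk
              have h5 : σ.numE ≤ ⌊K⌋₊ := Nat.le_floor hσ.numE_le
              have h6 := Nat.mul_le_mul_left k h5
              dsimp only
              omega
            · exact List.pairwise_cons.2 ⟨fun c hc =>
                (Disjoint.mono_right hCsub (h1.disj c hc)).symm, h1.pairwise⟩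
            · refine List.forall_mem_cons.2 ⟨?_, fun c hc =>
                Disjoint.mono_right hMVsub (h1.disj c hc)⟩
              rw [Finset.disjoint_left]
              intro x hx
              exact hσ.disjV x (by simpa using hx)
            · simp only [List.length_cons]; omega
            · intro x hx
              rcases List.mem_cons.1 hx with rfl | hx
              · exact Or.inr ⟨(σ.compV, σ.compE), by simp, hσ.mem_w⟩
              · rcases h3 x hx with h4 | ⟨c, hc, hxc⟩
                · rw [hσ.markedV] at h4
                  rcases Finset.mem_union.1 h4 with h4 | h4
                  · exact Or.inl h4
                  · exact Or.inr ⟨(σ.compV, σ.compE), by simp, by simpa using h4⟩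
                · exact Or.inr ⟨c, List.mem_cons_of_mem _ hc, hxc⟩

end Specs

/-! ### The randomised parts of the algorithm -/

section Sampling

variable {n m s q : ℕ} {H : Hypergraph (Fin n)}

/-- The colour lists determined by a partial image. -/
def lists (h : ProjectionScheme q s) (Y : Fin n → Option (Fin s)) (v : Fin n) : Finset (Fin q) :=
  match Y v with
  | some j => h.fibre j
  | none => Finset.univ

theorem lists_nonempty (h : ProjectionScheme q s) (Y : Fin n → Option (Fin s)) (v : Fin n) :
    (lists h Y v).Nonempty := by
  unfold lists
  split
  · exact h.fibre_nonempty _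
  · exact h.univ_colours_nonempty

theorem ex_drawColour (h : ProjectionScheme q s) (Y : Fin n → Option (Fin s)) (v : Fin n)
    {g : Fin q → ℝ} (hg : UnitValued g) :
    (drawColour h (Y v)).ex g = (∑ c ∈ lists h Y v, g c) / (lists h Y v).card := by
  unfold lists
  rcases Y v with _ | j
  · exact ex_draw _ _ hg
  · exact ex_draw _ _ hg

theorem ex_drawColours (h : ProjectionScheme q s) (Y : Fin n → Option (Fin s))
    {g : (Fin n → Fin q) → ℝ} (hg : UnitValued g) (vs : List (Fin n)) (hvs : vs.Nodup) :
    ∀ X, (drawColours h Y vs X).ex g = avg (lists h Y) fun Z => g (mix vs.toFinset Z X) := by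
  induction vs with
  | nil =>
    intro X
    rw [drawColours, ex_pure _ hg, ← avg_const (lists_nonempty h Y) (g X)]
    congr 1
  | cons v vs ih =>
    intro X
    rw [List.nodup_cons] at hvs
    rw [drawColours, ex_tick_bind _ _ hg, ex_bind _ _ hg,
      ex_drawColour h Y v (RandComp.unitValued_ex _ hg), avg_update (lists_nonempty h Y) v]
    congr 1
    refine Finset.sum_congr rfl fun c _ => ?_
    rw [ih hvs.2]
    congr 1
    funext Z
    congr 1
    funext x
    by_cases hx : x = v
    · subst hx
      simp [mix, hvs.1]
    · simp [mix, hx]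

theorem DepOn.mix_left {κ : Type} (W : Finset (Fin n)) (X : Fin n → κ) :
    DepOn (fun Z : Fin n → κ => mix W Z X) W := by
  intro Z Z' hZ
  funext v
  by_cases hv : v ∈ W
  · simp [mix, hv, hZ v hv]
  · simp [mix, hv]

theorem mix_mix_left {κ : Type} (W : Finset (Fin n)) (Z Z' X : Fin n → κ) :
    mix W Z (mix W Z' X) = mix W Z X := by
  funext v
  by_cases hv : v ∈ W <;> simp [mix, hv]

/-- No hyperedge in a list is monochromatic. -/
def ListGood (I : IncidenceLists H m) (es : List (Fin m)) (Z : Fin n → Fin q) : Prop :=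
  Avoids (fun e => Mono (I.ed e)) es.toFinset Z

theorem ListGood.dep (I : IncidenceLists H m) {es : List (Fin m)} {W : Finset (Fin n)}
    (hW : ∀ e ∈ es, I.ed e ⊆ W) : DepOn (ListGood I es : (Fin n → Fin q) → Prop) W :=
  (Avoids.dep (fun _ => Mono.dep _) _).mono
    (Finset.biUnion_subset.2 fun e he => hW e (by simpa using he))

/-- The first accepted trial has the conditional law, and one of R trials is accepted with
probability 1 - (1 - a)^R; the outcome of total failure is dropped because g ≥ 0. Each trial
overwrites the same vertices, so the array left by a failed one is irrelevant. -/
theorem le_ex_rejectionSample (I : IncidenceLists H m) (h : ProjectionScheme q s)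
    {k : ℕ} (hk : ∀ e, (I.verts e).length = k) (Y : Fin n → Option (Fin s)) {vs : List (Fin n)}
    (hvs : vs.Nodup) {es : List (Fin m)} (hes : ∀ e ∈ es, I.ed e ⊆ vs.toFinset)
    {g : Option (Fin n → Fin q) → ℝ} (hg : UnitValued g)
    (ha : 0 < avg (lists h Y) fun Z => ind (ListGood I es Z)) (R : ℕ) : ∀ X,
      (1 - (1 - avg (lists h Y) fun Z => ind (ListGood I es Z)) ^ R) *
        ((avg (lists h Y) fun Z => ind (ListGood I es Z) * g (some (mix vs.toFinset Z X))) /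
          avg (lists h Y) fun Z => ind (ListGood I es Z)) ≤
      (rejectionSample I h Y vs es R X).ex g := by
  have : Nonempty (Fin q) := ⟨h.someColour⟩
  set L := lists h Y with hL
  have hne : ∀ v, (L v).Nonempty := lists_nonempty h Y
  set a := avg L fun Z => ind (ListGood I es Z) with ha'
  have ha1 : a ≤ 1 := by
    rw [ha', ← avg_const hne 1]
    exact avg_mono fun Z _ => ind_le_one _
  induction R with
  | zero =>
    intro X
    rw [pow_zero, sub_self, zero_mul]
    exact RandComp.ex_nonneg _ _
  | succ R ih =>
    intro X
    rw [rejectionSample, ex_tick_bind _ _ hg, ex_bind _ _ hg,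
      ex_drawColours h Y (RandComp.unitValued_ex _ hg) vs hvs]
    set B := (avg L fun Z => ind (ListGood I es Z) * g (some (mix vs.toFinset Z X))) with hB
    set c := 1 - (1 - a) ^ R with hc
    have hpt : ∀ Z : Fin n → Fin q, ind (ListGood I es Z) * g (some (mix vs.toFinset Z X)) +
        (1 - ind (ListGood I es Z)) * (c * (B / a)) ≤
        (do if ← allProper I (mix vs.toFinset Z X) es then return some (mix vs.toFinset Z X)
            else rejectionSample I h Y vs es R (mix vs.toFinset Z X) :
              RandComp (Option (Fin n → Fin q))).ex g := by
      intro Z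
      rw [ex_bind _ _ hg]
      refine (spec_allProper I hk _ es).le_ex (RandComp.unitValued_ex _ hg) ?_
      rintro b t ⟨hb, _⟩
      have hiff : b = true ↔ ListGood I es Z := by
        rw [hb]
        have h1 : ListGood I es (mix vs.toFinset Z X) = ListGood I es Z :=
          ListGood.dep I hes _ _ fun v hv => by simp only [mix, if_pos hv]
        rw [← h1]
        unfold ListGood Avoids
        simp
      split_ifs with hbt
      · rw [ind_true (hiff.1 hbt), ex_pure _ hg]
        simp
      · rw [ind_false fun hc => hbt (hiff.2 hc)]
        have := ih (mix vs.toFinset Z X)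
        simp only [mix_mix_left] at this
        linarith
    refine le_trans ?_ (avg_mono fun Z _ => hpt Z)
    rw [avg_add, avg_mul_right, avg_sub, avg_const hne, ← ha', ← hB]
    have h1 : B = a * (B / a) := by field_simp
    apply le_of_eq
    rw [hc, pow_succ]
    nth_rewrite 2 [h1]
    ring

/-- Write the colours of `Z` on all components of a list to `X`. -/
def overwrite (cs : List (List (Fin n) × List (Fin m))) (Z X : Fin n → Fin q) : Fin n → Fin q :=
  match cs with
  | [] => X
  | c :: cs => overwrite cs Z (mix c.1.toFinset Z X)

/-- The vertices of the components of a list. -/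
def compVerts (cs : List (List (Fin n) × List (Fin m))) : Finset (Fin n) :=
  cs.foldr (fun c U => c.1.toFinset ∪ U) ∅

/-- The hyperedges of the components of a list. -/
def compEdges (cs : List (List (Fin n) × List (Fin m))) : List (Fin m) :=
  cs.flatMap Prod.snd

theorem mem_compVerts {cs : List (List (Fin n) × List (Fin m))} {v : Fin n} :
    v ∈ compVerts cs ↔ ∃ c ∈ cs, v ∈ c.1 := by
  induction cs with
  | nil => simp [compVerts]
  | cons c cs ih =>
    have : compVerts (c :: cs) = c.1.toFinset ∪ compVerts cs := rfl
    rw [this, Finset.mem_union, ih]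
    simp

theorem overwrite_apply (cs : List (List (Fin n) × List (Fin m))) (Z : Fin n → Fin q) :
    ∀ (X : Fin n → Fin q) (v : Fin n), overwrite cs Z X v =
      if v ∈ compVerts cs then Z v else X v := by
  induction cs with
  | nil => intro X v; simp [overwrite, compVerts]
  | cons c cs ih =>
    intro X v
    have : compVerts (c :: cs) = c.1.toFinset ∪ compVerts cs := rfl
    simp only [overwrite, ih, this, Finset.mem_union]
    by_cases h1 : v ∈ compVerts cs
    · simp [h1]
    · by_cases h2 : v ∈ c.1
      · simp [h1, h2, mix]
      · simp [h1, h2, mix]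

theorem overwrite_dep (cs : List (List (Fin n) × List (Fin m))) (X : Fin n → Fin q) :
    DepOn (fun Z => overwrite cs Z X) (compVerts cs) := by
  intro Z Z' hZ
  funext v
  simp only [overwrite_apply]
  split_ifs with hv
  · exact hZ v hv
  · rfl

theorem CompsOK.tail {I : IncidenceLists H m} {Y : Fin n → Option (Fin s)} {k : ℕ} {K : ℝ}
    {MV : Finset (Fin n)} {c : List (Fin n) × List (Fin m)}
    {cs : List (List (Fin n) × List (Fin m))} (h : CompsOK I Y k K MV (c :: cs)) :
    CompsOK I Y k K MV cs where
  nodup := fun c' hc => h.nodup c' (List.mem_cons_of_mem _ hc)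
  edges := fun c' hc => h.edges c' (List.mem_cons_of_mem _ hc)
  closed := fun c' hc => h.closed c' (List.mem_cons_of_mem _ hc)
  lengthE := fun c' hc => h.lengthE c' (List.mem_cons_of_mem _ hc)
  lengthV := fun c' hc => h.lengthV c' (List.mem_cons_of_mem _ hc)
  pairwise := (List.pairwise_cons.1 h.pairwise).2
  disj := fun c' hc => h.disj c' (List.mem_cons_of_mem _ hc)

theorem CompsOK.edges_subset {I : IncidenceLists H m} {Y : Fin n → Option (Fin s)} {k : ℕ} {K : ℝ}
    {MV : Finset (Fin n)} {cs : List (List (Fin n) × List (Fin m))} (h : CompsOK I Y k K MV cs) :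
    ∀ e ∈ compEdges cs, I.ed e ⊆ compVerts cs := by
  intro e he x hx
  obtain ⟨c, hc, hec⟩ := List.mem_flatMap.1 he
  exact mem_compVerts.2 ⟨c, hc, by simpa using h.edges c hc e hec hx⟩

/-- The hyperedges form a linear family, and the local lemma applies to all lists of at least
`b` colours. -/
structure Regime (I : IncidenceLists H m) (h : ProjectionScheme q s) (k Δ : ℕ) (b : ℝ) : Prop where
  family : LinearFamily I.ed k Δ
  two_le : 2 ≤ k
  one_le : 1 ≤ Δ
  pos : 0 < b
  fibre : ∀ j, b ≤ (h.fibre j).card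
  small : 4 * (1 / b) ^ (k - 1) * (Δ * k : ℕ) ≤ 1

namespace Regime

variable {I : IncidenceLists H m} {h : ProjectionScheme q s} {k Δ : ℕ} {b : ℝ}

theorem card_lists (hR : Regime I h k Δ b) (Y : Fin n → Option (Fin s)) (v : Fin n) :
    b ≤ (lists h Y v).card := by
  unfold lists
  split
  · exact hR.fibre _
  · refine (hR.fibre (h.toFun h.someColour)).trans ?_
    exact_mod_cast Finset.card_le_univ _

theorem listPair (hR : Regime I h k Δ b) (Y Y' : Fin n → Option (Fin s)) :
    ListPair I.ed k Δ b (lists h Y) (lists h Y') where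
  family := hR.family
  two_le := hR.two_le
  one_le := hR.one_le
  pos := hR.pos
  card₁ := hR.card_lists Y
  card₂ := hR.card_lists Y'
  small := hR.small

theorem length_verts (hR : Regime I h k Δ b) (e : Fin m) : (I.verts e).length = k := by
  rw [← hR.family.card e, IncidenceLists.ed, List.toFinset_card_of_nodup (I.nodup_verts e)]

theorem length_inc (hR : Regime I h k Δ b) (v : Fin n) : (I.inc v).length ≤ Δ := by
  rw [← List.toFinset_card_of_nodup (I.nodup_inc v)]
  refine (Finset.card_le_card fun e he => ?_).trans (hR.family.deg v)
  rw [List.mem_toFinset, I.mem_inc] at he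
  simpa [IncidenceLists.ed] using he

theorem avg_listGood_pos (hR : Regime I h k Δ b) (Y : Fin n → Option (Fin s))
    (es : List (Fin m)) : 0 < avg (lists h Y) fun Z => ind (ListGood I es Z) :=
  (hR.listPair Y Y).sys₁.avg_avoids_pos (hR.listPair Y Y).one_le_deg _

theorem pow_le_avg_listGood (hR : Regime I h k Δ b) (Y : Fin n → Option (Fin s))
    {es : List (Fin m)} {K : ℕ} (hes : es.length ≤ K) :
    (1 - 2 * (1 / b) ^ (k - 1)) ^ K ≤ avg (lists h Y) fun Z => ind (ListGood I es Z) := by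
  have hP := hR.listPair Y Y
  refine le_trans ?_ (hP.sys₁.pow_le_avg hP.one_le_deg es.toFinset)
  refine pow_le_pow_of_le_one hP.base_pos.le ?_ ((List.toFinset_card_le es).trans hes)
  have := hP.sys₁.nonneg
  linarith

/-- Components are disjoint, so their conditional laws multiply. Each has at most ⌊K⌋ hyperedges,
and `pow_le_avg_listGood` bounds its acceptance probability from below. -/
theorem le_ex_sampleComponents (hR : Regime I h k Δ b) (Y : Fin n → Option (Fin s)) {K : ℝ}
    {MV : Finset (Fin n)} (R : ℕ) {g : Option (Fin n → Fin q) → ℝ} (hg : UnitValued g)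
    (cs : List (List (Fin n) × List (Fin m))) : CompsOK I Y k K MV cs → ∀ X,
      (1 - (1 - (1 - 2 * (1 / b) ^ (k - 1)) ^ ⌊K⌋₊) ^ R) ^ cs.length *
        ((avg (lists h Y) fun Z => ind (ListGood I (compEdges cs) Z) *
          g (some (overwrite cs Z X))) /
          avg (lists h Y) fun Z => ind (ListGood I (compEdges cs) Z)) ≤
      (sampleComponents I h Y R cs X).ex g := by
  have hP := hR.listPair Y Y
  set L := lists h Y with hL
  have hne : ∀ v, (L v).Nonempty := lists_nonempty h Y
  set lam := (1 - 2 * (1 / b) ^ (k - 1)) ^ ⌊K⌋₊ with hlam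
  have hlam0 : 0 < lam := pow_pos hP.base_pos _
  have hlam1 : lam ≤ 1 := pow_le_one₀ hP.base_pos.le (by linarith [hP.sys₁.nonneg])
  have hfac0 : 0 ≤ 1 - (1 - lam) ^ R := by
    have : (1 - lam) ^ R ≤ 1 := pow_le_one₀ (by linarith) (by linarith)
    linarith
  induction cs with
  | nil =>
    intro _ X
    have h1 : ∀ Z : Fin n → Fin q, 
        ind (ListGood I (compEdges ([] : List (List (Fin n) × List (Fin m)))) Z) = 1 := fun Z =>
      ind_true (by simp [ListGood, Avoids, compEdges])
    simp only [h1, overwrite, List.length_nil, pow_zero, one_mul, avg_const hne, div_one]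
    rw [sampleComponents, ex_pure _ hg]
  | cons c cs ih =>
    intro hcs X
    set a := avg L fun Z => ind (ListGood I c.2 Z) with ha'
    set a' := avg L fun Z => ind (ListGood I (compEdges cs) Z) with ha''
    have ha : 0 < a := hR.avg_listGood_pos Y c.2
    have hapos' : 0 < a' := hR.avg_listGood_pos Y (compEdges cs)
    have hdisj : Disjoint c.1.toFinset (compVerts cs) := by
      rw [Finset.disjoint_left]
      intro x hx hx'
      obtain ⟨c', hc', hxc'⟩ := mem_compVerts.1 hx'
      exact Finset.disjoint_left.1 ((List.pairwise_cons.1 hcs.pairwise).1 c' hc') hx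
        (by simpa using hxc')
    have hdep : DepOn (ListGood I c.2 : (Fin n → Fin q) → Prop) c.1.toFinset :=
      ListGood.dep I (hcs.edges c (by simp))
    have hdep' : DepOn (ListGood I (compEdges cs) : (Fin n → Fin q) → Prop) (compVerts cs) :=
      ListGood.dep I hcs.tail.edges_subset
    have hsplit : ∀ Z : Fin n → Fin q, ind (ListGood I (compEdges (c :: cs)) Z) =
        ind (ListGood I c.2 Z) * ind (ListGood I (compEdges cs) Z) := by
      intro Z
      rw [← ind_and]
      refine ind_congr ?_
      unfold ListGood Avoids compEdges
      simp only [List.flatMap_cons, List.toFinset_append, Finset.mem_union]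
      exact ⟨fun hh => ⟨fun e he => hh e (Or.inl he), fun e he => hh e (Or.inr he)⟩,
        fun hh e he => he.elim (hh.1 e) (hh.2 e)⟩
    have hprod : avg L (fun Z => ind (ListGood I (compEdges (c :: cs)) Z)) = a * a' := by
      simp only [hsplit]
      exact avg_mul_of_disjoint hne hdisj hdep.ind hdep'.ind
    set γ : Option (Fin n → Fin q) → RandComp (Option (Fin n → Fin q)) := fun r =>
      match r with
      | none => pure none
      | some X' => sampleComponents I h Y R cs X' with hγ
    have hstep : (sampleComponents I h Y R (c :: cs) X).ex g =
        (rejectionSample I h Y c.1 c.2 R X).ex fun r => (γ r).ex g := by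
      rw [sampleComponents, ex_tick_bind _ _ hg, ex_bind _ _ hg]
    rw [hstep]
    have hrej := le_ex_rejectionSample I h hR.length_verts Y (hcs.nodup c (by simp))
      (hcs.edges c (by simp)) (RandComp.unitValued_ex γ hg) ha R X
    refine le_trans ?_ hrej
    rw [← hL, ← ha']
    have hc : 1 - (1 - lam) ^ R ≤ 1 - (1 - a) ^ R := by
      have h1 : lam ≤ a := hR.pow_le_avg_listGood Y (hcs.lengthE c (by simp))
      have h2 : a ≤ 1 := by
        rw [ha', ← avg_const hne 1]
        exact avg_mono fun Z _ => ind_le_one _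
      have : (1 - a) ^ R ≤ (1 - lam) ^ R := pow_le_pow_left₀ (by linarith) (by linarith) _
      linarith
    have hinner : (1 - (1 - lam) ^ R) ^ cs.length *
        (avg L (fun Z => ind (ListGood I (compEdges (c :: cs)) Z) *
          g (some (overwrite (c :: cs) Z X))) / a') ≤
        avg L fun Z => ind (ListGood I c.2 Z) * (γ (some (mix c.1.toFinset Z X))).ex g := by
      have h1 : avg L (fun Z => ind (ListGood I (compEdges (c :: cs)) Z) *
          g (some (overwrite (c :: cs) Z X))) = avg L fun Z => avg L fun Z' =>
            ind (ListGood I c.2 Z) * (ind (ListGood I (compEdges cs) Z') *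
              g (some (overwrite cs Z' (mix c.1.toFinset Z X)))) := by
        rw [avg_avg_of_disjoint hne hdisj]
        · congr 1
          funext Z
          rw [hsplit, overwrite, mul_assoc]
        · intro Z' Z₁ Z₂ hZ
          dsimp only
          have h2 : mix c.1.toFinset Z₁ X = mix c.1.toFinset Z₂ X :=
            DepOn.mix_left c.1.toFinset X Z₁ Z₂ hZ
          rw [hdep Z₁ Z₂ hZ, h2]
        · intro Z Z₁ Z₂ hZ
          dsimp only
          have h2 : overwrite cs Z₁ (mix c.1.toFinset Z X) =
              overwrite cs Z₂ (mix c.1.toFinset Z X) := overwrite_dep cs _ Z₁ Z₂ hZ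
          rw [hdep' Z₁ Z₂ hZ, h2]
      rw [h1, mul_div_assoc', mul_comm, ← avg_mul_right, div_eq_mul_inv, ← avg_mul_right]
      refine avg_mono fun Z _ => ?_
      rw [avg_mul_left]
      have h2 := ih hcs.tail (mix c.1.toFinset Z X)
      have h3 := mul_le_mul_of_nonneg_left h2 (ind_nonneg (ListGood I c.2 Z))
      refine le_trans (le_of_eq ?_) h3
      ring
    have hRHS0 : 0 ≤ avg L (fun Z => ind (ListGood I c.2 Z) *
        (γ (some (mix c.1.toFinset Z X))).ex g) / a :=
      div_nonneg (avg_nonneg fun Z _ => mul_nonneg (ind_nonneg _) (RandComp.ex_nonneg _ _)) ha.le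
    refine le_trans ?_ (mul_le_mul_of_nonneg_right hc hRHS0)
    rw [List.length_cons, pow_succ, hprod, mul_comm (_ ^ cs.length) _, mul_assoc]
    refine mul_le_mul_of_nonneg_left ?_ hfac0
    rw [le_div_iff₀ ha]
    refine le_trans (le_of_eq ?_) hinner
    field_simp

/-- A colour determines its bucket, so a monochromatic hyperedge has a constant image. Satisfied
hyperedges therefore impose no constraint. -/
theorem mono_imp_unsat {Y : Fin n → Option (Fin s)} {Z : Fin n → Fin q}
    (hZ : ∀ v, Z v ∈ lists h Y v) {e : Fin m} (hm : Mono (I.ed e) Z) : Unsat I Y e := by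
  obtain ⟨c, hc⟩ := hm
  refine ⟨h.toFun c, by simp, fun v hv j hj => ?_⟩
  have h1 := hZ v
  rw [lists, hj, hc v (by simpa [IncidenceLists.ed] using hv)] at h1
  simpa [ProjectionScheme.fibre, eq_comm] using h1

/-- The components that contain `S` determine the conditional law of the colours of `S`. -/
theorem cond_eq (hR : Regime I h k Δ b) {Y : Fin n → Option (Fin s)} {K : ℝ}
    {MV : Finset (Fin n)} {cs : List (List (Fin n) × List (Fin m))} (hcs : CompsOK I Y k K MV cs)
    {g : (Fin n → Fin q) → ℝ} (hg : DepOn g (compVerts cs)) :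
    cond I.ed (lists h Y) g =
      (avg (lists h Y) fun Z => ind (ListGood I (compEdges cs) Z) * g Z) /
        avg (lists h Y) fun Z => ind (ListGood I (compEdges cs) Z) := by
  classical
  set L := lists h Y with hL
  have hne : ∀ v, (L v).Nonempty := lists_nonempty h Y
  set rest := Finset.univ.filter fun e => Disjoint (I.ed e) (compVerts cs) with hrest
  set A : Fin m → (Fin n → Fin q) → Prop := fun e => Mono (I.ed e) with hA
  -- A hyperedge that meets the components without being listed is satisfied and never
  -- monochromatic. Properness thus splits into a condition on the components and one on hyperedges
  -- disjoint from them; the latter cancels from the quotient.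
  have hsplit : ∀ Z, (∀ v, Z v ∈ L v) → ind (Good I.ed Z) =
      ind (ListGood I (compEdges cs) Z) * ind (Avoids A rest Z) := by
    intro Z hZ
    rw [← ind_and]
    refine ind_congr ⟨fun hG => ⟨fun e _ => hG e (Finset.mem_univ e),
      fun e _ => hG e (Finset.mem_univ e)⟩, fun ⟨h1, h2⟩ e _ hm => ?_⟩
    by_cases hd : Disjoint (I.ed e) (compVerts cs)
    · exact h2 e (by simp [hrest, hd]) hm
    · obtain ⟨x, hx, hxU⟩ := Finset.not_disjoint_iff.1 hd
      obtain ⟨c, hc, hxc⟩ := mem_compVerts.1 hxU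
      have := hcs.closed c hc e (mono_imp_unsat hZ hm)
        (Finset.not_disjoint_iff.2 ⟨x, hx, by simpa using hxc⟩)
      exact h1 e (by
        rw [List.mem_toFinset]
        exact List.mem_flatMap.2 ⟨c, hc, this⟩) hm
  have hdep : DepOn (ListGood I (compEdges cs) : (Fin n → Fin q) → Prop) (compVerts cs) :=
    ListGood.dep I hcs.edges_subset
  have hdisj : Disjoint (compVerts cs) (rest.biUnion I.ed) :=
    (Finset.disjoint_biUnion_right _ _ _).2 fun e he => (Finset.mem_filter.1 he).2.symm
  have hdepr := (Avoids.dep (A := A) (fun e => Mono.dep (I.ed e)) rest).ind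
  have h1 : avg L (fun Z => g Z * ind (Good I.ed Z)) =
      avg L (fun Z => ind (ListGood I (compEdges cs) Z) * g Z) *
        avg L fun Z => ind (Avoids A rest Z) := by
    rw [← avg_mul_of_disjoint hne hdisj (hdep.ind.mul hg) hdepr]
    exact avg_congr fun Z hZ => by rw [hsplit Z hZ]; ring
  have h2 : avg L (fun Z => ind (Good I.ed Z)) =
      avg L (fun Z => ind (ListGood I (compEdges cs) Z)) *
        avg L fun Z => ind (Avoids A rest Z) := by
    rw [← avg_mul_of_disjoint hne hdisj hdep.ind hdepr]
    exact avg_congr hsplit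
  have h3 : 0 < avg L fun Z => ind (Avoids A rest Z) :=
    (hR.listPair Y Y).sys₁.avg_avoids_pos (hR.listPair Y Y).one_le_deg _
  unfold cond
  rw [h1, h2, mul_div_mul_right _ _ h3.ne']

/-- Unless some cluster is large, `sample` is close to the conditional distribution. -/
theorem le_ex_sample (hR : Regime I h k Δ b) (Y : Fin n → Option (Fin s)) {S : List (Fin n)}
    {ζ : ℝ} (hK : 0 ≤ sizeBound n k Δ ζ)
    (hlarge : ¬ ∃ w ∈ S, Large I Y (sizeBound n k Δ ζ) w)
    {g : (Fin n → Fin q) → ℝ} (hg : UnitValued g) (hgS : DepOn g S.toFinset) :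
    (1 - (1 - (1 - 2 * (1 / b) ^ (k - 1)) ^ ⌊sizeBound n k Δ ζ⌋₊) ^ numTrials n k Δ q ζ) ^
        S.length * cond I.ed (lists h Y) g ≤ (sample I h k Δ S Y ζ).ex g := by
  have : Nonempty (Fin s) := ⟨h.toFun h.someColour⟩
  have hP := hR.listPair Y Y
  set K := sizeBound n k Δ ζ with hK'
  set R := numTrials n k Δ q ζ with hR'
  set lam := (1 - 2 * (1 / b) ^ (k - 1)) ^ ⌊K⌋₊ with hlam
  have hlam0 : 0 < lam := pow_pos hP.base_pos _
  have hlam1 : lam ≤ 1 := pow_le_one₀ hP.base_pos.le (by linarith [hP.sys₁.nonneg])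
  have hfac : 0 ≤ (1 - lam) ^ R := pow_nonneg (by linarith) _
  have hfac0 : 0 ≤ 1 - (1 - lam) ^ R := by
    have : (1 - lam) ^ R ≤ 1 := pow_le_one₀ (by linarith) (by linarith)
    linarith
  have hcond : 0 ≤ cond I.ed (lists h Y) g :=
    (isExpectation_cond hP.avg_pos₁).nonneg fun Z => (hg Z).1
  have hM : ClosedMarks I Y ∅ ∅ := ⟨by simp, by simp⟩
  rw [sample, ex_tick_bind _ _ hg, ex_bind _ _ hg]
  refine (spec_components I hR.length_verts hR.length_inc hK S ∅ ∅ hM).le_ex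
    (RandComp.unitValued_ex _ hg) ?_
  rintro r t ⟨_, hnone, hsome⟩
  rcases r with _ | cs
  · exact absurd (hnone rfl) hlarge
  · obtain ⟨hcs, hlen, hcov⟩ := hsome cs rfl
    dsimp only
    rw [ex_bind _ _ hg]
    set γ : Option (Fin n → Fin q) → RandComp (Fin n → Fin q) := fun r =>
      match r with
      | none => drawColours h (fun _ => none) S fun _ => h.someColour
      | some X => pure X with hγ
    have hSU : S.toFinset ⊆ compVerts cs := by
      intro w hw
      rw [List.mem_toFinset] at hw
      exact mem_compVerts.2 ((hcov w hw).resolve_left (by simp))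
    refine le_trans ?_ (hR.le_ex_sampleComponents Y R (RandComp.unitValued_ex γ hg) cs hcs
      fun _ => h.someColour)
    have h1 : ∀ Z : Fin n → Fin q, (γ (some (overwrite cs Z fun _ => h.someColour))).ex g =
        g Z := by
      intro Z
      rw [hγ]
      dsimp only
      rw [ex_pure _ hg]
      refine hgS _ _ fun v hv => ?_
      rw [overwrite_apply, if_pos (hSU hv)]
    simp only [h1]
    rw [← hR.cond_eq hcs (hgS.mono hSU)]
    refine mul_le_mul_of_nonneg_right (pow_le_pow_of_le_one hfac0 (by linarith) hlen) hcond

/-- An upper bound for the expectation of a `[0, 1]`-valued function of a sample. -/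
theorem ex_sample_le (hR : Regime I h k Δ b) (Y : Fin n → Option (Fin s)) {S : List (Fin n)}
    {ζ : ℝ} (hK : 0 ≤ sizeBound n k Δ ζ) {f : ℝ}
    (hf : (1 - (1 - 2 * (1 / b) ^ (k - 1)) ^ ⌊sizeBound n k Δ ζ⌋₊) ^ numTrials n k Δ q ζ ≤ f)
    {g : (Fin n → Fin q) → ℝ} (hg : UnitValued g) (hgS : DepOn g S.toFinset) :
    (sample I h k Δ S Y ζ).ex g ≤ cond I.ed (lists h Y) g + S.length * f +
      ∑ w ∈ S.toFinset, ind (Large I Y (sizeBound n k Δ ζ) w) := by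
  have hP := hR.listPair Y Y
  have hE := isExpectation_cond hP.avg_pos₁
  set K := sizeBound n k Δ ζ with hK'
  set R := numTrials n k Δ q ζ with hR'
  set lam := (1 - 2 * (1 / b) ^ (k - 1)) ^ ⌊K⌋₊ with hlam
  have hlam0 : 0 < lam := pow_pos hP.base_pos _
  have hlam1 : lam ≤ 1 := pow_le_one₀ hP.base_pos.le (by linarith [hP.sys₁.nonneg])
  have hx0 : 0 ≤ (1 - lam) ^ R := pow_nonneg (by linarith) _
  have hx1 : (1 - lam) ^ R ≤ 1 := pow_le_one₀ (by linarith) (by linarith)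
  have hc := hE.unitValued hg
  have hf0 : 0 ≤ S.length * f := mul_nonneg (Nat.cast_nonneg _) (hx0.trans hf)
  have hs0 : ∀ w ∈ S.toFinset, 0 ≤ ind (Large I Y K w) := fun w _ => ind_nonneg _
  by_cases hlarge : ∃ w ∈ S, Large I Y K w
  · obtain ⟨w, hw, hwl⟩ := hlarge
    have h1 := Finset.single_le_sum hs0 (List.mem_toFinset.2 hw)
    rw [ind_true hwl] at h1
    have h2 := (sample I h k Δ S Y ζ).ex_le_one hg
    linarith [hc.1]
  · have hg' : UnitValued fun Z => 1 - g Z := fun a =>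
      ⟨sub_nonneg.2 (hg a).2, sub_le_self _ (hg a).1⟩
    -- The lower bound for 1 - g becomes an upper bound for g; Bernoulli's inequality turns the
    -- power into |S| times the failure probability.
    have h1 := hR.le_ex_sample Y hK hlarge hg' (hgS.comp (1 - ·))
    rw [RandComp.ex_one_sub _ hg, hE.sub, hE.one] at h1
    have h2 := one_add_mul_le_pow (a := -(1 - lam) ^ R) (by linarith) S.length
    have h3 : (1 + -(1 - lam) ^ R) ^ S.length ≤ 1 := pow_le_one₀ (by linarith) (by linarith)
    rw [← sub_eq_add_neg] at h2 h3
    have h4 : (S.length : ℝ) * (1 - lam) ^ R ≤ S.length * f :=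
      mul_le_mul_of_nonneg_left hf (Nat.cast_nonneg _)
    have h5 := Finset.sum_nonneg hs0
    nlinarith [hc.1, hc.2]

end Regime

end Sampling

/-! ### Running times -/

section Time

variable {n m s q : ℕ} {H : Hypergraph (Fin n)}

theorem time_drawColours (h : ProjectionScheme q s) (Y : Fin n → Option (Fin s))
    (vs : List (Fin n)) : ∀ X,
      (drawColours h Y vs X).Spec fun _ t => t ≤ vs.length * (1 + colourCost q) := by
  induction vs with
  | nil => exact fun X => spec_pure (by simp)
  | cons v vs ih =>
    intro X
    have h1 : (drawColour h (Y v)).Spec fun _ t => t = colourCost q := by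
      rcases Y v with _ | j
      · exact spec_draw _ fun _ _ => rfl
      · exact spec_draw _ fun _ _ => rfl
    refine spec_tick_bind (spec_bind h1 fun c t ht => (ih _).mono fun _ t' ht' => ?_)
    rw [List.length_cons, add_mul]
    omega

theorem time_rejectionSample (I : IncidenceLists H m) (h : ProjectionScheme q s)
    {k : ℕ} (hk : ∀ e, (I.verts e).length = k) (Y : Fin n → Option (Fin s)) (vs : List (Fin n))
    (es : List (Fin m)) (R : ℕ) : ∀ X,
      (rejectionSample I h Y vs es R X).Spec fun _ t =>
        t ≤ R * (1 + vs.length * (1 + colourCost q) + es.length * (k + 1)) := by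
  have : Nonempty (Fin q) := ⟨h.someColour⟩
  induction R with
  | zero => exact fun X => spec_pure (by simp)
  | succ R ih =>
    intro X
    refine spec_tick_bind (spec_bind (time_drawColours h Y vs X) fun X' t ht =>
      spec_bind (spec_allProper I hk X' es) fun b t' ht' => ?_)
    split_ifs
    · refine spec_pure ?_
      have := ht'.2
      rw [add_mul]
      omega
    · refine (ih X').mono fun _ t'' ht'' => ?_
      have := ht'.2
      rw [add_mul]
      omega

/-- A bound for the time of the rejection sampling on a component with at most `K` hyperedges. -/
def componentCost (k c K R : ℕ) : ℕ := 1 + R * (1 + (1 + k * K) * (1 + c) + K * (k + 1))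

theorem time_sampleComponents (I : IncidenceLists H m) (h : ProjectionScheme q s)
    {k : ℕ} (hk : ∀ e, (I.verts e).length = k) (Y : Fin n → Option (Fin s)) {K R : ℕ}
    (cs : List (List (Fin n) × List (Fin m))) (hV : ∀ c ∈ cs, c.1.length ≤ 1 + k * K)
    (hE : ∀ c ∈ cs, c.2.length ≤ K) : ∀ X, (sampleComponents I h Y R cs X).Spec fun _ t =>
      t ≤ cs.length * componentCost k (colourCost q) K R := by
  induction cs with
  | nil => exact fun X => spec_pure (by simp)
  | cons c cs ih =>
    intro X
    have h1 : R * (1 + c.1.length * (1 + colourCost q) + c.2.length * (k + 1)) ≤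
        R * (1 + (1 + k * K) * (1 + colourCost q) + K * (k + 1)) := by
      gcongr
      · exact hV c (by simp)
      · exact hE c (by simp)
    refine spec_tick_bind (spec_bind (time_rejectionSample I h hk Y c.1 c.2 R X) ?_)
    rintro (_ | X') t ht
    · refine spec_pure ?_
      rw [List.length_cons, add_mul, componentCost]
      omega
    · refine (ih (fun c' hc' => hV c' (List.mem_cons_of_mem _ hc'))
        (fun c' hc' => hE c' (List.mem_cons_of_mem _ hc')) X').mono fun _ t' ht' => ?_
      rw [List.length_cons, add_mul]
      unfold componentCost at *
      omega

/-- A bound for the time that `sample` spends per vertex of `S`. -/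
def vertexCost (k Δ c K R : ℕ) : ℕ :=
  1 + (2 + k * K) * (1 + Δ * (2 * k + 1)) + componentCost k c K R + (1 + c)

namespace Regime

variable {I : IncidenceLists H m} {h : ProjectionScheme q s} {k Δ : ℕ} {b : ℝ}

theorem time_sample (hR : Regime I h k Δ b) (S : List (Fin n)) (Y : Fin n → Option (Fin s))
    {ζ : ℝ} (hK : 0 ≤ sizeBound n k Δ ζ) :
    (sample I h k Δ S Y ζ).Spec fun _ t => t ≤ 1 + S.length *
      vertexCost k Δ (colourCost q) ⌊sizeBound n k Δ ζ⌋₊ (numTrials n k Δ q ζ) := by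
  have : Nonempty (Fin s) := ⟨h.toFun h.someColour⟩
  set K := sizeBound n k Δ ζ
  set R := numTrials n k Δ q ζ
  have hV : S.length * vertexCost k Δ (colourCost q) ⌊K⌋₊ R =
      S.length * (1 + (2 + k * ⌊K⌋₊) * (1 + Δ * (2 * k + 1))) +
        S.length * componentCost k (colourCost q) ⌊K⌋₊ R + S.length * (1 + colourCost q) := by
    unfold vertexCost
    ring
  refine spec_tick_bind (spec_bind (spec_components I hR.length_verts hR.length_inc hK S ∅ ∅
    ⟨by simp, by simp⟩) ?_)
  rintro (_ | cs) t ⟨ht, -, hcs⟩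
  · refine (time_drawColours h _ S _).mono fun _ t' ht' => ?_
    rw [hV]
    omega
  · obtain ⟨hok, hlen, -⟩ := hcs cs rfl
    have h1 : cs.length * componentCost k (colourCost q) ⌊K⌋₊ R ≤ S.length * componentCost k (colourCost q) ⌊K⌋₊ R :=
      Nat.mul_le_mul_right _ hlen
    refine spec_bind (time_sampleComponents I h hR.length_verts Y (R := R) cs hok.lengthV
      hok.lengthE _) ?_
    rintro (_ | X) t' ht'
    · refine (time_drawColours h _ S _).mono fun _ t'' ht'' => ?_
      rw [hV]
      omega
    · refine spec_pure ?_
      rw [hV]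
      omega

theorem time_scanStep (hR : Regime I h k Δ b) (v : Fin n) (Y : Fin n → Fin s)
    {ζ : ℝ} (hK : 0 ≤ sizeBound n k Δ ζ) :
    (scanStep I h k Δ ζ v Y).Spec fun _ t => t ≤ 2 + colourCost q +
      vertexCost k Δ (colourCost q) ⌊sizeBound n k Δ ζ⌋₊ (numTrials n k Δ q ζ) := by
  refine spec_tick_bind (spec_bind (hR.time_sample _ _ hK) fun X t ht =>
    spec_tick_bind (spec_pure ?_))
  rw [List.length_singleton, one_mul] at ht
  omega

theorem time_scan [NeZero n] (hR : Regime I h k Δ b) (Y : Fin n → Fin s)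
    {ζ : ℝ} (hK : 0 ≤ sizeBound n k Δ ζ) (T : ℕ) :
    (scan I h k Δ ζ T Y).Spec fun _ t => t ≤ T * (2 + colourCost q +
      vertexCost k Δ (colourCost q) ⌊sizeBound n k Δ ζ⌋₊ (numTrials n k Δ q ζ)) := by
  induction T with
  | zero => exact spec_pure (by simp)
  | succ T ih =>
    refine spec_bind ih fun Y' t ht => (hR.time_scanStep _ Y' hK).mono fun _ t' ht' => ?_
    rw [add_mul]
    omega

end Regime

theorem time_drawBuckets (h : ProjectionScheme q s) (vs : List (Fin n)) : ∀ Y,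
    (drawBuckets h vs Y).Spec fun _ t => t ≤ vs.length * (1 + colourCost q) := by
  induction vs with
  | nil => exact fun X => spec_pure (by simp)
  | cons v vs ih =>
    intro Y
    refine spec_tick_bind (spec_bind (spec_draw (P := fun _ t => t = colourCost q) _
      fun _ _ => rfl) fun j t ht => (ih _).mono fun _ t' ht' => ?_)
    rw [List.length_cons, add_mul]
    omega

theorem Regime.time_samplingAlgorithm [NeZero n] {I : IncidenceLists H m}
    {h : ProjectionScheme q s} {k Δ : ℕ} {b : ℝ} (hR : Regime I h k Δ b) {ε : ℝ}
    (hK : 0 ≤ sizeBound n k Δ (ε / (4 * numSteps n Δ ε))) :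
    (samplingAlgorithm I h k Δ ε).Spec fun _ t => t ≤ 2 + n * (1 + colourCost q) +
      (numSteps n Δ ε + n) * (2 + colourCost q + vertexCost k Δ (colourCost q)
        ⌊sizeBound n k Δ (ε / (4 * numSteps n Δ ε))⌋₊
        (numTrials n k Δ q (ε / (4 * numSteps n Δ ε)))) := by
  refine spec_tick_bind (spec_bind (time_drawBuckets h _ _) fun Y t ht =>
    spec_bind (hR.time_scan Y hK _) fun Y' t' ht' =>
      (hR.time_sample _ _ hK).mono fun _ t'' ht'' => ?_)
  rw [List.length_finRange] at ht ht''
  rw [add_mul (numSteps n Δ ε), mul_add n (2 + _)]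
  omega

end Time

/-! ### The systematic scan with exact updates -/

section Chain

variable {n m s q : ℕ} {H : Hypergraph (Fin n)}

/-- The partial image that is defined everywhere except at `v`. -/
def hide (v : Fin n) (Y : Fin n → Fin s) : Fin n → Option (Fin s) :=
  Function.update (fun u => some (Y u)) v none

/-- The image that is defined everywhere. -/
def full (Y : Fin n → Fin s) : Fin n → Option (Fin s) := fun u => some (Y u)

theorem hide_same (v : Fin n) (Y : Fin n → Fin s) : hide v Y v = none := by
  simp [hide]

theorem hide_of_ne {u v : Fin n} (huv : u ≠ v) (Y : Fin n → Fin s) : hide v Y u = some (Y u) := by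
  simp [hide, huv]

/-- The expectation of `g` after an exact update at `v`. -/
def resample (I : IncidenceLists H m) (h : ProjectionScheme q s) (v : Fin n)
    (g : (Fin n → Fin s) → ℝ) (Y : Fin n → Fin s) : ℝ :=
  cond I.ed (lists h (hide v Y)) fun Z => g (Function.update Y v (h.toFun (Z v)))

/-- The expectation with respect to a uniform proper colouring. -/
def uniformEx (I : IncidenceLists H m) (q : ℕ) (g : (Fin n → Fin q) → ℝ) : ℝ :=
  cond I.ed (fun _ => (Finset.univ : Finset (Fin q))) g

theorem cond_eq_sum {V κ ι : Type} [Fintype V] [DecidableEq V] [Fintype ι] [DecidableEq ι]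
    (ed : ι → Finset V) {L : V → Finset κ} (hL : ∀ v, (L v).Nonempty) (g : (V → κ) → ℝ) :
    cond ed L g = (∑ Z ∈ Fintype.piFinset L, g Z * ind (Good ed Z)) /
      ∑ Z ∈ Fintype.piFinset L, ind (Good ed Z) := by
  unfold cond avg
  rw [div_div_div_cancel_right₀ (card_piFinset_pos hL).ne']

theorem sum_fibre_average {Ω K : Type} [Fintype Ω] [Fintype K] [DecidableEq K] (key : Ω → K)
    {w : Ω → ℝ} (hw : ∀ x, 0 ≤ w x) (F : Ω → ℝ) :
    ∑ x, ((∑ z with key z = key x, F z * w z) / ∑ z with key z = key x, w z) * w x =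
      ∑ x, F x * w x := by
  rw [← Finset.sum_fiberwise Finset.univ key, ← Finset.sum_fiberwise Finset.univ key fun x => F x * w x]
  refine Finset.sum_congr rfl fun c _ => ?_
  have h1 : ∑ x with key x = c, ((∑ z with key z = key x, F z * w z) /
      ∑ z with key z = key x, w z) * w x = ∑ x with key x = c,
        ((∑ z with key z = c, F z * w z) / ∑ z with key z = c, w z) * w x := by
    refine Finset.sum_congr rfl fun x hx => ?_
    rw [(Finset.mem_filter.1 hx).2]
  rw [h1, ← Finset.mul_sum]
  -- On a fibre of total weight zero all weights vanish, and the quotient by zero does no harm.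
  by_cases h0 : ∑ z with key z = c, w z = 0
  · have h2 := (Finset.sum_eq_zero_iff_of_nonneg fun x _ => hw x).1 h0
    rw [h0, mul_zero]
    exact (Finset.sum_eq_zero fun x hx => by rw [h2 x hx, mul_zero]).symm
  · exact div_mul_cancel₀ _ h0

/-- By `hkey`, the lists attached to `key X` contain exactly the colourings with the same key. So
`cond` is the conditional expectation given the key, and this is the tower property. -/
theorem uniformEx_cond (I : IncidenceLists H m) (h : ProjectionScheme q s)
    (key : (Fin n → Fin q) → Fin n → Option (Fin s))
    (hkey : ∀ X Z, (∀ v, Z v ∈ lists h (key X) v) ↔ key Z = key X) (g : (Fin n → Fin q) → ℝ) :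
    uniformEx I q (fun X => cond I.ed (lists h (key X)) g) = uniformEx I q g := by
  have hu : ∀ _ : Fin n, (Finset.univ : Finset (Fin q)).Nonempty := fun _ =>
    h.univ_colours_nonempty
  unfold uniformEx
  rw [cond_eq_sum _ hu, cond_eq_sum _ hu, Fintype.piFinset_univ]
  congr 1
  rw [← sum_fibre_average key (fun X => ind_nonneg (Good I.ed X)) g]
  refine Finset.sum_congr rfl fun X _ => ?_
  rw [cond_eq_sum _ (lists_nonempty h _)]
  have h1 : Fintype.piFinset (lists h (key X)) = Finset.univ.filter fun Z => key Z = key X := by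
    ext Z
    simp [Fintype.mem_piFinset, hkey]
  rw [h1]

theorem mem_lists_full {h : ProjectionScheme q s} {X Z : Fin n → Fin q} :
    (∀ v, Z v ∈ lists h (full fun u => h.toFun (X u)) v) ↔
      (full fun u => h.toFun (Z u)) = full fun u => h.toFun (X u) := by
  rw [funext_iff]
  refine forall_congr' fun v => ?_
  simp [lists, full, ProjectionScheme.fibre]

theorem mem_lists_hide {h : ProjectionScheme q s} {w : Fin n} {X Z : Fin n → Fin q} :
    (∀ v, Z v ∈ lists h (hide w fun u => h.toFun (X u)) v) ↔
      (hide w fun u => h.toFun (Z u)) = hide w fun u => h.toFun (X u) := by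
  rw [funext_iff]
  refine forall_congr' fun v => ?_
  by_cases hv : v = w
  · subst hv
    simp [lists, hide]
  · simp [lists, hide, hv, ProjectionScheme.fibre]

theorem uniformEx_cond_full (I : IncidenceLists H m) (h : ProjectionScheme q s)
    (g : (Fin n → Fin q) → ℝ) :
    uniformEx I q (fun X => cond I.ed (lists h (full fun u => h.toFun (X u))) g) =
      uniformEx I q g :=
  uniformEx_cond I h (fun X => full fun u => h.toFun (X u)) (fun _ _ => mem_lists_full) g

/-- Stationarity of the image law: an exact update at v is conditioning on the image off v. -/
theorem uniformEx_resample (I : IncidenceLists H m) (h : ProjectionScheme q s) (v : Fin n)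
    (g : (Fin n → Fin s) → ℝ) :
    uniformEx I q (fun X => resample I h v g fun u => h.toFun (X u)) =
      uniformEx I q fun X => g fun u => h.toFun (X u) := by
  rw [← uniformEx_cond I h (fun X => hide v fun u => h.toFun (X u)) (fun _ _ => mem_lists_hide)
    fun X => g fun u => h.toFun (X u)]
  congr 1
  funext X
  refine cond_congr fun Z hZ => ?_
  congr 1
  have h1 := mem_lists_hide.1 hZ
  funext u
  by_cases hu : u = v
  · subst hu
    simp
  · have := congrFun h1 u
    rw [hide_of_ne hu, hide_of_ne hu, Option.some_inj] at this
    simp [hu, this]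

theorem uniformEx_updates (I : IncidenceLists H m) (h : ProjectionScheme q s)
    (g : (Fin n → Fin s) → ℝ) (l : List (Fin n)) :
    uniformEx I q (fun X => updates (resample I h) l g fun u => h.toFun (X u)) =
      uniformEx I q fun X => g fun u => h.toFun (X u) := by
  induction l with
  | nil => rfl
  | cons v l ih => exact (uniformEx_resample I h v _).trans ih

namespace Regime

variable {I : IncidenceLists H m} {h : ProjectionScheme q s} {k Δ : ℕ} {b : ℝ}

theorem isExpectation_uniformEx (hR : Regime I h k Δ b) : IsExpectation (uniformEx I q) :=
  isExpectation_cond (hR.listPair (fun _ => none) fun _ => none).avg_pos₁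

theorem isExpectation_cond_lists (hR : Regime I h k Δ b) (Y : Fin n → Option (Fin s)) :
    IsExpectation (cond I.ed (lists h Y)) :=
  isExpectation_cond (hR.listPair Y Y).avg_pos₁

theorem isExpectation_resample (hR : Regime I h k Δ b) (v : Fin n) (Y : Fin n → Fin s) :
    IsExpectation fun g => resample I h v g Y :=
  (hR.isExpectation_cond_lists _).map fun Z => Function.update Y v (h.toFun (Z v))

theorem isExpectation_updates (hR : Regime I h k Δ b) (l : List (Fin n)) : ∀ Y,
    IsExpectation fun g => updates (resample I h) l g Y := by
  induction l with
  | nil =>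
    exact fun Y => ⟨fun _ _ => rfl, fun _ _ => rfl, fun _ _ hfg => hfg Y, rfl⟩
  | cons v l ih => exact fun Y => (hR.isExpectation_resample v Y).bind ih

/-- A change at u ≠ v acts in two ways: it moves the law of the colour of v, which `cond_sub_le`
controls by the influence, and it changes the state into which the new bucket is written, at a cost
`o u`. The old bucket of v is overwritten and no longer matters. -/
theorem dobrushin (hR : Regime I h k Δ b) (hf : ListPair.factor k Δ b ^ k ≤ 2)
    (hw : ListPair.edgeWeight k b * (Δ * k) ≤ 1 / 16) :
    Dobrushin (resample I h) (ListPair.influence I.ed k Δ b) where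
  nonneg := (hR.listPair (fun _ => none) fun _ => none).influence_nonneg
  sum_le := (hR.listPair (fun _ => none) fun _ => none).sum_influence_le hf hw
  osc := by
    intro v g o ho hg u Y a
    by_cases huv : u = v
    · subst huv
      have h1 : hide u (Function.update Y u a) = hide u Y := by
        funext w
        by_cases hw : w = u <;> simp [hide, hw]
      simp [resample, h1]
    · dsimp only
      rw [if_neg huv]
      set Y' := Function.update Y u a with hY'
      have h1 : cond I.ed (lists h (hide v Y))
          (fun Z => g (Function.update Y v (h.toFun (Z v)))) ≤ cond I.ed (lists h (hide v Y'))
          (fun Z => g (Function.update Y v (h.toFun (Z v)))) +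
            ListPair.influence I.ed k Δ b u v * o v := by
        refine (hR.listPair _ _).cond_sub_le (Ne.symm huv) (fun w hw => ?_) ?_ ?_
        · have : hide v Y w = hide v Y' w := by
            by_cases hwv : w = v
            · simp [hide, hwv]
            · simp [hide, hwv, hY', hw]
          simp only [lists, this]
        · intro Z Z' hZ
          simp only [hZ v (Finset.mem_singleton_self v)]
        · intro Z Z'
          have := hg v (Function.update Y v (h.toFun (Z v))) (h.toFun (Z' v))
          rw [Function.update_idem] at this
          linarith
      have hE := hR.isExpectation_cond_lists (hide v Y')
      have h2 : cond I.ed (lists h (hide v Y'))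
          (fun Z => g (Function.update Y v (h.toFun (Z v)))) ≤ resample I h v g Y' + o u := by
        have h3 := hE.add (fun Z => g (Function.update Y' v (h.toFun (Z v)))) fun _ => o u
        rw [hE.const] at h3
        rw [resample, ← h3]
        refine hE.mono _ _ fun Z => ?_
        have h4 := hg u (Function.update Y v (h.toFun (Z v))) a
        rwa [Function.update_comm (Ne.symm huv)] at h4
      unfold resample at h2 ⊢
      linarith

/-- The lists of a bucket image make every bucket of a vertex unlikely. -/
theorem cond_bucket_le (hR : Regime I h k Δ b) {π : ℝ}
    (hπ : ∀ j, ((h.fibre j).card : ℝ) ≤ π * (1 - 2 * (1 / b) ^ (k - 1)) ^ Δ * q) (v : Fin n)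
    (Y : Fin n → Fin s) (j : Fin s) :
    cond I.ed (lists h (hide v Y)) (fun Z => ind (h.toFun (Z v) = j)) ≤ π := by
  have hP := hR.listPair (hide v Y) (hide v Y)
  set L := lists h (hide v Y) with hL
  have hne : ∀ u, (L u).Nonempty := lists_nonempty h _
  have hq : (0 : ℝ) < q := by
    have := h.one_le.trans h.le
    exact_mod_cast this
  have hdep : DepOn (fun Z : Fin n → Fin q => ind (h.toFun (Z v) = j)) {v} := fun Z Z' hZ => by
    simp only [hZ v (Finset.mem_singleton_self v)]
  -- As v is hidden, its list is all of [q]; conditioning on properness involves at most the Δ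
  -- hyperedges through v.
  have h1 := hP.sys₁.pow_mul_avg_mul_le hP.one_le_deg (W := {v}) (t := Δ)
    (by simpa using hR.family.card_touching_le {v}) hdep fun Z => ind_nonneg _
  have h2 : avg L (fun Z => ind (h.toFun (Z v) = j)) = (h.fibre j).card / q := by
    rw [avg_update hne v]
    have hLv : L v = Finset.univ := by simp [hL, lists, hide_same]
    simp only [Function.update_self, avg_const hne, hLv, ind, Finset.sum_ite,
      ProjectionScheme.fibre]
    simp
  rw [h2] at h1
  have hb0 : 0 < (1 - 2 * (1 / b) ^ (k - 1)) ^ Δ := pow_pos hP.base_pos _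
  have ha := hP.avg_pos₁
  unfold cond
  rw [div_le_iff₀ ha]
  refine le_of_mul_le_mul_left (h1.trans ?_) hb0
  have h3 : ((h.fibre j).card : ℝ) / q ≤ π * (1 - 2 * (1 / b) ^ (k - 1)) ^ Δ := by
    rw [div_le_iff₀ hq]
    exact hπ j
  refine (mul_le_mul_of_nonneg_right h3 ha.le).trans (le_of_eq ?_)
  unfold Good
  ring

end Regime

/-- The uniform distribution on the images. -/
def uniformImage (n s : ℕ) (g : (Fin n → Fin s) → ℝ) : ℝ :=
  avg (fun _ => (Finset.univ : Finset (Fin s))) g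

theorem isExpectation_uniformImage (h : ProjectionScheme q s) :
    IsExpectation (uniformImage n s) :=
  isExpectation_avg fun _ => h.univ_buckets_nonempty

theorem ex_drawBuckets (h : ProjectionScheme q s) {g : (Fin n → Fin s) → ℝ} (hg : UnitValued g)
    (vs : List (Fin n)) (hvs : vs.Nodup) : ∀ Y, (drawBuckets h vs Y).ex g =
      uniformImage n s fun Z => g (mix vs.toFinset Z Y) := by
  have hne : ∀ _ : Fin n, (Finset.univ : Finset (Fin s)).Nonempty := fun _ =>
    h.univ_buckets_nonempty
  unfold uniformImage
  induction vs with
  | nil =>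
    intro Y
    rw [drawBuckets, ex_pure _ hg, ← avg_const hne (g Y)]
    congr 1
  | cons v vs ih =>
    intro Y
    rw [List.nodup_cons] at hvs
    rw [drawBuckets, ex_tick_bind _ _ hg, ex_bind _ _ hg,
      ex_draw _ _ (RandComp.unitValued_ex _ hg), avg_update hne v]
    congr 1
    refine Finset.sum_congr rfl fun c _ => ?_
    rw [ih hvs.2]
    congr 1
    funext Z
    congr 1
    funext x
    by_cases hx : x = v
    · subst hx
      simp [mix, hvs.1]
    · simp [mix, hx]

/-- The vertices that are updated in the steps `t + 1, …, t + l` of the scan. -/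
def schedule (n : ℕ) [NeZero n] (t l : ℕ) : List (Fin n) :=
  (List.range l).map fun i => Fin.ofNat n (t + i + 1)

theorem schedule_succ [NeZero n] (t l : ℕ) :
    schedule n t (l + 1) = schedule n t l ++ [Fin.ofNat n (t + l + 1)] := by
  simp [schedule, List.range_succ]

theorem schedule_add [NeZero n] (t l l' : ℕ) :
    schedule n t (l + l') = schedule n t l ++ schedule n (t + l) l' := by
  induction l' with
  | zero => simp [schedule]
  | succ l' ih =>
    rw [← add_assoc, schedule_succ, ih, schedule_succ, List.append_assoc]
    simp only [add_assoc]

theorem mem_schedule [NeZero n] (t : ℕ) (v : Fin n) : v ∈ schedule n t n := by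
  have hn : 0 < n := Nat.pos_of_neZero n
  -- The index solves t + i + 1 ≡ v modulo n, with (n - 1)(t + 1) in the role of -(t + 1).
  refine List.mem_map.2 ⟨(v.val + (n - 1) * (t + 1)) % n, List.mem_range.2 (Nat.mod_lt _ hn), ?_⟩
  refine Fin.ext ?_
  rw [Fin.val_ofNat, add_right_comm, Nat.add_mod_mod]
  have : t + 1 + (v.val + (n - 1) * (t + 1)) = v.val + n * (t + 1) := by
    obtain ⟨p, rfl⟩ : ∃ p, n = p + 1 := ⟨n - 1, by omega⟩
    rw [Nat.add_sub_cancel]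
    ring
  rw [this, Nat.add_mul_mod_self_left, Nat.mod_eq_of_lt v.isLt]

/-! ### Convergence of the exact scan and comparison with the approximate one -/

namespace Regime

variable {I : IncidenceLists H m} {h : ProjectionScheme q s} {k Δ : ℕ} {b : ℝ}

/-- The expectation after `t` steps of the scan with exact updates. -/
def scanEx [NeZero n] (I : IncidenceLists H m) (h : ProjectionScheme q s) (t : ℕ)
    (g : (Fin n → Fin s) → ℝ) : ℝ :=
  uniformImage n s (updates (resample I h) (schedule n 0 t) g)

theorem isExpectation_scanEx [NeZero n] (hR : Regime I h k Δ b) (t : ℕ) :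
    IsExpectation (scanEx I h t) :=
  (isExpectation_uniformImage h).bind fun Y => hR.isExpectation_updates _ Y

theorem scanEx_succ [NeZero n] (t : ℕ) (g : (Fin n → Fin s) → ℝ) :
    scanEx I h (t + 1) g = scanEx I h t (resample I h (Fin.ofNat n (t + 1)) g) := by
  unfold scanEx
  rw [schedule_succ, updates_append, zero_add]
  rfl

/-- If the vertex updated last lies in `W`, its new bucket is the prescribed one with probability at
most π, whatever the other buckets are; otherwise the update leaves the event alone. No mixing is
involved, so this holds at all times. -/
theorem scanEx_cylinder_le [NeZero n] (hR : Regime I h k Δ b) {π : ℝ} (hsπ : 1 / (s : ℝ) ≤ π)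
    (hπ : ∀ j, ((h.fibre j).card : ℝ) ≤ π * (1 - 2 * (1 / b) ^ (k - 1)) ^ Δ * q) (t : ℕ) :
    ∀ (W : Finset (Fin n)) (τ : Fin n → Fin s),
      scanEx I h t (fun Y => ind (∀ v ∈ W, Y v = τ v)) ≤ π ^ W.card := by
  have hs : (0 : ℝ) < s := by exact_mod_cast h.one_le
  have hπ0 : 0 ≤ π := (by positivity : (0 : ℝ) ≤ 1 / s).trans hsπ
  induction t with
  | zero =>
    intro W τ
    refine (avg_cylinder_le hs (by simp) W τ).trans ?_
    exact pow_le_pow_left₀ (by positivity) hsπ _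
  | succ t ih =>
    intro W τ
    rw [scanEx_succ]
    set v := Fin.ofNat n (t + 1)
    by_cases hv : v ∈ W
    · have h1 : ∀ Y, resample I h v (fun Y => ind (∀ u ∈ W, Y u = τ u)) Y ≤
          π * ind (∀ u ∈ W.erase v, Y u = τ u) := by
        intro Y
        have hE := hR.isExpectation_cond_lists (hide v Y)
        rw [mul_comm]
        refine le_trans ?_ (mul_le_mul_of_nonneg_left (hR.cond_bucket_le hπ v Y (τ v))
          (ind_nonneg (∀ u ∈ W.erase v, Y u = τ u)))
        rw [← hE.smul]
        refine hE.mono _ _ fun Z => ?_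
        rw [← ind_and]
        refine ind_mono fun hZ => ⟨fun u hu => ?_, ?_⟩
        · have := hZ u (Finset.mem_of_mem_erase hu)
          rwa [Function.update_of_ne (Finset.ne_of_mem_erase hu)] at this
        · simpa using hZ v hv
      have hE := hR.isExpectation_scanEx t
      refine (hE.mono _ _ h1).trans ?_
      rw [hE.smul, ← Finset.card_erase_add_one hv, pow_succ, mul_comm]
      exact mul_le_mul_of_nonneg_right (ih _ _) hπ0
    · have h1 : resample I h v (fun Y => ind (∀ u ∈ W, Y u = τ u)) =
          fun Y => ind (∀ u ∈ W, Y u = τ u) := by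
        funext Y
        rw [← (hR.isExpectation_cond_lists (hide v Y)).const (ind (∀ u ∈ W, Y u = τ u))]
        refine cond_congr fun Z _ => ind_congr (forall₂_congr fun u hu => ?_)
        rw [Function.update_of_ne (show u ≠ v from fun huv => hv (huv ▸ hu))]
      rw [h1]
      exact ih W τ

/-- A function is pulled back through the last updates first, so full sweeps are peeled off at the
end of the schedule. The t updates that remain do not increase the total oscillation. -/
theorem exists_osc_schedule [NeZero n] (hR : Regime I h k Δ b)
    (hf : ListPair.factor k Δ b ^ k ≤ 2) (hw : ListPair.edgeWeight k b * (Δ * k) ≤ 1 / 16)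
    (t a : ℕ) : ∀ (g : (Fin n → Fin s) → ℝ) (o : Fin n → ℝ), (∀ u, 0 ≤ o u) → Osc g o →
      ∃ o' : Fin n → ℝ, (∀ u, 0 ≤ o' u) ∧
        Osc (updates (resample I h) (schedule n 0 (t + n * a)) g) o' ∧
        ∑ u, o' u ≤ (1 / 2) ^ a * ∑ u, o u := by
  have hD := hR.dobrushin hf hw
  induction a with
  | zero =>
    intro g o ho hg
    obtain ⟨o', ho', hosc, hsum⟩ := hD.exists_osc_updates ho hg (schedule n 0 (t + n * 0))
    refine ⟨o', ho', hosc, ?_⟩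
    rw [pow_zero, one_mul]
    refine le_trans (Finset.sum_le_sum fun u _ => ?_) hsum
    have := ho' u
    split_ifs <;> linarith
  | succ a ih =>
    intro g o ho hg
    obtain ⟨o₁, ho₁, hosc₁, hsum₁⟩ := hD.exists_osc_updates_sweep ho hg
      (mem_schedule (n := n) (0 + (t + n * a)))
    obtain ⟨o₂, ho₂, hosc₂, hsum₂⟩ := ih _ o₁ ho₁ hosc₁
    refine ⟨o₂, ho₂, ?_, hsum₂.trans ?_⟩
    · rwa [mul_add, mul_one, ← add_assoc, schedule_add, updates_append]
    · rw [pow_succ, mul_assoc]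
      exact mul_le_mul_of_nonneg_left hsum₁ (by positivity)

/-- The scan with exact updates converges to the image of the uniform distribution. -/
theorem scanEx_le [NeZero n] (hR : Regime I h k Δ b)
    (hf : ListPair.factor k Δ b ^ k ≤ 2) (hw : ListPair.edgeWeight k b * (Δ * k) ≤ 1 / 16)
    (t : ℕ) {g : (Fin n → Fin s) → ℝ} (hg : UnitValued g) :
    scanEx I h t g ≤ uniformEx I q (fun X => g fun u => h.toFun (X u)) +
      n * (1 / 2) ^ (t / n) := by
  obtain ⟨o, -, hosc, hsum⟩ := hR.exists_osc_schedule hf hw (t % n) (t / n) g (fun _ => 1)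
    (fun _ => zero_le_one) fun u Y a => by linarith [(hg Y).2, (hg (Function.update Y u a)).1]
  rw [Nat.mod_add_div] at hosc
  -- By stationarity both sides become expectations of the same function, whose total oscillation is
  -- small.
  rw [← uniformEx_updates I h g (schedule n 0 t)]
  have h1 := (isExpectation_uniformImage h).le_add
    (hR.isExpectation_uniformEx.map fun X u => h.toFun (X u))
    (f := updates (resample I h) (schedule n 0 t) g) fun Y Y' => hosc.le_add_sum Y Y'
  unfold scanEx
  simp only [Finset.sum_const, Finset.card_univ, Fintype.card_fin, nsmul_eq_mul, mul_one] at hsum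
  linarith

/-- The cluster of a vertex is not large after the scan, with high probability. -/
theorem scanEx_large_le [NeZero n] (hR : Regime I h k Δ b) {π : ℝ} (hsπ : 1 / (s : ℝ) ≤ π)
    (hπ1 : π ≤ 1)
    (hπ : ∀ j, ((h.fibre j).card : ℝ) ≤ π * (1 - 2 * (1 / b) ^ (k - 1)) ^ Δ * q) {ρ : ℝ}
    (hρ0 : 0 ≤ ρ) {θ l : ℕ}
    (hρ : (Δ * (Δ * (k * θ)) ^ θ : ℕ) * (s * π ^ ((k - θ) * θ)) * 2 ^ (k * θ + 1) ≤ ρ)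
    {K : ℝ} (hK : (1 + k * θ * l) * (Δ * θ) ≤ K)
    (t : ℕ) (w : Fin n) {Q : (Fin n → Fin s) → Fin n → Option (Fin s)}
    (hQ : ∀ Y v, v ≠ w → Q Y v = some (Y v)) :
    scanEx I h t (fun Y => ind (Large I (Q Y) K w)) ≤ 2 * ρ ^ l := by
  have : Nonempty (Fin s) := ⟨h.toFun h.someColour⟩
  have hs : (0 : ℝ) < s := by exact_mod_cast h.one_le
  have hE := hR.isExpectation_scanEx (n := n) (I := I) (h := h) t
  refine le_trans (hE.mono _ _ fun Y => ind_mono ?_) (hR.family.cluster_le hE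
    ((by positivity : (0 : ℝ) ≤ 1 / s).trans hsπ) hπ1 (hR.scanEx_cylinder_le hsπ hπ t)
    (θ := θ) hρ0 (by simpa using hρ) l w)
  rintro ⟨E, hE, hcard⟩
  refine ⟨E, fun e he => (hE e he).mono ?_, ?_⟩
  -- Off w the image is defined everywhere, so an unsatisfied hyperedge is constant off w.
  · rintro e ⟨a, -, ha⟩
    refine ⟨a, fun v hv => ?_⟩
    rw [Finset.mem_erase] at hv
    exact ha v (by simpa [IncidenceLists.ed] using hv.2) (Y v) (hQ Y v hv.1)
  · have h1 := hK.trans_lt hcard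
    exact_mod_cast h1

/-- The error of the scan with approximate updates. -/
theorem ex_scan_le [NeZero n] (hR : Regime I h k Δ b) {ζ : ℝ} (hK : 0 ≤ sizeBound n k Δ ζ) {f κ : ℝ}
    (hf : (1 - (1 - 2 * (1 / b) ^ (k - 1)) ^ ⌊sizeBound n k Δ ζ⌋₊) ^ numTrials n k Δ q ζ ≤ f)
    (hκ : ∀ t w, scanEx I h t (fun Y => ind (Large I (hide w Y) (sizeBound n k Δ ζ) w)) ≤ κ)
    (t : ℕ) : ∀ {g : (Fin n → Fin s) → ℝ}, UnitValued g →
      uniformImage n s (fun Y => (scan I h k Δ ζ t Y).ex g) ≤ scanEx I h t g + t * (f + κ) := by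
  induction t with
  | zero =>
    intro g hg
    simp only [scan, ex_pure _ hg]
    simp [scanEx, schedule, updates]
  | succ t ih =>
    intro g hg
    set v := Fin.ofNat n (t + 1) with hv
    have h1 : ∀ Y, (scan I h k Δ ζ (t + 1) Y).ex g =
        (scan I h k Δ ζ t Y).ex fun Y' => (scanStep I h k Δ ζ v Y').ex g := fun Y => by
      rw [scan, ex_bind _ _ hg]
    simp only [h1]
    -- The first t steps are replaced by exact ones before the last step is treated, so the event of
    -- a large cluster is evaluated under the exact scan.
    refine (ih (RandComp.unitValued_ex _ hg)).trans ?_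
    have hE := hR.isExpectation_scanEx (n := n) (I := I) (h := h) t
    have h2 : ∀ Y, (scanStep I h k Δ ζ v Y).ex g ≤ resample I h v g Y + f +
        ind (Large I (hide v Y) (sizeBound n k Δ ζ) v) := by
      intro Y
      rw [scanStep, ex_tick_bind _ _ hg, ex_bind _ _ hg]
      have h4 := hR.ex_sample_le (hide v Y) (S := [v]) hK hf
        (g := fun X => g (Function.update Y v (h.toFun (X v)))) (fun X => hg _)
        fun X X' hX => by simp only [hX v (by simp)]
      simp only [List.length_singleton, Nat.cast_one, one_mul, List.toFinset_cons,
        List.toFinset_nil, insert_empty_eq, Finset.sum_singleton] at h4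
      refine (le_of_eq ?_).trans h4
      unfold hide
      congr 1
      funext X
      rw [ex_tick_bind _ _ hg, ex_pure _ hg]
    have h5 := hE.mono _ _ h2
    rw [hE.add, hE.add, hE.const] at h5
    rw [scanEx_succ]
    have := hκ t v
    push_cast
    linarith

/-- The error of the sampling algorithm. -/
theorem ex_samplingAlgorithm_le [NeZero n] (hR : Regime I h k Δ b)
    (hfac : ListPair.factor k Δ b ^ k ≤ 2) (hw : ListPair.edgeWeight k b * (Δ * k) ≤ 1 / 16)
    {π : ℝ} (hsπ : 1 / (s : ℝ) ≤ π) (hπ1 : π ≤ 1)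
    (hπ : ∀ j, ((h.fibre j).card : ℝ) ≤ π * (1 - 2 * (1 / b) ^ (k - 1)) ^ Δ * q) {ρ : ℝ}
    (hρ0 : 0 ≤ ρ) {θ l : ℕ}
    (hρ : (Δ * (Δ * (k * θ)) ^ θ : ℕ) * (s * π ^ ((k - θ) * θ)) * 2 ^ (k * θ + 1) ≤ ρ)
    {ε ζ : ℝ} (hζ : ζ = ε / (4 * numSteps n Δ ε))
    (hK : (1 + k * θ * l) * (Δ * θ) ≤ sizeBound n k Δ ζ) {f : ℝ}
    (hf : (1 - (1 - 2 * (1 / b) ^ (k - 1)) ^ ⌊sizeBound n k Δ ζ⌋₊) ^ numTrials n k Δ q ζ ≤ f)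
    {g : (Fin n → Fin q) → ℝ} (hg : UnitValued g) :
    (samplingAlgorithm I h k Δ ε).ex g ≤ uniformEx I q g +
      n * (1 / 2) ^ (numSteps n Δ ε / n) + (numSteps n Δ ε + n) * (f + 2 * ρ ^ l) := by
  subst hζ
  set T := numSteps n Δ ε
  set ζ := ε / (4 * T)
  have hK0 : 0 ≤ sizeBound n k Δ ζ := le_trans (by positivity) hK
  set G : (Fin n → Fin s) → ℝ := fun Y => (sample I h k Δ (List.finRange n) (full Y) ζ).ex g
  have hG : UnitValued G := RandComp.unitValued_ex _ hg
  have h1 : (samplingAlgorithm I h k Δ ε).ex g =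
      uniformImage n s fun Y => (scan I h k Δ ζ T Y).ex G := by
    rw [samplingAlgorithm, ex_tick_bind _ _ hg, ex_bind _ _ hg,
      ex_drawBuckets h (RandComp.unitValued_ex _ hg) _ (List.nodup_finRange n)]
    congr 1
    funext Z
    have : mix (List.finRange n).toFinset Z (fun _ => h.toFun h.someColour) = Z := by
      funext v
      simp [mix]
    rw [this, ex_bind _ _ hg]
    rfl
  rw [h1]
  -- The scan makes T calls for a single vertex and the final call handles n vertices: together a
  -- factor T + n.
  have h2 := hR.ex_scan_le hK0 hf (κ := 2 * ρ ^ l) (fun t w =>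
    hR.scanEx_large_le hsπ hπ1 hπ hρ0 hρ hK t w fun Y v hv => hide_of_ne hv Y) T hG
  refine h2.trans ?_
  have hE := hR.isExpectation_scanEx (n := n) (I := I) (h := h) T
  have h3 : ∀ Y, G Y ≤ cond I.ed (lists h (full Y)) g + n * f +
      ∑ w, ind (Large I (full Y) (sizeBound n k Δ ζ) w) := by
    intro Y
    have h4 := hR.ex_sample_le (full Y) (S := List.finRange n) hK0 hf hg
      fun Z Z' hZ => congrArg g (funext fun v => hZ v (by simp))
    have h5 : (List.finRange n).toFinset = Finset.univ := by
      ext v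
      simp
    rwa [List.length_finRange, h5] at h4
  have h4 := hE.mono _ _ h3
  rw [hE.add, hE.add, hE.const, hE.sum] at h4
  have h5 : ∑ w, scanEx I h T (fun Y => ind (Large I (full Y) (sizeBound n k Δ ζ) w)) ≤
      n * (2 * ρ ^ l) := by
    refine (Finset.sum_le_card_nsmul _ _ (2 * ρ ^ l) fun w _ =>
      hR.scanEx_large_le hsπ hπ1 hπ hρ0 hρ hK T w fun Y v _ => rfl).trans ?_
    simp
  have h6 := hR.scanEx_le hfac hw T (g := fun Y => cond I.ed (lists h (full Y)) g) fun Y =>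
    (hR.isExpectation_cond_lists _).unitValued hg
  rw [uniformEx_cond_full] at h6
  linarith

end Regime

end Chain

/-! ### Numerical estimates -/

section Numerics

/-- Converts the lower bound on q/100, with its real exponent, into inequalities between integer
powers of y. -/
theorem pow_le_sqrt_pow {A x a D : ℝ} (hA : 1 ≤ A) (ha : 0 < a) (hD : 0 < D)
    (hx : A ^ (a / D) ≤ x) {t N : ℕ} (htN : 2 * t * D ≤ N * a) : A ^ t ≤ √x ^ N := by
  have hx1 : 1 ≤ x := (Real.one_le_rpow hA (by positivity)).trans hx
  have h1 : A ^ t = (A ^ (a / D)) ^ (t * D / a) := by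
    rw [← Real.rpow_mul (by linarith), ← Real.rpow_natCast A t]
    congr 1
    field_simp
  have h2 : √x ^ N = x ^ ((N : ℝ) / 2) := by
    rw [Real.sqrt_eq_rpow, ← Real.rpow_natCast, ← Real.rpow_mul (by linarith)]
    congr 1
    ring
  rw [h1, h2]
  refine (Real.rpow_le_rpow (Real.rpow_nonneg (by linarith) _) hx (by positivity)).trans
    (Real.rpow_le_rpow_of_exponent_le hx1 ?_)
  rw [div_le_div_iff₀ ha two_pos]
  linarith

/-- The consequences of the assumptions on `k` and `q` that are used, with `y = √(q / 100)`. -/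
structure Bounds (k Δ θ : ℕ) (α y : ℝ) : Prop where
  one_le_theta : 1 ≤ θ
  theta_le : 10 * θ + 10 ≤ k
  lt : 20 < k
  one_le_deg : 1 ≤ Δ
  alpha_pos : 0 < α
  alpha_le : α ≤ 1
  one_le : 1 ≤ y
  deg_div_le : Δ / α ≤ y ^ (k - 4)
  pow_le : (Δ : ℝ) ^ (θ + 1) ≤ y ^ ((k - θ) * θ - 1)

theorem bounds_of_le {δ α : ℝ} (hδ : 0 < δ) (hα : 0 < α) (hα1 : α ≤ 1) {k Δ q : ℕ}
    (hΔ : 1 ≤ Δ) (hk : 20 * (1 + δ) / δ ≤ (k : ℝ))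
    (hq : 100 * ((Δ : ℝ) / α) ^ ((2 + δ) / ((k : ℝ) - 4 / δ - 4)) ≤ (q : ℝ)) :
    Bounds k Δ ⌈2 / δ⌉₊ α √((q : ℝ) / 100) := by
  set θ := ⌈2 / δ⌉₊ with hθ
  have hΔ' : (1 : ℝ) ≤ Δ := by exact_mod_cast hΔ
  have hk' : 20 / δ + 20 ≤ (k : ℝ) := by
    refine le_trans (le_of_eq ?_) hk
    field_simp
  have hδ1 : 0 < 1 / δ := by positivity
  have e1 : 20 / δ = 20 * (1 / δ) := by ring
  have e2 : 4 / δ = 4 * (1 / δ) := by ring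
  have e3 : 2 / δ = 2 * (1 / δ) := by ring
  have h1θ : 1 ≤ θ := Nat.one_le_ceil_iff.2 (by positivity)
  have h1θ' : (1 : ℝ) ≤ θ := by exact_mod_cast h1θ
  have hθ1 : 2 / δ ≤ θ := Nat.le_ceil _
  have hθ2 : (θ : ℝ) < 2 / δ + 1 := Nat.ceil_lt_add_one (by positivity)
  have hθk : 10 * θ + 10 ≤ k := by
    have : ((10 * θ + 10 : ℕ) : ℝ) ≤ k := by
      push_cast
      linarith
    exact_mod_cast this
  have hD : 0 < (k : ℝ) - 4 / δ - 4 := by linarith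
  have hA : 1 ≤ (Δ : ℝ) / α := by
    rw [le_div_iff₀ hα]
    linarith
  have hx : ((Δ : ℝ) / α) ^ ((2 + δ) / ((k : ℝ) - 4 / δ - 4)) ≤ (q : ℝ) / 100 := by
    rw [le_div_iff₀ (by norm_num)]
    linarith
  have hx1 : 1 ≤ (q : ℝ) / 100 :=
    (Real.one_le_rpow hA (by positivity)).trans hx
  have hdl : δ * (1 / δ) = 1 := by field_simp
  refine ⟨h1θ, hθk, ?_, hΔ, hα, hα1, Real.one_le_sqrt.2 hx1, ?_, ?_⟩
  · have : (20 : ℝ) < k := by linarith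
    exact_mod_cast this
  · rw [← pow_one ((Δ : ℝ) / α)]
    refine pow_le_sqrt_pow hA (by linarith) hD hx ?_
    rw [Nat.cast_sub (by omega)]
    push_cast
    nlinarith
  · refine (pow_le_pow_left₀ (by linarith) (le_div_self (by linarith) hα hα1) (θ + 1)).trans
      (pow_le_sqrt_pow hA (by linarith) hD hx ?_)
    have hM : 1 ≤ (k - θ) * θ := Nat.one_le_iff_ne_zero.2 (by
      have : 0 < k - θ := by omega
      positivity)
    rw [Nat.cast_sub hM, Nat.cast_mul, Nat.cast_sub (by omega)]
    push_cast
    -- The reason for θ = ⌈2/δ⌉: the difference of the two sides has coefficient δθ - 2 at k. Since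
    -- it is nonnegative, only k ≥ 20 has to be used.
    have hd : 2 ≤ δ * θ := by
      rw [div_le_iff₀ hδ] at hθ1
      linarith
    have hd2 : δ * θ ≤ 2 + δ := by
      have := mul_le_mul_of_nonneg_left hθ2.le hδ.le
      rw [e3] at this
      nlinarith
    set z := 1 / δ with hz
    rw [e2]
    rw [e3] at hθ2
    rw [e1] at hk'
    have h20 : (20 : ℝ) ≤ k := by linarith
    -- the claim reduces to an inequality without `k`
    have key : 2 * (θ : ℝ) ^ 2 + 2 + δ * θ ^ 2 + δ ≤
        8 * (θ + 1) * (1 + z) + (δ * θ - 2) * 20 := by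
      have a1 : 2 * (θ : ℝ) ^ 2 ≤ 2 * θ * (2 * z + 1) := by nlinarith
      have a2 : δ * (θ : ℝ) ^ 2 ≤ θ * (2 + δ) := by nlinarith
      rcases le_total δ 2 with h | h
      · nlinarith [mul_pos hδ1 (by linarith : (0 : ℝ) < θ)]
      · nlinarith [mul_pos hδ1 (by linarith : (0 : ℝ) < θ)]
    nlinarith [mul_le_mul_of_nonneg_left h20 (by linarith : 0 ≤ δ * (θ : ℝ) - 2)]

/-- From √q = 10y and 10y ≤ s ≤ 10y + 1 it follows that q/s lies between 10y - 1 and 10y; rounding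
changes it by at most 1, and y ≥ 1 absorbs the constants. -/
theorem bucket_bounds {q s : ℕ} (h : ProjectionScheme q s) (hs : s = ⌈Real.sqrt q⌉₊) {y : ℝ}
    (hy : y = √((q : ℝ) / 100)) (hy1 : 1 ≤ y) :
    (q : ℝ) = (10 * y) ^ 2 ∧ 10 * y ≤ s ∧ (s : ℝ) ≤ 11 * y ∧
      ∀ j, 8 * y ≤ ((h.fibre j).card : ℝ) ∧ ((h.fibre j).card : ℝ) ≤ 11 * y := by
  have hq : (q : ℝ) = (10 * y) ^ 2 := by
    rw [mul_pow, hy, Real.sq_sqrt (by positivity)]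
    ring
  have hr : Real.sqrt q = 10 * y := by
    rw [hq, Real.sqrt_sq (by linarith)]
  have hs1 : 10 * y ≤ s := by
    have := Nat.le_ceil (Real.sqrt q)
    rwa [← hs, hr] at this
  have hs2 : (s : ℝ) ≤ 10 * y + 1 := by
    have := (Nat.ceil_lt_add_one (Real.sqrt_nonneg q)).le
    rwa [← hs, hr] at this
  refine ⟨hq, hs1, by linarith, fun j => ?_⟩
  have hs0 : (0 : ℝ) < s := by linarith
  have h1 : (q : ℝ) / s ≤ 10 * y := by
    rw [div_le_iff₀ hs0, hq]
    nlinarith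
  have h2 : 10 * y - 1 ≤ (q : ℝ) / s := by
    rw [le_div_iff₀ hs0, hq]
    nlinarith
  have h3 : (q : ℝ) / s < ⌊(q : ℝ) / s⌋₊ + 1 := Nat.lt_floor_add_one _
  have h4 : (⌊(q : ℝ) / s⌋₊ : ℝ) ≤ (q : ℝ) / s := Nat.floor_le (by positivity)
  have h5 : (⌈(q : ℝ) / s⌉₊ : ℝ) < (q : ℝ) / s + 1 := Nat.ceil_lt_add_one (by positivity)
  have h6 : (q : ℝ) / s ≤ ⌈(q : ℝ) / s⌉₊ := Nat.le_ceil _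
  unfold ProjectionScheme.fibre
  rcases h.balanced j with h7 | h7 <;> rw [h7] <;> constructor <;> linarith

namespace Bounds

variable {k Δ θ : ℕ} {α y : ℝ}

theorem deg_le (h : Bounds k Δ θ α y) : (Δ : ℝ) ≤ y ^ (k - 4) :=
  (le_div_self (Nat.cast_nonneg _) h.alpha_pos h.alpha_le).trans h.deg_div_le

theorem pow_growth {k : ℕ} (hk : 20 ≤ k) : 16000 * k ^ 3 ≤ 4 ^ (k - 2) := by
  induction k, hk using Nat.le_induction with
  | base => norm_num
  | succ k hk ih =>
    have h1 : 4 ^ (k + 1 - 2) = 4 * 4 ^ (k - 2) := by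
      rw [← pow_succ']
      congr 1
      omega
    rw [h1]
    nlinarith [Nat.pow_le_pow_left hk 2, Nat.pow_le_pow_left hk 3]

/-- The probability of a monochromatic hyperedge. -/
theorem mono_prob_mul_le (h : Bounds k Δ θ α y) :
    16000 * (k : ℝ) ^ 3 * ((1 / (8 * y)) ^ (k - 1) * y ^ (k - 3)) ≤ 1 := by
  have hy : 0 < y := by linarith [h.one_le]
  have h1 : 16000 * (k : ℝ) ^ 3 ≤ 4 ^ (k - 2) := by exact_mod_cast pow_growth h.lt.le
  have h2 : (1 / (8 * y)) ^ (k - 1) * y ^ (k - 3) ≤ (1 / 4) ^ (k - 2) := by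
    have e1 : k - 1 = (k - 3) + 2 := by have := h.lt; omega
    have e2 : k - 2 = (k - 3) + 1 := by have := h.lt; omega
    rw [e1, e2, pow_add, mul_right_comm, ← mul_pow]
    have e3 : 1 / (8 * y) * y = 1 / 8 := by field_simp
    rw [e3]
    have h3 : (1 / (8 * y)) ^ 2 ≤ 1 / 4 := by
      rw [div_pow, one_pow]
      exact one_div_le_one_div_of_le (by norm_num) (by nlinarith [h.one_le])
    have h4 : ((1 : ℝ) / 8) ^ (k - 3) ≤ (1 / 4) ^ (k - 3) :=
      pow_le_pow_left₀ (by norm_num) (by norm_num) _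
    rw [pow_succ]
    exact mul_le_mul h4 h3 (sq_nonneg _) (pow_nonneg (by norm_num) _)
  refine (mul_le_mul h1 h2 (by positivity) (by positivity)).trans (le_of_eq ?_)
  rw [← mul_pow]
  norm_num

theorem mono_prob_le (h : Bounds k Δ θ α y) :
    16000 * (k : ℝ) ^ 3 * ((1 / (8 * y)) ^ (k - 1) * Δ) ≤ 1 := by
  have hy : 0 < y := by linarith [h.one_le]
  refine le_trans ?_ h.mono_prob_mul_le
  have h1 : (Δ : ℝ) ≤ y ^ (k - 3) := h.deg_le.trans (pow_le_pow_right₀ h.one_le (by omega))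
  gcongr

theorem small (h : Bounds k Δ θ α y) : 8 * (1 / (8 * y)) ^ (k - 1) * (Δ * k : ℕ) ≤ 1 := by
  have hy : 0 < y := by linarith [h.one_le]
  refine le_trans ?_ h.mono_prob_le
  have hk : (1 : ℝ) ≤ k := by exact_mod_cast h.lt.le.trans' (by norm_num)
  have hk3 : (k : ℝ) ≤ k ^ 3 := le_self_pow₀ hk (by norm_num)
  have h0 : 0 ≤ (1 / (8 * y)) ^ (k - 1) * Δ := by positivity
  push_cast
  nlinarith [mul_le_mul_of_nonneg_right hk3 h0]

theorem factor_pow_le (h : Bounds k Δ θ α y) : ListPair.factor k Δ (8 * y) ^ k ≤ 2 := by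
  have hy : 0 < y := by linarith [h.one_le]
  have h1 := h.small
  set p := (1 / (8 * y)) ^ (k - 1) with hp
  have hp0 : 0 ≤ p := by positivity
  have hΔk : (1 : ℝ) ≤ (Δ * k : ℕ) := by
    have := Nat.mul_le_mul h.one_le_deg (h.lt.le.trans' (by norm_num : 1 ≤ 20))
    exact_mod_cast this
  unfold ListPair.factor
  rw [inv_pow, ← pow_mul, ← pow_mul]
  -- Bernoulli: the loss 2p · 2Δk is at most 1/2 by `small`.
  have h2 := one_add_mul_le_pow (a := -(2 * p)) (by nlinarith) (Δ * (2 * k))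
  rw [← sub_eq_add_neg] at h2
  have h3 : (1 : ℝ) / 2 ≤ (1 - 2 * p) ^ (Δ * (2 * k)) := by
    refine le_trans ?_ h2
    push_cast at h1 ⊢
    linarith
  rw [inv_le_comm₀ (by linarith) two_pos]
  linarith

theorem edgeWeight_le (h : Bounds k Δ θ α y) :
    ListPair.edgeWeight k (8 * y) * (Δ * k) ≤ 1 / 16 := by
  have hy : 0 < y := by linarith [h.one_le]
  have h1 : 16000 * (k : ℝ) ^ 3 ≤ 4 ^ (k - 2) := by exact_mod_cast pow_growth h.lt.le
  have hk : (1 : ℝ) ≤ k := by exact_mod_cast h.lt.le.trans' (by norm_num)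
  have hk3 : (k : ℝ) ≤ k ^ 3 := le_self_pow₀ hk (by norm_num)
  have h2 : (Δ : ℝ) ≤ y ^ (k - 2) := h.deg_le.trans (pow_le_pow_right₀ h.one_le (by omega))
  have e1 : 2 / (8 * y) = 1 / (4 * y) := by field_simp; norm_num
  unfold ListPair.edgeWeight
  rw [e1, div_pow, one_pow, mul_pow]
  have h4 : (0 : ℝ) < 4 ^ (k - 2) := by positivity
  have h5 : (0 : ℝ) < y ^ (k - 2) := by positivity
  rw [mul_one_div, div_mul_eq_mul_div, div_le_div_iff₀ (by positivity) (by norm_num)]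
  have h6 : (Δ : ℝ) * (32 * k) ≤ y ^ (k - 2) * 4 ^ (k - 2) :=
    mul_le_mul h2 (by linarith) (by positivity) h5.le
  linarith

/-- The weight of a block of the exploration of a cluster. -/
theorem block_weight_le (h : Bounds k Δ θ α y) {s : ℕ} (hs : 10 * y ≤ s) :
    (Δ * (Δ * (k * θ)) ^ θ : ℕ) * (s * (2 / (s : ℝ)) ^ ((k - θ) * θ)) * 2 ^ (k * θ + 1) ≤
      1 / 4 := by
  have hy : 0 < y := by linarith [h.one_le]
  have hs0 : (0 : ℝ) < s := by linarith
  have hθ1 := h.one_le_theta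
  have hθk := h.theta_le
  obtain ⟨N, hN⟩ : ∃ N, (k - θ) * θ = N + 1 := ⟨(k - θ) * θ - 1, by
    have : 1 ≤ (k - θ) * θ := Nat.one_le_iff_ne_zero.2 (by
      have : 0 < k - θ := by omega
      positivity)
    omega⟩
  have hpow := h.pow_le
  rw [hN, Nat.add_sub_cancel] at hpow
  -- One of the N + 1 factors 2/s pays for the choice of the common bucket of a block.
  have h1 : (s : ℝ) * (2 / (s : ℝ)) ^ (N + 1) ≤ 2 * (1 / (5 * y)) ^ N := by
    have e1 : (s : ℝ) * (2 / (s : ℝ)) ^ (N + 1) = 2 * (2 / (s : ℝ)) ^ N := by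
      rw [pow_succ]
      field_simp
    rw [e1]
    refine mul_le_mul_of_nonneg_left (pow_le_pow_left₀ (by positivity) ?_ _) (by norm_num)
    rw [div_le_div_iff₀ hs0 (by positivity)]
    linarith
  -- `5 ^ (k - θ) ≥ 4 ^ k`
  have h2 : (4 : ℝ) ^ k ≤ 5 ^ (k - θ) := by
    have h3 : (4 ^ k) ^ 10 ≤ (5 ^ (k - θ)) ^ 10 := by
      calc (4 ^ k) ^ 10 = (4 ^ 10) ^ k := by rw [← pow_mul, ← pow_mul, mul_comm]
        _ ≤ (5 ^ 9) ^ k := Nat.pow_le_pow_left (by norm_num) _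
        _ = 5 ^ (9 * k) := by rw [← pow_mul]
        _ ≤ 5 ^ ((k - θ) * 10) := Nat.pow_le_pow_right (by norm_num) (by omega)
        _ = (5 ^ (k - θ)) ^ 10 := by rw [pow_mul]
    have := (Nat.pow_le_pow_iff_left (by norm_num : (10 : ℕ) ≠ 0)).1 h3
    exact_mod_cast this
  have h3 : ((k : ℝ) * θ) * 2 ^ k / 5 ^ (k - θ) ≤ 1 / 100 := by
    rw [div_le_div_iff₀ (by positivity) (by norm_num), one_mul]
    refine le_trans ?_ h2
    have h4 : 4 ^ k = (2 : ℝ) ^ k * 2 ^ k := by rw [← mul_pow]; norm_num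
    have h5 : ((k : ℝ) * θ) * 100 ≤ 2 ^ k := by
      have h6 : ∀ k : ℕ, 20 ≤ k → 10 * k ^ 2 ≤ 2 ^ k := by
        intro k hk
        induction k, hk using Nat.le_induction with
        | base => norm_num
        | succ k hk ih =>
          rw [pow_succ 2]
          nlinarith
      have h7 : ((10 * k ^ 2 : ℕ) : ℝ) ≤ 2 ^ k := by exact_mod_cast h6 k h.lt.le
      have h8 : (10 : ℝ) * θ ≤ k := by
        have : 10 * θ ≤ k := by omega
        exact_mod_cast this
      push_cast at h7
      nlinarith [(Nat.cast_nonneg k : (0 : ℝ) ≤ k)]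
    rw [h4]
    have : (0 : ℝ) < 2 ^ k := by positivity
    nlinarith
  have h4 : (((k : ℝ) * θ) * 2 ^ k / 5 ^ (k - θ)) ^ θ ≤ 1 / 100 := by
    refine le_trans (pow_le_of_le_one (by positivity) (by linarith) (by omega)) h3
  have h5 : (1 : ℝ) / 5 ^ N = 5 * (1 / 5 ^ (k - θ)) ^ θ := by
    rw [div_pow, one_pow, ← pow_mul, hN, pow_succ]
    field_simp
  have e2 : ((Δ * (Δ * (k * θ)) ^ θ : ℕ) : ℝ) = (Δ : ℝ) ^ (θ + 1) * (k * θ) ^ θ := by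
    push_cast
    rw [mul_pow, pow_succ]
    ring
  rw [e2, hN]
  -- The powers of y cancel against the bound for Δ^(θ+1); what remains is at most 20 · 1/100.
  calc (Δ : ℝ) ^ (θ + 1) * (k * θ) ^ θ * (s * (2 / (s : ℝ)) ^ (N + 1)) * 2 ^ (k * θ + 1)
      ≤ y ^ N * (k * θ) ^ θ * (2 * (1 / (5 * y)) ^ N) * 2 ^ (k * θ + 1) := by gcongr
    _ = 4 * ((k * θ) ^ θ * (2 ^ k) ^ θ * (1 / 5 ^ N)) := by
        rw [one_div, inv_pow, mul_pow 5 y, pow_succ, pow_mul]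
        field_simp
        norm_num
    _ = 20 * (((k : ℝ) * θ) * 2 ^ k / 5 ^ (k - θ)) ^ θ := by
        rw [h5, ← mul_pow, div_eq_mul_one_div _ ((5 : ℝ) ^ (k - θ)), mul_pow _ (1 / _)]
        ring
    _ ≤ 1 / 4 := by linarith

end Bounds

end Numerics

/-! ### The parameters of the algorithm -/

section Parameters

variable {n k Δ θ q : ℕ} {α y ε : ℝ}

theorem exp_neg_two_mul_le {x : ℝ} (hx0 : 0 ≤ x) (hx : x ≤ 1 / 2) : Real.exp (-(2 * x)) ≤ 1 - x := by
  rw [Real.exp_neg, inv_le_comm₀ (Real.exp_pos _) (by linarith)]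
  refine le_trans ?_ (Real.add_one_le_exp (2 * x))
  rw [inv_le_iff_one_le_mul₀ (by linarith)]
  nlinarith

namespace Bounds

theorem eta_eq (h : Bounds k Δ θ α y) (hy : y = √((q : ℝ) / 100)) :
    eta k Δ q = y ^ (k - 3) / Δ := by
  have hk := h.lt
  rw [eta, hy, Real.sqrt_eq_rpow, ← Real.rpow_natCast, ← Real.rpow_mul (by positivity),
    Nat.cast_sub (by omega), one_div_mul_eq_div]
  congr 2
  push_cast
  ring

/-- This keeps the exponent 1/(1000η) in the number of trials below α/1000. -/
theorem inv_le_eta (h : Bounds k Δ θ α y) (hy : y = √((q : ℝ) / 100)) : 1 / α ≤ eta k Δ q := by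
  have hΔ : (0 : ℝ) < Δ := by exact_mod_cast h.one_le_deg
  rw [h.eta_eq hy, div_le_div_iff₀ h.alpha_pos hΔ, one_mul, ← div_le_iff₀ h.alpha_pos]
  exact h.deg_div_le.trans (pow_le_pow_right₀ h.one_le (by omega))

theorem eta_pos (h : Bounds k Δ θ α y) (hy : y = √((q : ℝ) / 100)) : 0 < eta k Δ q :=
  (one_div_pos.2 h.alpha_pos).trans_le (h.inv_le_eta hy)

/-- The rejection sampling fails with small probability. -/
theorem failure_le (h : Bounds k Δ θ α y) (hy : y = √((q : ℝ) / 100)) (hn : 1 ≤ n) {ζ : ℝ}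
    (hζ : 0 < ζ) (hζ1 : ζ ≤ 1) :
    (1 - (1 - 2 * (1 / (8 * y)) ^ (k - 1)) ^ ⌊sizeBound n k Δ ζ⌋₊) ^ numTrials n k Δ q ζ ≤
      ζ / n := by
  have hy0 : 0 < y := by linarith [h.one_le]
  have hη := h.eta_pos hy
  have hΔ : (1 : ℝ) ≤ Δ := by exact_mod_cast h.one_le_deg
  have hn' : (1 : ℝ) ≤ n := by exact_mod_cast hn
  set p := (1 / (8 * y)) ^ (k - 1) with hp
  have hp0 : 0 ≤ p := by positivity
  have hnζ : 1 ≤ n / ζ := by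
    rw [le_div_iff₀ hζ]
    linarith
  have hnΔζ : 1 ≤ n * Δ / ζ := by
    rw [le_div_iff₀ hζ]
    nlinarith
  set L := Real.log (n * Δ / ζ) with hL
  have hL0 : 0 ≤ L := Real.log_nonneg hnΔζ
  have hl0 : 0 ≤ Real.log (n / ζ) := Real.log_nonneg hnζ
  set K := sizeBound n k Δ ζ with hK
  have hKL : K = 4 * Δ * (k : ℝ) ^ 3 * L := rfl
  have hK0 : 0 ≤ K := by rw [hKL]; positivity
  have hp1 : 2 * p ≤ 1 / 2 := by
    have h1 := h.small
    have h2 : (1 : ℝ) ≤ (Δ * k : ℕ) := by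
      exact_mod_cast Nat.mul_le_mul h.one_le_deg (h.lt.le.trans' (by norm_num : 1 ≤ 20))
    nlinarith
  -- The constant 16000 in `mono_prob_mul_le` is the product of the 4 here, the 4 in `sizeBound` and
  -- the 1000 in `numTrials`.
  have hpK : 4 * p * K ≤ L * (1 / (1000 * eta k Δ q)) := by
    rw [mul_one_div, le_div_iff₀ (by positivity), hKL, h.eta_eq hy]
    have h1 := mul_le_mul_of_nonneg_right h.mono_prob_mul_le hL0
    refine le_trans (le_of_eq ?_) (h1.trans_eq (one_mul L))
    field_simp
    ring
  have ha : Real.exp (-(L * (1 / (1000 * eta k Δ q)))) ≤ (1 - 2 * p) ^ ⌊K⌋₊ := by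
    refine le_trans ?_ (pow_le_pow_left₀ (Real.exp_pos _).le
      (exp_neg_two_mul_le (by positivity) hp1) _)
    rw [← Real.exp_nat_mul]
    refine Real.exp_le_exp.2 ?_
    have := Nat.floor_le hK0
    nlinarith
  set a := (1 - 2 * p) ^ ⌊K⌋₊ with ha'
  have ha1 : a ≤ 1 := pow_le_one₀ (by linarith) (by linarith)
  have hR : 10 * Real.exp (L * (1 / (1000 * eta k Δ q))) * Real.log (n / ζ) ≤
      numTrials n k Δ q ζ := by
    refine le_trans (le_of_eq ?_) (Nat.le_ceil _)
    rw [Real.rpow_def_of_pos (by linarith)]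
  -- The exponentials in the acceptance probability and in the number of trials cancel, so R trials
  -- make the failure probability at most e^(-log(n/ζ)).
  have haR : Real.log (n / ζ) ≤ a * numTrials n k Δ q ζ := by
    refine le_trans ?_ (mul_le_mul ha hR (by positivity) ((Real.exp_pos _).le.trans ha))
    rw [mul_comm (10 : ℝ), mul_assoc, ← mul_assoc, ← Real.exp_add, neg_add_cancel, Real.exp_zero]
    linarith
  calc (1 - a) ^ numTrials n k Δ q ζ ≤ Real.exp (-a) ^ numTrials n k Δ q ζ :=
        pow_le_pow_left₀ (by linarith) (Real.one_sub_le_exp_neg a) _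
    _ = Real.exp (-(a * numTrials n k Δ q ζ)) := by
        rw [← Real.exp_nat_mul]
        congr 1
        ring
    _ ≤ Real.exp (-Real.log (n / ζ)) := Real.exp_le_exp.2 (neg_le_neg haR)
    _ = ζ / n := by rw [Real.exp_neg, Real.exp_log (by linarith), inv_div]

end Bounds

theorem three_le_log {x : ℝ} (hx : 21 ≤ x) : 3 ≤ Real.log x := by
  rw [Real.le_log_iff_exp_le (by linarith)]
  have h1 := Real.exp_one_lt_d9
  have h2 : Real.exp 3 = Real.exp 1 ^ 3 := by
    rw [← Real.exp_nat_mul]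
    norm_num
  rw [h2]
  have h3 : Real.exp 1 ^ 3 ≤ 2.72 ^ 3 :=
    pow_le_pow_left₀ (Real.exp_pos 1).le (by linarith) 3
  norm_num at h3
  linarith

theorem one_quarter_pow_le (l : ℕ) : (1 / 4 : ℝ) ^ l ≤ Real.exp (-l) := by
  have h1 : (1 / 4 : ℝ) ≤ Real.exp (-1) := by
    rw [Real.exp_neg, one_div, inv_le_inv₀ (by norm_num) (Real.exp_pos 1)]
    linarith [Real.exp_one_lt_d9]
  refine (pow_le_pow_left₀ (by norm_num) h1 l).trans (le_of_eq ?_)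
  rw [← Real.exp_nat_mul]
  congr 1
  ring

theorem one_half_pow_le (l : ℕ) : (1 / 2 : ℝ) ^ l ≤ Real.exp (-(l / 2)) := by
  have h1 : (1 / 2 : ℝ) ≤ Real.exp (-(1 / 2)) := by
    have := Real.add_one_le_exp (-(1 / 2) : ℝ)
    linarith
  refine (pow_le_pow_left₀ (by norm_num) h1 l).trans (le_of_eq ?_)
  rw [← Real.exp_nat_mul]
  congr 1
  ring

theorem le_numSteps (hn : 21 ≤ n) (hΔ : 1 ≤ Δ) (hε : 0 < ε) (hε1 : ε < 1) :
    3 ≤ Real.log (2 * n * Δ / ε) ∧ (150 : ℝ) * n ≤ numSteps n Δ ε := by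
  have hn' : (21 : ℝ) ≤ n := by exact_mod_cast hn
  have hΔ' : (1 : ℝ) ≤ Δ := by exact_mod_cast hΔ
  have h1 : 3 ≤ Real.log (2 * n * Δ / ε) := by
    refine three_le_log ?_
    rw [le_div_iff₀ hε]
    nlinarith
  refine ⟨h1, le_trans ?_ (Nat.le_ceil _)⟩
  nlinarith

/-- The scan is long enough. -/
theorem mixing_le (hn : 21 ≤ n) (hΔ : 1 ≤ Δ) (hε : 0 < ε) (hε1 : ε < 1) :
    n * (1 / 2 : ℝ) ^ (numSteps n Δ ε / n) ≤ ε / 2 := by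
  have hn' : (21 : ℝ) ≤ n := by exact_mod_cast hn
  have hΔ' : (1 : ℝ) ≤ Δ := by exact_mod_cast hΔ
  obtain ⟨h1, -⟩ := le_numSteps hn hΔ hε hε1
  set L := Real.log (2 * n * Δ / ε) with hL
  set j := numSteps n Δ ε / n with hj
  -- Rounding loses less than one sweep, and 50L - 1 sweeps are far more than the 2L that are used.
  have h2 : 50 * L ≤ j + 1 := by
    have h3 : numSteps n Δ ε < n * (j + 1) := Nat.lt_mul_div_succ _ (by omega)
    have h4 : (numSteps n Δ ε : ℝ) ≤ n * (j + 1) := by exact_mod_cast h3.le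
    have h5 : 50 * n * L ≤ numSteps n Δ ε := Nat.le_ceil _
    refine le_of_mul_le_mul_left ?_ (by linarith : (0 : ℝ) < n)
    linarith
  have h3 : (1 / 2 : ℝ) ^ j ≤ ε / (2 * n * Δ) := by
    refine (one_half_pow_le j).trans ?_
    have h4 : Real.exp (-(j / 2 : ℝ)) ≤ Real.exp (-L) := Real.exp_le_exp.2 (by linarith)
    refine h4.trans (le_of_eq ?_)
    rw [Real.exp_neg, hL, Real.exp_log (by positivity), inv_div]
  refine (mul_le_mul_of_nonneg_left h3 (by positivity)).trans ?_
  rw [mul_div_assoc', div_le_div_iff₀ (by positivity) two_pos]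
  nlinarith [mul_pos hε (by linarith : (0 : ℝ) < n)]

/-- The total error of the approximate updates. -/
theorem total_error_le (h : Bounds k Δ θ α y) (hn : 21 ≤ n) (hε : 0 < ε) (hε1 : ε < 1) {ζ : ℝ}
    (hζ : ζ = ε / (4 * numSteps n Δ ε)) :
    0 < ζ ∧ ζ ≤ 1 ∧ ∃ l : ℕ, (1 + k * θ * l) * (Δ * θ) ≤ sizeBound n k Δ ζ ∧
      (numSteps n Δ ε + n) * (ζ / n + 2 * (1 / 4) ^ l) ≤ ε / 2 := by
  have hn' : (21 : ℝ) ≤ n := by exact_mod_cast hn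
  have hΔ' : (1 : ℝ) ≤ Δ := by exact_mod_cast h.one_le_deg
  obtain ⟨-, hT⟩ := le_numSteps hn h.one_le_deg hε hε1
  set T := numSteps n Δ ε
  have hT0 : (1 : ℝ) ≤ T := by linarith
  have hζ0 : 0 < ζ := by rw [hζ]; positivity
  have hζ1 : ζ ≤ 1 := by
    rw [hζ, div_le_one (by positivity)]
    linarith
  have hx : 21 ≤ n * Δ / ζ := by
    rw [le_div_iff₀ hζ0]
    nlinarith
  have hL3 := three_le_log hx
  set L := Real.log (n * Δ / ζ) with hL
  have hl1 : 2 * L ≤ ⌈2 * L⌉₊ := Nat.le_ceil _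
  have hl2 : (⌈2 * L⌉₊ : ℝ) < 2 * L + 1 := Nat.ceil_lt_add_one (by linarith)
  -- With l ≥ 2L one gets (1/4)^l ≤ e^(-2L) = (ζ/(nΔ))², while l < 2L + 1 keeps the exploration
  -- below the threshold `sizeBound`.
  refine ⟨hζ0, hζ1, ⌈2 * L⌉₊, ?_, ?_⟩
  · set l : ℝ := (⌈2 * L⌉₊ : ℝ)
    have hθk : (θ : ℝ) ≤ k := by
      have := h.theta_le
      exact_mod_cast (by omega : θ ≤ k)
    have hθ : (1 : ℝ) ≤ θ := by exact_mod_cast h.one_le_theta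
    have hl : 1 + l ≤ 4 * L := by linarith
    change _ ≤ 4 * Δ * (k : ℝ) ^ 3 * L
    calc (1 + k * θ * l) * (Δ * θ) ≤ (k * θ * 1 + k * θ * l) * (Δ * θ) := by
          gcongr
          rw [mul_one]
          nlinarith
      _ = (k * θ * θ * Δ) * (1 + l) := by ring
      _ ≤ (k * k * k * Δ) * (4 * L) := by gcongr
      _ = 4 * Δ * (k : ℝ) ^ 3 * L := by ring
  · have h1 : 2 * (1 / 4 : ℝ) ^ ⌈2 * L⌉₊ ≤ ζ / n := by
      have h2 : (1 / 4 : ℝ) ^ ⌈2 * L⌉₊ ≤ Real.exp (-L) * Real.exp (-L) := by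
        refine (one_quarter_pow_le _).trans ?_
        rw [← Real.exp_add]
        exact Real.exp_le_exp.2 (by linarith)
      have h3 : Real.exp (-L) = ζ / (n * Δ) := by
        rw [Real.exp_neg, hL, Real.exp_log (by linarith), inv_div]
      have h4 : ζ / (n * Δ) ≤ 1 / 2 := by
        rw [div_le_div_iff₀ (by positivity) two_pos]
        nlinarith
      have h5 : ζ / (n * Δ) ≤ ζ / n := by
        refine div_le_div_of_nonneg_left hζ0.le (by linarith) ?_
        nlinarith
      rw [h3] at h2
      have h6 : 0 ≤ ζ / (n * Δ) := by positivity
      nlinarith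
    have h2 : T * ζ = ε / 4 := by
      rw [hζ]
      field_simp
    calc (T + n) * (ζ / n + 2 * (1 / 4 : ℝ) ^ ⌈2 * L⌉₊)
        ≤ (2 * T) * (ζ / n + ζ / n) := by
          gcongr
          linarith
      _ = 4 * (T * ζ) / n := by ring
      _ ≤ ε / 2 := by
          rw [h2, div_le_iff₀ (by linarith)]
          nlinarith

end Parameters

/-! ### The running time -/

section RunningTime

variable {n k Δ θ q : ℕ} {α y ε : ℝ}

/-- The search contributes order Δ²k⁵Λ, and rejection order (PΛ)(Δk⁴Λ)Λ: trials, times vertices of a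
component, times the cost of a draw. P stands for (nΔ/ε)^(α/100). -/
theorem vertexCost_le {k Δ c K R : ℕ} {Λ P : ℝ} (hk : 20 < k) (hΔ : 1 ≤ Δ) (hΛ : 1 ≤ Λ) (hP : 1 ≤ P)
    (hc : (c : ℝ) ≤ 3 * Λ) (hK : (K : ℝ) ≤ 20 * Δ * k ^ 3 * Λ) (hR : (R : ℝ) ≤ 51 * P * Λ) :
    2 + (c : ℝ) + (vertexCost k Δ c K R : ℕ) ≤ 8000 * Δ ^ 2 * k ^ 5 * P * Λ ^ 3 := by
  have hk' : (20 : ℝ) ≤ k := by exact_mod_cast hk.le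
  have hk1 : (1 : ℝ) ≤ k := by linarith
  have hΔ' : (1 : ℝ) ≤ Δ := by exact_mod_cast hΔ
  unfold vertexCost componentCost
  push_cast
  set U : ℝ := Δ ^ 2 * k ^ 5 * P * Λ ^ 3 with hU
  have hΔ2 : (Δ : ℝ) ≤ Δ ^ 2 := le_self_pow₀ hΔ' (by norm_num)
  have e1 : Δ * (k : ℝ) ^ 4 * Λ ^ 2 * (P * Λ) ≤ U := by
    calc Δ * (k : ℝ) ^ 4 * Λ ^ 2 * (P * Λ) ≤ Δ ^ 2 * (k : ℝ) ^ 5 * Λ ^ 2 * (P * Λ) := by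
          gcongr
          norm_num
      _ = U := by rw [hU]; ring
  have e2 : Δ ^ 2 * (k : ℝ) ^ 5 * Λ ≤ U := by
    calc Δ ^ 2 * (k : ℝ) ^ 5 * Λ = Δ ^ 2 * (k : ℝ) ^ 5 * 1 * Λ ^ 1 := by ring
      _ ≤ Δ ^ 2 * (k : ℝ) ^ 5 * P * Λ ^ 3 := by
          gcongr
          norm_num
  have e3 : Λ ≤ U := by
    have h1 : (1 : ℝ) ≤ Δ ^ 2 * k ^ 5 := by
      have := one_le_pow₀ hΔ' (n := 2)
      have := one_le_pow₀ hk1 (n := 5)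
      nlinarith
    refine le_trans ?_ e2
    nlinarith
  have hk4 : (1 : ℝ) ≤ Δ * k ^ 4 * Λ := by
    have := one_le_pow₀ hk1 (n := 4)
    have h2 : (1 : ℝ) ≤ Δ * k ^ 4 := by nlinarith
    nlinarith
  have hkK : (k : ℝ) * K ≤ 20 * (Δ * k ^ 4 * Λ) := by
    calc (k : ℝ) * K ≤ k * (20 * Δ * k ^ 3 * Λ) := by gcongr
      _ = 20 * (Δ * k ^ 4 * Λ) := by ring
  have b1 : (2 + (k : ℝ) * K) * (1 + Δ * (2 * k + 1)) ≤ 88 * U := by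
    have h1 : 1 + (Δ : ℝ) * (2 * k + 1) ≤ 4 * (Δ * k) := by nlinarith
    calc (2 + (k : ℝ) * K) * (1 + Δ * (2 * k + 1))
        ≤ (22 * (Δ * k ^ 4 * Λ)) * (4 * (Δ * k)) := by
          gcongr
          linarith
      _ = 88 * (Δ ^ 2 * (k : ℝ) ^ 5 * Λ) := by ring
      _ ≤ 88 * U := by linarith
  have b2 : 1 + (1 + (k : ℝ) * K) * (1 + c) + K * (k + 1) ≤ 125 * (Δ * k ^ 4 * Λ ^ 2) := by
    have h1 : (1 + (k : ℝ) * K) * (1 + c) ≤ (21 * (Δ * k ^ 4 * Λ)) * (4 * Λ) := by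
      gcongr <;> linarith
    have h2 : (K : ℝ) * (k + 1) ≤ 40 * (Δ * k ^ 4 * Λ) := by
      have : (K : ℝ) ≤ k * K := by nlinarith [(Nat.cast_nonneg K : (0 : ℝ) ≤ K)]
      linarith
    have h3 : Δ * (k : ℝ) ^ 4 * Λ ≤ Δ * k ^ 4 * Λ ^ 2 := by
      gcongr
      exact le_self_pow₀ hΛ (by norm_num)
    nlinarith
  have b3 : (R : ℝ) * (1 + (1 + (k : ℝ) * K) * (1 + c) + K * (k + 1)) ≤ 6375 * U := by
    calc (R : ℝ) * (1 + (1 + (k : ℝ) * K) * (1 + c) + K * (k + 1))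
        ≤ (51 * P * Λ) * (125 * (Δ * k ^ 4 * Λ ^ 2)) := by gcongr
      _ = 6375 * (Δ * (k : ℝ) ^ 4 * Λ ^ 2 * (P * Λ)) := by ring
      _ ≤ 6375 * U := by linarith
  have : 8000 * (Δ : ℝ) ^ 2 * k ^ 5 * P * Λ ^ 3 = 8000 * U := by rw [hU]; ring
  rw [this]
  linarith

theorem colourCost_le (hq : 100 ≤ q) : (colourCost q : ℝ) ≤ 2 * Real.log q + 1 := by
  have hq' : (0 : ℝ) < q := by exact_mod_cast (by omega : 0 < q)
  have h1 : ((2 : ℝ) ^ Nat.log 2 q) ≤ q := by exact_mod_cast Nat.pow_log_le_self 2 (by omega)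
  have h2 := Real.log_le_log (by positivity) h1
  rw [Real.log_pow] at h2
  have h3 := Real.log_two_gt_d9
  have h4 : (0 : ℝ) ≤ Nat.log 2 q := Nat.cast_nonneg _
  unfold colourCost
  push_cast
  nlinarith

/-- Bounds in terms of `B = n Δ / ε` and `Λ = log (n Δ q / ε)`. -/
theorem scan_bounds (h : Bounds k Δ θ α y) (hn : 21 ≤ n)
    (hq : 100 ≤ q) (hε : 0 < ε) (hε1 : ε < 1) {ζ B Λ : ℝ} (hζ : ζ = ε / (4 * numSteps n Δ ε))
    (hB : B = n * Δ / ε) (hΛ : Λ = Real.log (n * Δ * q / ε)) :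
    21 ≤ B ∧ 3 ≤ Λ ∧ Real.log q ≤ Λ ∧ (numSteps n Δ ε : ℝ) ≤ 51 * (n * Λ) ∧
      1 ≤ n * Δ / ζ ∧ n * Δ / ζ ≤ B ^ 5 ∧ Real.log (n * Δ / ζ) ≤ 5 * Λ := by
  have hn' : (21 : ℝ) ≤ n := by exact_mod_cast hn
  have hq' : (100 : ℝ) ≤ q := by exact_mod_cast hq
  have hΔ' : (1 : ℝ) ≤ Δ := by exact_mod_cast h.one_le_deg
  obtain ⟨hL3, hT⟩ := le_numSteps hn h.one_le_deg hε hε1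
  obtain ⟨hζ0, hζ1, -⟩ := total_error_le h hn hε hε1 hζ
  set T := numSteps n Δ ε with hTdef
  have hB21 : 21 ≤ B := by
    rw [hB, le_div_iff₀ hε]
    nlinarith
  have hnB : (n : ℝ) ≤ B := by
    rw [hB, le_div_iff₀ hε]
    nlinarith
  have hqB : (n : ℝ) * Δ * q / ε = B * q := by
    rw [hB]
    ring
  have hBΛ : Real.log B ≤ Λ := by
    rw [hΛ, hqB]
    exact Real.log_le_log (by linarith) (by nlinarith)
  have hqΛ : Real.log q ≤ Λ := by
    rw [hΛ, hqB]
    exact Real.log_le_log (by linarith) (by nlinarith)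
  have hΛ3 : 3 ≤ Λ := (three_le_log hB21).trans hBΛ
  have h2B : 2 * (n : ℝ) * Δ / ε = 2 * B := by
    rw [hB]
    ring
  have hL'Λ : Real.log (2 * n * Δ / ε) ≤ Λ := by
    rw [hΛ, hqB, h2B]
    exact Real.log_le_log (by linarith) (by nlinarith)
  have hT1 : (T : ℝ) ≤ 50 * n * Real.log (2 * n * Δ / ε) + 1 :=
    (Nat.ceil_lt_add_one (by positivity)).le
  have hTΛ : (T : ℝ) ≤ 51 * (n * Λ) := by nlinarith
  have hTB : (T : ℝ) ≤ 101 * B ^ 2 := by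
    have h1 : Real.log (2 * n * Δ / ε) ≤ 2 * B := by
      rw [h2B]
      exact (Real.log_le_sub_one_of_pos (by linarith)).trans (by linarith)
    have h2 : (n : ℝ) * Real.log (2 * n * Δ / ε) ≤ B * (2 * B) :=
      mul_le_mul hnB h1 (by linarith) (by linarith)
    nlinarith
  have hx : (n : ℝ) * Δ / ζ = 4 * T * B := by
    rw [hζ, hB]
    have : (0 : ℝ) < T := by linarith
    field_simp
  have hxB : (n : ℝ) * Δ / ζ ≤ B ^ 5 := by
    rw [hx]
    have h1 : 4 * (T : ℝ) * B ≤ 404 * B ^ 3 := by nlinarith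
    -- Here 404 ≤ 21² ≤ B².
    have h2 : 404 * B ^ 3 ≤ B ^ 2 * B ^ 3 := by
      refine mul_le_mul_of_nonneg_right ?_ (by positivity)
      nlinarith
    refine h1.trans (h2.trans_eq ?_)
    ring
  have hx1 : 1 ≤ (n : ℝ) * Δ / ζ := by
    rw [le_div_iff₀ hζ0]
    nlinarith
  have hL : Real.log (n * Δ / ζ) ≤ 5 * Λ := by
    have := Real.log_le_log (by linarith) hxB
    rw [Real.log_pow] at this
    push_cast at this
    linarith
  exact ⟨hB21, hΛ3, hqΛ, hTΛ, hx1, hxB, hL⟩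

theorem call_bounds (h : Bounds k Δ θ α y) (hy : y = √((q : ℝ) / 100)) (hn : 21 ≤ n)
    {ζ B Λ : ℝ} (hζ0 : 0 < ζ) (hζ1 : ζ ≤ 1) (hB21 : 21 ≤ B) (hΛ3 : 3 ≤ Λ) (hx1 : 1 ≤ n * Δ / ζ)
    (hxB : n * Δ / ζ ≤ B ^ 5) (hL : Real.log (n * Δ / ζ) ≤ 5 * Λ) :
    1 ≤ B ^ (α / 100) ∧ (numTrials n k Δ q ζ : ℝ) ≤ 51 * B ^ (α / 100) * Λ ∧
      ((⌊sizeBound n k Δ ζ⌋₊ : ℕ) : ℝ) ≤ 20 * Δ * k ^ 3 * Λ := by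
  have hn' : (21 : ℝ) ≤ n := by exact_mod_cast hn
  have hΔ' : (1 : ℝ) ≤ Δ := by exact_mod_cast h.one_le_deg
  set P := B ^ (α / 100) with hP
  have hα := h.alpha_pos
  have hP1 : 1 ≤ P := Real.one_le_rpow (by linarith) (by positivity)
  have hη := h.inv_le_eta hy
  have hη0 := h.eta_pos hy
  have hxP : ((n : ℝ) * Δ / ζ) ^ (1 / (1000 * eta k Δ q)) ≤ P := by
    refine (Real.rpow_le_rpow (by linarith) hxB (by positivity)).trans ?_
    rw [← Real.rpow_natCast, ← Real.rpow_mul (by linarith), hP]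
    refine Real.rpow_le_rpow_of_exponent_le (by linarith) ?_
    -- The fifth power of B turns the exponent into 5/(1000η) ≤ α/200.
    have h1 : 1 / eta k Δ q ≤ α := by
      rw [div_le_iff₀ hη0]
      rw [div_le_iff₀ hα] at hη
      linarith
    have h2 : ((5 : ℕ) : ℝ) * (1 / (1000 * eta k Δ q)) = 1 / 200 * (1 / eta k Δ q) := by
      push_cast
      field_simp
      norm_num
    rw [h2]
    linarith
  have hnζ : Real.log (n / ζ) ≤ 5 * Λ := by
    refine le_trans (Real.log_le_log (by positivity) ?_) hL
    refine div_le_div_of_nonneg_right ?_ hζ0.le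
    nlinarith
  have hnζ0 : 0 ≤ Real.log (n / ζ) := by
    refine Real.log_nonneg ?_
    rw [le_div_iff₀ hζ0]
    linarith
  have hR : (numTrials n k Δ q ζ : ℝ) ≤ 51 * P * Λ := by
    have h1 : (numTrials n k Δ q ζ : ℝ) ≤
        10 * ((n : ℝ) * Δ / ζ) ^ (1 / (1000 * eta k Δ q)) * Real.log (n / ζ) + 1 :=
      (Nat.ceil_lt_add_one (by positivity)).le
    have h2 : 10 * ((n : ℝ) * Δ / ζ) ^ (1 / (1000 * eta k Δ q)) * Real.log (n / ζ) ≤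
        10 * P * (5 * Λ) := by gcongr
    have h3 : 1 ≤ P * Λ := by nlinarith
    linarith
  have hK : ((⌊sizeBound n k Δ ζ⌋₊ : ℕ) : ℝ) ≤ 20 * Δ * k ^ 3 * Λ := by
    have h0 : 0 ≤ Real.log (n * Δ / ζ) := Real.log_nonneg hx1
    refine (Nat.floor_le (by unfold sizeBound; positivity)).trans ?_
    unfold sizeBound
    have : 4 * (Δ : ℝ) * k ^ 3 * Real.log (n * Δ / ζ) ≤ 4 * Δ * k ^ 3 * (5 * Λ) := by gcongr
    linarith
  exact ⟨hP1, hR, hK⟩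

theorem time_bound (h : Bounds k Δ θ α y) (hy : y = √((q : ℝ) / 100)) (hn : 21 ≤ n)
    (hq : 100 ≤ q) (hε : 0 < ε) (hε1 : ε < 1) {ζ : ℝ} (hζ : ζ = ε / (4 * numSteps n Δ ε)) :
    ((2 + n * (1 + colourCost q) + (numSteps n Δ ε + n) * (2 + colourCost q +
      vertexCost k Δ (colourCost q) ⌊sizeBound n k Δ ζ⌋₊ (numTrials n k Δ q ζ)) : ℕ) : ℝ) ≤
      1000000 * ((Δ : ℝ) ^ 2 * (k : ℝ) ^ 5 * n * ((n : ℝ) * Δ / ε) ^ (α / 100) *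
            Real.log (n * Δ * q / ε) ^ 4) := by
  have hn' : (21 : ℝ) ≤ n := by exact_mod_cast hn
  have hΔ' : (1 : ℝ) ≤ Δ := by exact_mod_cast h.one_le_deg
  have hk' : (1 : ℝ) ≤ k := by exact_mod_cast h.lt.le.trans' (by norm_num)
  obtain ⟨hζ0, hζ1, -⟩ := total_error_le h hn hε hε1 hζ
  obtain ⟨hB21, hΛ3, hqΛ, hTΛ, hx1, hxB, hL⟩ := scan_bounds h hn hq hε hε1 hζ rfl rfl
  obtain ⟨hP1, hR, hK⟩ := call_bounds h hy hn hζ0 hζ1 hB21 hΛ3 hx1 hxB hL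
  generalize Real.log (n * Δ * q / ε) = Λ at *
  generalize ((n : ℝ) * Δ / ε) ^ (α / 100) = P at *
  have hc : (colourCost q : ℝ) ≤ 3 * Λ := (colourCost_le hq).trans (by linarith)
  have hV := vertexCost_le h.lt h.one_le_deg (by linarith) hP1 hc hK hR
  push_cast
  set V : ℝ := 2 + (colourCost q : ℝ) +
    (vertexCost k Δ (colourCost q) ⌊sizeBound n k Δ ζ⌋₊ (numTrials n k Δ q ζ) : ℕ)
  set U : ℝ := Δ ^ 2 * k ^ 5 * P * Λ ^ 3 with hU
  have hΔk : (1 : ℝ) ≤ Δ ^ 2 * k ^ 5 := by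
    have := one_le_pow₀ hΔ' (n := 2)
    have := one_le_pow₀ hk' (n := 5)
    nlinarith
  have hU1 : 1 ≤ U := by
    have h1 : 1 ≤ Λ ^ 3 := one_le_pow₀ (by linarith)
    have h2 : 1 ≤ Δ ^ 2 * (k : ℝ) ^ 5 * P := by nlinarith
    rw [hU]
    nlinarith
  have hΛ0 : 0 < n * Λ := by positivity
  -- T + n ≤ 52nΛ; the total 52 · 8000 + 5 stays below 10⁶.
  have h1 : ((numSteps n Δ ε : ℝ) + n) * V ≤ (52 * (n * Λ)) * (8000 * U) := by
    refine mul_le_mul ?_ ?_ (by positivity) (by positivity)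
    · nlinarith
    · refine hV.trans (le_of_eq ?_)
      rw [hU]
      ring
  have h2 : 2 + (n : ℝ) * (1 + colourCost q) ≤ 5 * (n * Λ) := by nlinarith
  have h3 : n * Λ ≤ n * Λ * U := by nlinarith
  have h4 : (Δ : ℝ) ^ 2 * (k : ℝ) ^ 5 * n * P * Λ ^ 4 = n * Λ * U := by
    rw [hU]
    ring
  rw [h4]
  linarith

end RunningTime

/-! ### Incidence lists of a simple uniform hypergraph -/

section Hypergraphs

variable {n m q : ℕ} {H : Hypergraph (Fin n)} {k Δ : ℕ}

theorem IncidenceLists.coe_ed (I : IncidenceLists H m) (e : Fin m) :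
    (I.ed e : Set (Fin n)) = {v | v ∈ I.verts e} := by
  ext v
  simp [IncidenceLists.ed]

theorem IncidenceLists.ed_mem (I : IncidenceLists H m) (e : Fin m) :
    (I.ed e : Set (Fin n)) ∈ H.edgeSet := by
  rw [I.coe_ed]
  exact I.bijOn.mapsTo (Set.mem_univ e)

theorem IncidenceLists.exists_ed (I : IncidenceLists H m) {s : Set (Fin n)} (hs : s ∈ H.edgeSet) :
    ∃ e, (I.ed e : Set (Fin n)) = s := by
  obtain ⟨e, -, he⟩ := I.bijOn.surjOn hs
  exact ⟨e, by rw [I.coe_ed]; exact he⟩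

theorem IncidenceLists.coe_ed_injective (I : IncidenceLists H m) :
    Function.Injective fun e => (I.ed e : Set (Fin n)) := fun e f hef =>
  I.bijOn.injOn (Set.mem_univ e) (Set.mem_univ f) (by simpa only [I.coe_ed] using hef)

theorem IncidenceLists.linearFamily (I : IncidenceLists H m) (hV : H.vertexSet = Set.univ)
    (hk : IsUniform H k) (hs : IsSimple H) (hΔ : HasMaxDegree H Δ) : LinearFamily I.ed k Δ where
  card e := by
    rw [← hk _ (I.ed_mem e), Set.ncard_coe_finset]
  simple e f hef := by
    have h1 := hs _ (I.ed_mem e) _ (I.ed_mem f) fun h => hef (I.coe_ed_injective h)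
    rw [Finset.card_le_one]
    intro a ha b hb
    exact h1 (by simpa using ha) (by simpa using hb)
  deg v := by
    have h1 : degree H v ≤ Δ := hΔ.2 ⟨v, by rw [hV]; exact Set.mem_univ v, rfl⟩
    refine le_trans ?_ h1
    rw [← Set.ncard_coe_finset, degree]
    refine Set.ncard_le_ncard_of_injOn (fun e => (I.ed e : Set (Fin n))) (fun e he => ?_)
      I.coe_ed_injective.injOn (Set.toFinite _)
    exact ⟨I.ed_mem e, by simpa using he⟩

/-- A hyperedge exists since Δ ≥ 1. With k > 20 this supplies the n ≥ 21 of the numerical estimates.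
-/
theorem le_card_of_hasMaxDegree (hk : IsUniform H k)
    (hΔ : HasMaxDegree H Δ) (hΔ1 : 1 ≤ Δ) : k ≤ n := by
  obtain ⟨v, -, hv⟩ := hΔ.1
  have h1 : {e ∈ H.edgeSet | v ∈ e}.Nonempty := by
    rw [← Set.ncard_pos]
    exact hΔ1.trans_eq hv
  obtain ⟨s, hs, -⟩ := h1
  rw [← hk s hs]
  exact (Set.ncard_le_card s).trans_eq (Nat.card_fin n)

theorem IncidenceLists.isProper_iff (I : IncidenceLists H m) (X : Fin n → Fin q) :
    IsProper H X ↔ Good I.ed X := by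
  constructor
  · rintro h e - ⟨c, hc⟩
    exact h _ (I.ed_mem e) ⟨c, fun v hv => hc v (by simpa using hv)⟩
  · rintro h s hs ⟨c, hc⟩
    obtain ⟨e, rfl⟩ := I.exists_ed hs
    exact h e (Finset.mem_univ e) ⟨c, fun v hv => hc v (by simpa using hv)⟩

theorem IncidenceLists.mem_properColourings (I : IncidenceLists H m) {X : Fin n → Fin q} :
    X ∈ properColourings H q ↔ Good I.ed X := by
  simp [properColourings, I.isProper_iff]

theorem uniformEx_eq (I : IncidenceLists H m) (hq : 0 < q)
    (hne : (properColourings H q).Nonempty) (g : (Fin n → Fin q) → ℝ) :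
    uniformEx I q g =
      ∑ X, (PMF.uniformOfFinset (properColourings H q) hne X).toReal * g X := by
  have : Nonempty (Fin q) := ⟨⟨0, hq⟩⟩
  have h1 : ∀ X : Fin n → Fin q,
      ind (Good I.ed X) = if X ∈ properColourings H q then 1 else 0 := fun X => by
    split_ifs with hX
    · exact ind_true (I.mem_properColourings.1 hX)
    · exact ind_false fun h => hX (I.mem_properColourings.2 h)
  rw [uniformEx, cond_eq_sum _ fun _ => Finset.univ_nonempty, Fintype.piFinset_univ]
  simp only [h1, mul_ite, mul_one, mul_zero, Finset.sum_ite_mem, Finset.univ_inter,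
    PMF.uniformOfFinset_apply, apply_ite ENNReal.toReal, ENNReal.toReal_inv, ENNReal.toReal_natCast,
    ENNReal.toReal_zero, ite_mul, zero_mul, Finset.sum_const, nsmul_eq_mul]
  rw [← Finset.mul_sum, div_eq_inv_mul]

theorem Regime.properColourings_nonempty {s : ℕ} {I : IncidenceLists H m}
    {h : ProjectionScheme q s} {b : ℝ} (hR : Regime I h k Δ b) :
    (properColourings H q).Nonempty := by
  by_contra hne
  rw [Finset.not_nonempty_iff_eq_empty] at hne
  have h1 := (hR.listPair (fun _ => none) fun _ => none).avg_pos₁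
  have h2 : ∀ X : Fin n → Fin q, ind (Good I.ed X) = 0 := fun X => ind_false fun hX => by
    have := I.mem_properColourings.2 hX
    rw [hne] at this
    exact absurd this (Finset.notMem_empty X)
  simp only [h2, avg_const (lists_nonempty h _), lt_irrefl] at h1

theorem Bounds.regime {s θ : ℕ} {α y : ℝ} (hB : Bounds k Δ θ α y) {I : IncidenceLists H m}
    (hI : LinearFamily I.ed k Δ) {h : ProjectionScheme q s}
    (hf : ∀ j, 8 * y ≤ (h.fibre j).card) : Regime I h k Δ (8 * y) where
  family := hI
  two_le := hB.lt.le.trans' (by norm_num)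
  one_le := hB.one_le_deg
  pos := by linarith [hB.one_le]
  fibre := hf
  small := by
    have hy := hB.one_le
    refine le_trans ?_ hB.small
    gcongr
    norm_num

end Hypergraphs

end HypergraphSampling

end

/-! ### Assembly of the estimates -/

open HypergraphSampling
theorem theorem2 :
    ∃ C : ℝ, 0 < C ∧
      ∀ (δ α : ℝ), 0 < δ → 0 < α → α ≤ 1 →
      ∀ (ε : ℝ), 0 < ε → ε < 1 →
      ∀ (n m k Δ q : ℕ) [NeZero n] (H : Hypergraph (Fin n)) (I : IncidenceLists H m)
        (h : ProjectionScheme q ⌈Real.sqrt q⌉₊),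
        H.vertexSet = Set.univ → IsUniform H k → IsSimple H → HasMaxDegree H Δ → 1 ≤ Δ →
        20 * (1 + δ) / δ ≤ (k : ℝ) →
        100 * ((Δ : ℝ) / α) ^ ((2 + δ) / ((k : ℝ) - 4 / δ - 4)) ≤ (q : ℝ) →
        (∃ hne : (properColourings H q).Nonempty,
          tvDist (samplingAlgorithm I h k Δ ε).output
            (PMF.uniformOfFinset (properColourings H q) hne) ≤ ε) ∧
        (samplingAlgorithm I h k Δ ε).RunsIn
          (C * ((Δ : ℝ) ^ 2 * (k : ℝ) ^ 5 * n * ((n : ℝ) * Δ / ε) ^ (α / 100) *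
            Real.log (n * Δ * q / ε) ^ 4)) := by
  refine ⟨1000000, by norm_num, ?_⟩
  intro δ α hδ hα hα1 ε hε hε1 n m k Δ q _ H I h hV hk hs hΔ hΔ1 hkδ hqδ
  set y := √((q : ℝ) / 100) with hy
  have hB := bounds_of_le hδ hα hα1 hΔ1 hkδ hqδ
  set θ := ⌈2 / δ⌉₊
  obtain ⟨hq, hs1, hs2, hfib⟩ := bucket_bounds h rfl hy hB.one_le
  have hy1 : 1 ≤ y := hB.one_le
  have hR := hB.regime (I.linearFamily hV hk hs hΔ) fun j => (hfib j).1
  have hn : 21 ≤ n := hB.lt.trans_le (le_card_of_hasMaxDegree hk hΔ hΔ1)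
  have hq100 : 100 ≤ q := by
    have : (100 : ℝ) ≤ q := by nlinarith
    exact_mod_cast this
  obtain ⟨hζ0, hζ1, l, hK, herr⟩ := total_error_le hB hn hε hε1 rfl
  have hK0 := le_trans (by positivity) hK
  refine ⟨⟨hR.properColourings_nonempty, tvDist_le fun g hg => ?_⟩, ?_⟩
  · rw [← RandComp.ex_eq_sum _ hg, ← uniformEx_eq I (by omega)]
    have hs0 : (0 : ℝ) < ⌈√(q : ℝ)⌉₊ := by linarith
    have hsπ : 1 / (⌈√(q : ℝ)⌉₊ : ℝ) ≤ 2 / ⌈√(q : ℝ)⌉₊ := by gcongr; norm_num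
    have hπ1 : 2 / (⌈√(q : ℝ)⌉₊ : ℝ) ≤ 1 := by
      rw [div_le_one hs0]
      linarith
    have hp : 3 / 4 ≤ (1 - 2 * (1 / (8 * y)) ^ (k - 1)) ^ Δ := by
      have h1 := hB.small
      have h0 : 0 ≤ (1 / (8 * y)) ^ (k - 1) := by positivity
      set p := (1 / (8 * y)) ^ (k - 1)
      have hk1 : (1 : ℝ) ≤ k := by exact_mod_cast hB.lt.le.trans' (by norm_num)
      have hΔ1' : (1 : ℝ) ≤ Δ := by exact_mod_cast hΔ1
      push_cast at h1
      have h2 : 8 * p * Δ ≤ 1 := by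
        refine le_trans ?_ h1
        have : (Δ : ℝ) ≤ Δ * k := by nlinarith
        gcongr
      have h3 := one_add_mul_le_pow (a := -(2 * p)) (by nlinarith) Δ
      rw [← sub_eq_add_neg] at h3
      refine le_trans ?_ h3
      linarith
    -- The rounding of s and of the fibres and the local-lemma factor 3/4 all fit into the 2 of π =
    -- 2/s, because 11 ≤ 150/11.
    have hπ : ∀ j, ((h.fibre j).card : ℝ) ≤
        2 / (⌈√(q : ℝ)⌉₊ : ℝ) * (1 - 2 * (1 / (8 * y)) ^ (k - 1)) ^ Δ * q := by
      intro j
      have h1 : 2 / (11 * y) ≤ 2 / (⌈√(q : ℝ)⌉₊ : ℝ) := by gcongr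
      have h2 : 11 * y ≤ 2 / (11 * y) * (3 / 4) * (10 * y) ^ 2 := by
        have : 2 / (11 * y) * (3 / 4) * (10 * y) ^ 2 = 150 / 11 * y := by
          field_simp
          norm_num
        rw [this]
        linarith
      refine (hfib j).2.trans (h2.trans ?_)
      rw [← hq]
      gcongr
    have h1 := hR.ex_samplingAlgorithm_le hB.factor_pow_le hB.edgeWeight_le hsπ hπ1 hπ
      (by norm_num) (hB.block_weight_le hs1) rfl hK (hB.failure_le hy (by omega) hζ0 hζ1) hg
    -- Mixing uses ε/2; truncation and large clusters use the other half by `herr`.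
    have h2 := mixing_le hn hΔ1 hε hε1
    linarith
  · refine ((hR.time_samplingAlgorithm hK0).mono fun _ t ht => ?_).runsIn
    refine le_trans ?_ (time_bound hB hy hn hq100 hε hε1 rfl)
    exact_mod_cast ht
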